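/- Let $d\ge 1$ be an integer and let $\alpha$ be real with $\frac{8}{d}<\alpha$, and $\alpha<\frac{8}{d-4}$ if $d\ge 5$. Put $\gamma_c=\frac d2-\frac4\alpha\in(0,2)$ and $\alpha_c=\frac{d\alpha}{4}=\frac{2d}{d-2\gamma_c}$. All functions are complex valued on $\mathbb R^d$, and $\|f\|_{\dot H^\gamma}=\||\nabla|^\gamma f\|_{L^2}$, where $|\nabla|=(-\Delta)^{1/2}$ and $|\nabla|^\gamma f$ is taken modulo polynomials, i.e. in the dual of the space of Schwartz functions whose Fourier transform vanishes to infinite order at $0$; an element of $\dot H^{\gamma_c}\cap\dot H^2$ is identified with its unique representative whose Fourier transform is a locally integrable function. Define \[ A_{\mathrm{GN}}=\sup\left\{\frac{\|f\|_{L^{\alpha+2}}^{\alpha+2}}{\|f\|_{\dot H^{\gamma_c}}^{\alpha}\|f\|_{\dot H^2}^2}:\ 0\ne f\in\dot H^{\gamma_c}\cap\dot H^2\right\},\qquad B_{\mathrm{GN}}=\sup\left\{\frac{\|f\|_{L^{\alpha+2}}^{\alpha+2}}{\|f\|_{L^{\alpha_c}}^{\alpha}\|f\|_{\dot H^2}^2}:\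 0\ne f\in L^{\alpha_c}\cap\dot H^2\right\}. \] Then $A_{\mathrm{GN}},B_{\mathrm{GN}}\in(0,\infty)$; they are thus the sharp constants in the Gagliardo--Nirenberg inequalities $\|f\|_{L^{\alpha+2}}^{\alpha+2}\le A_{\mathrm{GN}}\|f\|_{\dot H^{\gamma_c}}^{\alpha}\|f\|_{\dot H^2}^2$ for $f\in\dot H^{\gamma_c}\cap\dot H^2$ and $\|f\|_{L^{\alpha+2}}^{\alpha+2}\le B_{\mathrm{GN}}\|f\|_{L^{\alpha_c}}^{\alpha}\|f\|_{\dot H^2}^2$ for $f\in L^{\alpha_c}\cap\dot H^2$. Moreover: (1) The supremum $A_{\mathrm{GN}}$ is attained at a function $U\in\dot H^{\gamma_c}\cap\dot H^2$ of the form $U(x)=a\,Q(\lambda x+x_0)$ with $a\in\mathbb C\setminus\{0\}$, $\lambda>0$, $x_0\in\mathbb R^d$, where $Q\in\dot H^{\gamma_c}\cap\dot H^2$ solves, in the sense of tempered distributions, \[ \Delta^2Q+(-\Delta)^{\gamma_c}Q-|Q|^\alpha Q=0, \] and $A_{\mathrm{GN}}=\frac{\alpha+2}{2}\|Q\|_{\dot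 H^{\gamma_c}}^{-\alpha}$. (2) The supremum $B_{\mathrm{GN}}$ is attained at a function $V\in L^{\alpha_c}\cap\dot H^2$ of the form $V(x)=b\,R(\mu x+y_0)$ with $b\in\mathbb C\setminus\{0\}$, $\mu>0$, $y_0\in\mathbb R^d$, where $R\in L^{\alpha_c}\cap\dot H^2$ solves, in the sense of tempered distributions, \[ \Delta^2R+|R|^{\alpha_c-2}R-|R|^\alpha R=0, \] and $B_{\mathrm{GN}}=\frac{\alpha+2}{2}\|R\|_{L^{\alpha_c}}^{-\alpha}$. -/

import Mathlib

open MeasureTheory FourierTransform Laplacian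
open scoped SchwartzMap ENNReal

noncomputable section

namespace BiharmonicGN

/-- The space `ℝ^d` with its Euclidean norm and Lebesgue measure. -/
abbrev Space (d : ℕ) : Type := EuclideanSpace ℝ (Fin d)

/-- `γ_c = d/2 - 4/α`. -/
def critSobolev (d : ℕ) (α : ℝ) : ℝ := (d : ℝ) / 2 - 4 / α

/-- `α_c = dα/4 = 2d/(d - 2γ_c)`. -/
def critLebesgue (d : ℕ) (α : ℝ) : ℝ := (d : ℝ) * α / 4

/-- The `L^p` norm (possibly infinite) for a real exponent `p`. -/
def lpNorm {d : ℕ} (p : ℝ) (f : Space d → ℂ) : ℝ≥0∞ :=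
  eLpNorm f (ENNReal.ofReal p) volume

/-- `|∇|^s φ = (-Δ)^{s/2} φ` for a test function `φ`: the Fourier multiplier with symbol
`|2πξ|^s` (the Fourier transform here has kernel `exp(-2πi x·ξ)`). -/
def absGrad {d : ℕ} (s : ℝ) (φ : 𝓢(Space d, ℂ)) : Space d → ℂ :=
  𝓕⁻ (fun ξ : Space d => (((2 * Real.pi * ‖ξ‖) ^ s : ℝ) : ℂ) * 𝓕 (φ : Space d → ℂ) ξ)

/-- The space `𝓢₀` of Schwartz functions all of whose Fourier transform's derivatives vanish
at the origin. -/
def schwartzZero (d : ℕ) : Set 𝓢(Space d, ℂ) :=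
  {φ | ∀ n : ℕ, iteratedFDeriv ℝ n (𝓕 (φ : Space d → ℂ)) 0 = 0}

/-- `f` is a function that defines a tempered distribution by integration. -/
def IsTempered {d : ℕ} (f : Space d → ℂ) : Prop :=
  AEStronglyMeasurable f volume ∧ ∀ φ : 𝓢(Space d, ℂ), Integrable (fun x => f x * φ x) volume

/-- The distributional Fourier transform of `f` is a locally integrable function. -/
def HasLocIntFourier {d : ℕ} (f : Space d → ℂ) : Prop :=
  ∃ G : Space d → ℂ, LocallyIntegrable G volume ∧
    ∀ φ : 𝓢(Space d, ℂ), HasCompactSupport φ →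
      ∫ x, f x * 𝓕 (φ : Space d → ℂ) x = ∫ ξ, G ξ * φ ξ

/-- `|∇|^γ f = g` in `𝓢₀'`, with `g ∈ L²`. -/
def IsAbsGrad {d : ℕ} (γ : ℝ) (f g : Space d → ℂ) : Prop :=
  MemLp g 2 volume ∧
    ∀ φ ∈ schwartzZero d, ∫ x, f x * absGrad γ φ x = ∫ x, g x * φ x

/-- The homogeneous Sobolev norm `‖f‖_{Ḣ^γ} = ‖|∇|^γ f‖_{L²}`, infinite if `|∇|^γ f ∉ L²`. -/
def hdotNorm {d : ℕ} (γ : ℝ) (f : Space d → ℂ) : ℝ≥0∞ :=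
  ⨅ (g : Space d → ℂ) (_ : IsAbsGrad γ f g), eLpNorm g 2 volume

/-- `Ḣ^γ ∩ Ḣ²` (for `γ < d/2`). Elements of `Ḣ^γ` are classes in `𝓢₀' = 𝓢'/polynomials`;
as usual, a class is identified with its one representative whose Fourier transform is a locally
integrable function. -/
def sobolevSpace (d : ℕ) (γ : ℝ) : Set (Space d → ℂ) :=
  {f | IsTempered f ∧ HasLocIntFourier f ∧ hdotNorm γ f < ∞ ∧ hdotNorm 2 f < ∞}

/-- `L^p ∩ Ḣ²`. -/
def lebesgueSpace (d : ℕ) (p : ℝ) : Set (Space d → ℂ) :=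
  {f | MemLp f (ENNReal.ofReal p) volume ∧ hdotNorm 2 f < ∞}

/-- `H(f) = ‖f‖_{L^{α+2}}^{α+2} / (‖f‖_{Ḣ^{γ_c}}^α ‖f‖_{Ḣ²}²)`, with `H(0) = 0`. -/
def quotientH {d : ℕ} (α : ℝ) (f : Space d → ℂ) : ℝ≥0∞ :=
  lpNorm (α + 2) f ^ (α + 2) / (hdotNorm (critSobolev d α) f ^ α * hdotNorm 2 f ^ 2)

/-- `K(f) = ‖f‖_{L^{α+2}}^{α+2} / (‖f‖_{L^{α_c}}^α ‖f‖_{Ḣ²}²)`, with `K(0) = 0`. -/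
def quotientK {d : ℕ} (α : ℝ) (f : Space d → ℂ) : ℝ≥0∞ :=
  lpNorm (α + 2) f ^ (α + 2) / (lpNorm (critLebesgue d α) f ^ α * hdotNorm 2 f ^ 2)

/-- The sharp constant `A_GN`. -/
def sharpA (d : ℕ) (α : ℝ) : ℝ≥0∞ :=
  ⨆ f ∈ sobolevSpace d (critSobolev d α), quotientH α f

/-- The sharp constant `B_GN`. -/
def sharpB (d : ℕ) (α : ℝ) : ℝ≥0∞ :=
  ⨆ f ∈ lebesgueSpace d (critLebesgue d α), quotientK α f

/-- The power nonlinearity `|f|^p f`. -/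
def powerNL {d : ℕ} (p : ℝ) (f : Space d → ℂ) : Space d → ℂ :=
  fun x => ((‖f x‖ ^ p : ℝ) : ℂ) * f x

/-- `Δ²Q + (-Δ)^γ Q - |Q|^α Q = 0` in the sense of tempered distributions, where
`⟨(-Δ)^γ Q, φ⟩ = ∫ |∇|^γ Q · |∇|^γ φ`. -/
def SolvesSobolev {d : ℕ} (α γ : ℝ) (Q : Space d → ℂ) : Prop :=
  ∃ G : Space d → ℂ, IsAbsGrad γ Q G ∧
    ∀ φ : 𝓢(Space d, ℂ),
      Integrable (fun x => powerNL α Q x * φ x) volume ∧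
      (∫ x, Q x * Δ (Δ φ) x) + (∫ x, G x * absGrad γ φ x)
        - (∫ x, powerNL α Q x * φ x) = 0

/-- `Δ²R + |R|^{p-2} R - |R|^α R = 0` in the sense of tempered distributions. -/
def SolvesLebesgue {d : ℕ} (α p : ℝ) (R : Space d → ℂ) : Prop :=
  ∀ φ : 𝓢(Space d, ℂ),
    Integrable (fun x => powerNL (p - 2) R x * φ x) volume ∧
    Integrable (fun x => powerNL α R x * φ x) volume ∧
    (∫ x, R x * Δ (Δ φ) x) + (∫ x, powerNL (p - 2) R x * φ x)
      - (∫ x, powerNL α R x * φ x) = 0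

end BiharmonicGN

end

noncomputable section

namespace BiharmonicGN

variable {d : ℕ}

/-! ### Functions as tempered distributions -/

/-! Both sharp constants come from one argument, carried out in the abstract setting `GNSetting`: a
norm `N f = ‖u‖_{L^m}`, with `u = |∇|^γ f` and `m = 2` for the first constant, and `u = f` and `m =
q`, the critical Lebesgue exponent, for the second. In both cases `N` controls the `L^q` norm and
scales like it, so only `L^q ∩ Ḣ²` enters most estimates.

Finiteness. A smooth multiplier splits `f` at frequency `A` (`exists_decomposition`). The high part
is governed by `Δf` in `L²` with a gain `A ^ (s - 2)` in the Sobolev inequality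
`exists_sobolev_const`; the low part is a correlation with a fixed Schwartz kernel, hence a bounded
function. This gives an additive inequality, and optimizing over dilations makes it multiplicative
(`Exponents.exists_gagliardo_nirenberg`).

Attainment. Amplitude and dilation normalize both norms of a maximizing sequence to one. Its
`L^{α+2}` norms stay bounded below, so the same splitting shows that the fixed kernel detects each
member at some point (`Exponents.exists_detect`). After translating that point to the origin, local
compactness yields an a.e. limit `F ≠ 0`. All three quantities in the quotient split asymptotically
into that of `F` and that of the remainder, by the Hilbert space identity or the Brezis–Lieb lemma.
With `a`, `b` the shares of `N ^ m` and of the squared `Ḣ²` norm carried by `F`, the sharp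
inequality for both pieces gives `1 ≤ a ^ κ * b + (1 - a) ^ κ * (1 - b)` with `κ = α / m`. Since `a,
b > 0`, this forces `a = b = 1`, so nothing is lost and `F` is a maximizer
(`GNSetting.exists_maximizer`).

Equation. The defect in the sharp inequality is minimal, namely zero, at a maximizer, so its first
variation vanishes. Rescaling so that `N ^ α = (α + 2) / (2K)`, with `K` the sharp constant, and the
squared `Ḣ²` norm equals `2 * N ^ m / α` turns every coefficient into one. The first normalization
is at the same time the claimed formula for `K`.

The remaining work is caused by `|∇|^γ f` being defined only modulo polynomials. An `L²` function
has no part of its Fourier transform concentrated at the origin, so `|∇|^γ f` is unique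
(`IsAbsGrad.ae_unique`); a locally integrable Fourier transform identifies `f` as a Riesz potential
(`exists_riesz_representation`); and for `f ∈ L^q` a dilation argument shows that `-Δf = g` holds
against every Schwartz function (`IsAbsGrad.laplaceDefect_eq_zero`). -/

/-- A smooth bump equal to one on a given compact set is a Schwartz function, and integrability
against it is integrability on that set. -/
theorem IsTempered.locallyIntegrable {u : Space d → ℂ} (hu : IsTempered u) :
    LocallyIntegrable u volume := by
  rw [locallyIntegrable_iff]
  intro K hK
  obtain ⟨χ, hχ1, -, hχs, hχK⟩ := exists_contMDiff_support_eq_eq_one_iff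
    (I := modelWithCornersSelf ℝ (Space d)) (n := ⊤)
    (s := Metric.ball (0 : Space d) ((hK.isBounded.subset_ball 0).choose))
    (t := K) Metric.isOpen_ball hK.isClosed (hK.isBounded.subset_ball 0).choose_spec
  have hχc : HasCompactSupport (fun x => (χ x : ℂ)) := by
    refine HasCompactSupport.intro (K := Metric.closedBall 0 ((hK.isBounded.subset_ball 0).choose))
      (isCompact_closedBall _ _) fun x hx => ?_
    have : x ∉ Function.support χ := by
      rw [hχs]; exact fun h => hx (Metric.ball_subset_closedBall h)
    simpa using this
  have hχd : ContDiff ℝ ((⊤ : ℕ∞) : WithTop ℕ∞) (fun x => (χ x : ℂ)) :=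
    Complex.ofRealCLM.contDiff.comp (hχ1.contDiff.of_le (by exact_mod_cast le_top))
  have h := (hu.2 (hχc.toSchwartzMap hχd)).integrableOn (s := K)
  refine h.congr_fun_ae ?_
  filter_upwards [ae_restrict_mem hK.measurableSet] with x hx
  have : χ x = 1 := (hχK x).1 hx
  simp [this]

theorem toSchwartz_exists {g : Space d → ℝ} (hg : ContDiff ℝ (((⊤ : ℕ∞) : WithTop ℕ∞)) g)
    (hc : HasCompactSupport g) :
    ∃ φ : 𝓢(Space d, ℂ), HasCompactSupport φ ∧ (∀ x, φ x = (g x : ℂ)) := by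
  have hχc : HasCompactSupport (fun x => (g x : ℂ)) := hc.comp_left (g := Complex.ofReal) (by simp)
  have hχd : ContDiff ℝ ((⊤ : ℕ∞) : WithTop ℕ∞) (fun x => (g x : ℂ)) :=
    Complex.ofRealCLM.contDiff.comp hg
  exact ⟨hχc.toSchwartzMap hχd, hχc, fun x => rfl⟩

theorem ae_eq_zero_of_forall_schwartz {u : Space d → ℂ} (hu : LocallyIntegrable u volume)
    (h : ∀ φ : 𝓢(Space d, ℂ), HasCompactSupport φ → ∫ x, u x * φ x = 0) : u =ᵐ[volume] 0 := by
  refine ae_eq_zero_of_integral_contDiff_smul_eq_zero hu fun g hg hc => ?_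
  obtain ⟨φ, hφ, hφg⟩ := toSchwartz_exists hg hc
  rw [← h φ hφ]
  refine integral_congr_ae (Filter.Eventually.of_forall fun x => ?_)
  simp [hφg, mul_comm]

/-- On the complement of the origin it is enough to test with functions vanishing near `0`. -/
theorem ae_eq_zero_of_forall_schwartz_away (hd : 1 ≤ d) {u : Space d → ℂ}
    (hu : LocallyIntegrableOn u {0}ᶜ volume)
    (h : ∀ φ : 𝓢(Space d, ℂ), HasCompactSupport φ → tsupport φ ⊆ {0}ᶜ → ∫ x, u x * φ x = 0) :
    u =ᵐ[volume] 0 := by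
  have : Nonempty (Fin d) := ⟨⟨0, hd⟩⟩
  have := isOpen_compl_singleton.ae_eq_zero_of_integral_contDiff_smul_eq_zero hu
    (fun g hg hc hs => ?_)
  · filter_upwards [this, compl_mem_ae_iff.2 (measure_singleton (0 : Space d))] with x hx hx0
    exact hx hx0
  obtain ⟨φ, hφ, hφg⟩ := toSchwartz_exists hg hc
  rw [← h φ hφ]
  · refine integral_congr_ae (Filter.Eventually.of_forall fun x => ?_)
    simp [hφg, mul_comm]
  · refine subset_trans (closure_mono ?_) hs
    intro x hx
    simpa [hφg] using hx

theorem isTempered_of_memLp {u : Space d → ℂ} {p : ℝ≥0∞} (hp : 1 ≤ p) (hu : MemLp u p volume) :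
    IsTempered u := by
  refine ⟨hu.1, fun φ => ?_⟩
  have : ENNReal.HolderConjugate p (ENNReal.conjExponent p) := ENNReal.HolderConjugate.conjExponent hp
  have h2 := φ.memLp (ENNReal.conjExponent p) (μ := volume)
  exact hu.integrable_mul h2

theorem IsTempered.sub {u v : Space d → ℂ} (hu : IsTempered u) (hv : IsTempered v) :
    IsTempered (fun x => u x - v x) :=
  ⟨hu.1.sub hv.1, fun φ => by simp only [sub_mul]; exact (hu.2 φ).sub (hv.2 φ)⟩

theorem IsTempered.add {u v : Space d → ℂ} (hu : IsTempered u) (hv : IsTempered v) :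
    IsTempered (fun x => u x + v x) :=
  ⟨hu.1.add hv.1, fun φ => by simp only [add_mul]; exact (hu.2 φ).add (hv.2 φ)⟩

theorem IsTempered.const_mul {u : Space d → ℂ} (hu : IsTempered u) (c : ℂ) :
    IsTempered (fun x => c * u x) :=
  ⟨hu.1.const_mul c, fun φ => by simpa [mul_assoc] using (hu.2 φ).const_mul c⟩

/-- Two tempered functions with the same pairings agree almost everywhere. -/
theorem IsTempered.ae_eq {u v : Space d → ℂ} (hu : IsTempered u) (hv : IsTempered v)
    (h : ∀ φ : 𝓢(Space d, ℂ), ∫ x, u x * φ x = ∫ x, v x * φ x) : u =ᵐ[volume] v := by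
  have := ae_eq_zero_of_forall_schwartz (hu.sub hv).locallyIntegrable fun φ _ => by
    simp only [sub_mul]
    rw [integral_sub (hu.2 φ) (hv.2 φ), h φ, sub_self]
  filter_upwards [this] with x hx
  exact sub_eq_zero.1 hx

/-! ### Fourier pairs -/

/-- `F` is the Fourier transform of `f`, both being functions. -/
def IsFourierPair (f F : Space d → ℂ) : Prop :=
  IsTempered f ∧ IsTempered F ∧
    ∀ φ : 𝓢(Space d, ℂ), ∫ x, f x * 𝓕 (φ : Space d → ℂ) x = ∫ ξ, F ξ * φ ξ

theorem IsFourierPair.ae_eq_left {f f' F : Space d → ℂ} (h : IsFourierPair f F)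
    (h' : IsFourierPair f' F) : f =ᵐ[volume] f' := by
  refine h.1.ae_eq h'.1 fun φ => ?_
  have e : ∀ x, φ x = 𝓕 ((𝓕⁻ φ : 𝓢(Space d, ℂ)) : Space d → ℂ) x := fun x => by
    rw [← SchwartzMap.fourier_coe, fourier_fourierInv_eq]
  simp only [e]
  rw [h.2.2, h'.2.2]

theorem IsFourierPair.ae_eq_right {f F F' : Space d → ℂ} (h : IsFourierPair f F)
    (h' : IsFourierPair f F') : F =ᵐ[volume] F' :=
  h.2.1.ae_eq h'.2.1 fun φ => by rw [← h.2.2, ← h'.2.2]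

theorem IsFourierPair.add {f f' F F' : Space d → ℂ} (h : IsFourierPair f F)
    (h' : IsFourierPair f' F') : IsFourierPair (fun x => f x + f' x) (fun x => F x + F' x) := by
  refine ⟨h.1.add h'.1, h.2.1.add h'.2.1, fun φ => ?_⟩
  simp only [add_mul]
  rw [integral_add, integral_add (h.2.1.2 φ) (h'.2.1.2 φ), h.2.2, h'.2.2]
  · exact h.1.2 (𝓕 φ)
  · exact h'.1.2 (𝓕 φ)

theorem IsTempered.congr {f f' : Space d → ℂ} (h : IsTempered f) (hf : f =ᵐ[volume] f') :
    IsTempered f' :=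
  ⟨h.1.congr hf, fun φ => (h.2 φ).congr (by filter_upwards [hf] with x hx; rw [hx])⟩

theorem IsFourierPair.congr {f f' F F' : Space d → ℂ} (h : IsFourierPair f F)
    (hf : f =ᵐ[volume] f') (hF : F =ᵐ[volume] F') : IsFourierPair f' F' := by
  refine ⟨h.1.congr hf, h.2.1.congr hF, fun φ => ?_⟩
  refine Eq.trans (integral_congr_ae ?_) ((h.2.2 φ).trans (integral_congr_ae ?_))
  · filter_upwards [hf] with x hx
    rw [hx]
  · filter_upwards [hF] with x hx
    rw [hx]

/-- Plancherel's isometry agrees with the distributional transform; this allows `L²` identities and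
duality with test functions to be mixed freely. -/
theorem isFourierPair_Lp (g : Lp ℂ 2 (volume : Measure (Space d))) :
    IsFourierPair g (𝓕 g : Lp ℂ 2 (volume : Measure (Space d))) := by
  refine ⟨isTempered_of_memLp (by norm_num) (Lp.memLp g),
    isTempered_of_memLp (by norm_num) (Lp.memLp _), fun φ => ?_⟩
  have h := congrArg (fun T => T φ) (Lp.fourier_toTemperedDistribution_eq g)
  simp only [TemperedDistribution.fourier_apply, Lp.toTemperedDistribution_apply, smul_eq_mul] at h
  simpa [mul_comm, SchwartzMap.fourier_coe] using h

theorem exists_fourier_of_memLp_two {g : Space d → ℂ} (hg : MemLp g 2 volume) :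
    ∃ G : Space d → ℂ, MemLp G 2 volume ∧ IsFourierPair g G ∧
      eLpNorm G 2 volume = eLpNorm g 2 volume := by
  refine ⟨(𝓕 (hg.toLp g) : Lp ℂ 2 (volume : Measure (Space d))), Lp.memLp _,
    (isFourierPair_Lp _).congr hg.coeFn_toLp (ae_eq_refl _), ?_⟩
  have := Lp.norm_fourier_eq (hg.toLp g)
  rw [Lp.norm_def, Lp.norm_def, ENNReal.toReal_eq_toReal_iff' (Lp.memLp _).2.ne (Lp.memLp _).2.ne]
    at this
  rw [this, eLpNorm_congr_ae hg.coeFn_toLp]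

theorem exists_fourierInv_of_memLp_two {G : Space d → ℂ} (hG : MemLp G 2 volume) :
    ∃ g : Space d → ℂ, MemLp g 2 volume ∧ IsFourierPair g G ∧
      eLpNorm G 2 volume = eLpNorm g 2 volume := by
  set g : Lp ℂ 2 (volume : Measure (Space d)) := 𝓕⁻ (hG.toLp G) with hgdef
  have hg : 𝓕 g = hG.toLp G := by rw [hgdef, fourier_fourierInv_eq]
  have hp := isFourierPair_Lp g
  rw [hg] at hp
  refine ⟨g, Lp.memLp _, hp.congr (ae_eq_refl _) hG.coeFn_toLp, ?_⟩
  have := Lp.norm_fourier_eq g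
  rw [hg, Lp.norm_def, Lp.norm_def,
    ENNReal.toReal_eq_toReal_iff' (Lp.memLp _).2.ne (Lp.memLp _).2.ne] at this
  rw [← this, eLpNorm_congr_ae hG.coeFn_toLp]

theorem eLpNorm_eq_of_isFourierPair {g G : Space d → ℂ} (hg : MemLp g 2 volume)
    (h : IsFourierPair g G) : MemLp G 2 volume ∧ eLpNorm G 2 volume = eLpNorm g 2 volume := by
  obtain ⟨G', hG', hp, he⟩ := exists_fourier_of_memLp_two hg
  have := hp.ae_eq_right h
  exact ⟨hG'.ae_eq this, by rw [← he, eLpNorm_congr_ae this]⟩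

/-! ### Fourier transforms of integrable functions -/

theorem integral_fourier_mul_eq {f g : Space d → ℂ} (hf : Integrable f volume)
    (hg : Integrable g volume) : ∫ ξ, 𝓕 f ξ * g ξ = ∫ x, f x * 𝓕 g x := by
  have := VectorFourier.integral_fourierIntegral_smul_eq_flip (𝕜 := ℝ) (L := innerₗ (Space d))
    Real.continuous_fourierChar continuous_inner hf hg
  rw [flip_innerₗ] at this
  exact this

theorem norm_fourier_le (f : Space d → ℂ) (x : Space d) : ‖𝓕 f x‖ ≤ ∫ ξ, ‖f ξ‖ :=
  VectorFourier.norm_fourierIntegral_le_integral_norm _ _ _ _ _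

theorem norm_fourierInv_le (f : Space d → ℂ) (x : Space d) : ‖𝓕⁻ f x‖ ≤ ∫ ξ, ‖f ξ‖ := by
  rw [Real.fourierInv_eq_fourier_neg]
  exact norm_fourier_le _ _

theorem continuous_fourier {f : Space d → ℂ} (hf : Integrable f volume) : Continuous (𝓕 f) :=
  VectorFourier.fourierIntegral_continuous Real.continuous_fourierChar
    (by exact continuous_inner) hf

theorem continuous_fourierInv {f : Space d → ℂ} (hf : Integrable f volume) :
    Continuous (𝓕⁻ f) := by
  have : 𝓕⁻ f = fun x => 𝓕 f (-x) := by ext x; rw [Real.fourierInv_eq_fourier_neg]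
  rw [this]
  exact (continuous_fourier hf).comp continuous_neg

theorem integral_fourierInv_mul_eq {f g : Space d → ℂ} (hf : Integrable f volume)
    (hg : Integrable g volume) : ∫ ξ, 𝓕⁻ f ξ * g ξ = ∫ x, f x * 𝓕⁻ g x := by
  have h1 : 𝓕⁻ f = 𝓕 (fun x => f (-x)) := Real.fourierInv_eq_fourier_comp_neg f
  rw [h1, integral_fourier_mul_eq hf.comp_neg hg, ← integral_neg_eq_self]
  simp [Real.fourierInv_eq_fourier_neg]

theorem isTempered_of_bounded {f : Space d → ℂ} (hf : AEStronglyMeasurable f volume) {C : ℝ}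
    (hC : ∀ x, ‖f x‖ ≤ C) : IsTempered f :=
  isTempered_of_memLp le_top (memLp_top_of_bound hf C (Filter.Eventually.of_forall hC))

theorem isFourierPair_fourierInv {F : Space d → ℂ} (hF : Integrable F volume) :
    IsFourierPair (𝓕⁻ F) F := by
  refine ⟨isTempered_of_bounded (continuous_fourierInv hF).aestronglyMeasurable
    (norm_fourierInv_le F), isTempered_of_memLp le_rfl (memLp_one_iff_integrable.2 hF),
    fun φ => ?_⟩
  have hi : Integrable (𝓕 (φ : Space d → ℂ)) volume := by
    rw [← SchwartzMap.fourier_coe]; exact (𝓕 φ).integrable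
  rw [integral_fourierInv_mul_eq hF hi]
  have : 𝓕⁻ (𝓕 (φ : Space d → ℂ)) = φ := by
    rw [← SchwartzMap.fourier_coe, ← SchwartzMap.fourierInv_coe, fourierInv_fourier_eq]
  rw [this]

theorem isFourierPair_fourier {f : Space d → ℂ} (hf : Integrable f volume) :
    IsFourierPair f (𝓕 f) :=
  ⟨isTempered_of_memLp le_rfl (memLp_one_iff_integrable.2 hf),
    isTempered_of_bounded (continuous_fourier hf).aestronglyMeasurable (norm_fourier_le f),
    fun φ => (integral_fourier_mul_eq hf φ.integrable).symm⟩

/-- For functions in `L¹ ∩ L²` the integral Fourier transform is in `L²`. -/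
theorem memLp_two_fourier {f : Space d → ℂ} (hf : Integrable f volume) (hf2 : MemLp f 2 volume) :
    MemLp (𝓕 f) 2 volume :=
  (eLpNorm_eq_of_isFourierPair hf2 (isFourierPair_fourier hf)).1

/-! ### The homogeneous Sobolev inequality -/

/-- In polar coordinates the integrand is `r ^ (d - 1 - 2s)`, integrable at zero because `2s < d`.
This is the weight that Cauchy–Schwarz produces for the low frequencies. -/
theorem integral_closedBall_norm_rpow (hd : 1 ≤ d) {s : ℝ} (hs : 2 * s < d) :
    ∃ c : ℝ, 0 ≤ c ∧ ∀ A : ℝ, 0 < A →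
      ∫⁻ ξ : Space d, ENNReal.ofReal
        ((Set.Iic A).indicator (fun t : ℝ => t ^ (-(2 * s))) ‖ξ‖) =
          ENNReal.ofReal (c * A ^ ((d : ℝ) - 2 * s)) := by
  have : Nonempty (Fin d) := ⟨⟨0, hd⟩⟩
  refine ⟨d * volume.real (Metric.ball (0 : Space d) 1) / (d - 2 * s),
    div_nonneg (by positivity) (by linarith), fun A hA => ?_⟩
  set f : ℝ → ℝ := (Set.Iic A).indicator (fun t : ℝ => t ^ (-(2 * s))) with hf
  have hexp : -1 < (d : ℝ) - 1 - 2 * s := by linarith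
  have hcongr : Set.EqOn (fun y : ℝ => y ^ (d - 1) • f y)
      ((Set.Ioc 0 A).indicator fun y : ℝ => y ^ ((d : ℝ) - 1 - 2 * s)) (Set.Ioi 0) := by
    intro y hy
    have hy : 0 < y := hy
    by_cases hyA : y ≤ A
    · have h1 : y ∈ Set.Ioc 0 A := ⟨hy, hyA⟩
      have h2 : y ∈ Set.Iic A := hyA
      simp only [hf, Set.indicator_of_mem h1, Set.indicator_of_mem h2, smul_eq_mul]
      rw [← Real.rpow_natCast, ← Real.rpow_add hy]
      congr 1
      push_cast [hd]
      ring
    · have h1 : y ∉ Set.Ioc 0 A := fun h => hyA h.2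
      have h2 : y ∉ Set.Iic A := hyA
      simp only [hf, Set.indicator_of_notMem h1, Set.indicator_of_notMem h2, smul_zero]
  have hint : IntegrableOn (fun y : ℝ => y ^ ((d : ℝ) - 1 - 2 * s)) (Set.Ioc 0 A) :=
    (intervalIntegrable_iff_integrableOn_Ioc_of_le hA.le).1
      (intervalIntegral.intervalIntegrable_rpow' hexp)
  have hI : IntegrableOn (fun y : ℝ => y ^ (d - 1) • f y) (Set.Ioi 0) := by
    rw [integrableOn_congr_fun hcongr measurableSet_Ioi]
    exact (integrable_indicator_iff measurableSet_Ioc |>.2 hint).integrableOn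
  have hI' : Integrable (fun ξ : Space d => f ‖ξ‖) volume := by
    rw [integrable_fun_norm_addHaar]
    simpa using hI
  rw [← ofReal_integral_eq_lintegral_ofReal hI'
    (Filter.Eventually.of_forall fun ξ => ?_)]
  · congr 1
    rw [integral_fun_norm_addHaar]
    simp only [finrank_euclideanSpace, Fintype.card_fin]
    rw [setIntegral_congr_fun measurableSet_Ioi hcongr, setIntegral_indicator measurableSet_Ioc,
      Set.inter_eq_self_of_subset_right (fun y hy => hy.1),
      ← intervalIntegral.integral_of_le hA.le, integral_rpow (Or.inl hexp)]
    have e1 : (d : ℝ) - 1 - 2 * s + 1 = d - 2 * s := by ring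
    rw [e1, Real.zero_rpow (by linarith)]
    simp only [nsmul_eq_mul, smul_eq_mul, sub_zero]
    ring
  · simp only [hf, Set.indicator_apply]
    split_ifs
    · exact Real.rpow_nonneg (norm_nonneg _) _
    · exact le_rfl

theorem lintegral_rpow_Ioo {r b : ℝ} (hr : -1 < r) (hb : 0 ≤ b) :
    ∫⁻ t in Set.Ioo 0 b, ENNReal.ofReal (t ^ r) = ENNReal.ofReal (b ^ (r + 1) / (r + 1)) := by
  rw [restrict_Ioo_eq_restrict_Ioc, ← ofReal_integral_eq_lintegral_ofReal]
  · rw [← intervalIntegral.integral_of_le hb, integral_rpow (Or.inl hr),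
      Real.zero_rpow (by linarith), sub_zero]
  · exact (intervalIntegrable_iff_integrableOn_Ioc_of_le hb).1
      (intervalIntegral.intervalIntegrable_rpow' hr)
  · filter_upwards [ae_restrict_mem measurableSet_Ioc] with t ht
    exact Real.rpow_nonneg ht.1.le _

/-- Splitting at frequency `A`: the low-frequency part is bounded, the high-frequency part is
square integrable. -/
theorem measure_superlevel_le (hd : 1 ≤ d) {s : ℝ} (hs0 : 0 < s) {c : ℝ} (hc : 0 ≤ c)
    (hcA : ∀ A : ℝ, 0 < A → ∫⁻ ξ : Space d, ENNReal.ofReal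
        ((Set.Iic A).indicator (fun t : ℝ => t ^ (-(2 * s))) ‖ξ‖) =
          ENNReal.ofReal (c * A ^ ((d : ℝ) - 2 * s)))
    {f F : Space d → ℂ} (h : IsFourierPair f F) (hF : Measurable F) {N : ℝ} (hN : 0 ≤ N)
    (hFN : eLpNorm (fun ξ => ((‖ξ‖ ^ s : ℝ) : ℂ) * F ξ) 2 volume = ENNReal.ofReal N)
    {A t : ℝ} (hA : 0 < A) (ht : 0 < t)
    (hAt : N * (c * A ^ ((d : ℝ) - 2 * s)) ^ (1 / 2 : ℝ) ≤ t / 2) :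
    volume {x | t < ‖f x‖} ≤
      ENNReal.ofReal (4 * t ^ (-2 : ℝ)) * ∫⁻ ξ in {ξ | A < ‖ξ‖}, ‖F ξ‖ₑ ^ (2 : ℝ) := by
  set w : Space d → ℂ := fun ξ => ((‖ξ‖ ^ s : ℝ) : ℂ) * F ξ with hw
  have hwm : Measurable w := by fun_prop
  set Flo : Space d → ℂ := {ξ | ‖ξ‖ ≤ A}.indicator F with hFlo
  set Fhi : Space d → ℂ := {ξ | A < ‖ξ‖}.indicator F with hFhi
  have mlo : MeasurableSet {ξ : Space d | ‖ξ‖ ≤ A} := measurableSet_le measurable_norm measurable_const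
  have mhi : MeasurableSet {ξ : Space d | A < ‖ξ‖} := measurableSet_lt measurable_const measurable_norm
  have hsum : ∀ ξ, Flo ξ + Fhi ξ = F ξ := by
    intro ξ
    by_cases hξ : ‖ξ‖ ≤ A
    · simp [Flo, Fhi, hξ, hξ.not_gt]
    · simp [Flo, Fhi, hξ, not_le.1 hξ]
  -- the low frequency part
  have hlo : ∫⁻ ξ, ‖Flo ξ‖ₑ ≤ ENNReal.ofReal (t / 2) := by
    set k : Space d → ℝ := fun ξ => (Set.Iic A).indicator (fun t : ℝ => t ^ (-(2 * s))) ‖ξ‖ with hk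
    have hkm : Measurable k :=
      (Measurable.indicator (by fun_prop) measurableSet_Iic).comp measurable_norm
    -- Off the origin `F = (|ξ|^s F) · |ξ|^(-s)`; this factorization is fed to Cauchy–Schwarz.
    have h1 : ∀ᵐ ξ ∂volume, ‖Flo ξ‖ₑ ≤ ‖w ξ‖ₑ * ENNReal.ofReal (k ξ ^ (1 / 2 : ℝ)) := by
      have : Nonempty (Fin d) := ⟨⟨0, hd⟩⟩
      filter_upwards [compl_mem_ae_iff.2 (measure_singleton (0 : Space d))] with ξ hξ0
      have hξ0 : 0 < ‖ξ‖ := norm_pos_iff.2 hξ0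
      by_cases hξ : ‖ξ‖ ≤ A
      · have h2 : ξ ∈ {ξ : Space d | ‖ξ‖ ≤ A} := hξ
        have h3 : ‖ξ‖ ∈ Set.Iic A := hξ
        simp only [hFlo, hk, Set.indicator_of_mem h2, Set.indicator_of_mem h3, hw]
        rw [← Real.rpow_mul hξ0.le, ← ofReal_norm, ← ofReal_norm,
          ← ENNReal.ofReal_mul (norm_nonneg _), norm_mul, Complex.norm_real,
          Real.norm_of_nonneg (by positivity)]
        refine ENNReal.ofReal_le_ofReal (le_of_eq ?_)
        rw [mul_right_comm, ← Real.rpow_add hξ0]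
        ring_nf
        simp
      · have h2 : ξ ∉ {ξ : Space d | ‖ξ‖ ≤ A} := hξ
        simp [hFlo, Set.indicator_of_notMem h2]
    calc ∫⁻ ξ, ‖Flo ξ‖ₑ ≤ ∫⁻ ξ, ‖w ξ‖ₑ * ENNReal.ofReal (k ξ ^ (1 / 2 : ℝ)) := lintegral_mono_ae h1
      _ ≤ (∫⁻ ξ, ‖w ξ‖ₑ ^ (2 : ℝ)) ^ (1 / 2 : ℝ) *
          (∫⁻ ξ, ENNReal.ofReal (k ξ ^ (1 / 2 : ℝ)) ^ (2 : ℝ)) ^ (1 / 2 : ℝ) :=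
        ENNReal.lintegral_mul_le_Lp_mul_Lq volume Real.HolderConjugate.two_two
          hwm.enorm.aemeasurable (by fun_prop)
      _ = ENNReal.ofReal N * ENNReal.ofReal (c * A ^ ((d : ℝ) - 2 * s)) ^ (1 / 2 : ℝ) := by
        congr 1
        · rw [← hFN, eLpNorm_eq_lintegral_rpow_enorm_toReal (by norm_num) (by norm_num)]
          simp
        · rw [← hcA A hA]
          congr 1
          refine lintegral_congr fun ξ => ?_
          have hk0 : 0 ≤ k ξ := by
            simp only [hk, Set.indicator_apply]
            split_ifs
            · exact Real.rpow_nonneg (norm_nonneg _) _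
            · exact le_rfl
          rw [ENNReal.ofReal_rpow_of_nonneg (by positivity) (by norm_num), ← Real.rpow_mul hk0]
          norm_num [hk]
      _ ≤ ENNReal.ofReal (t / 2) := by
        rw [ENNReal.ofReal_rpow_of_nonneg (by positivity) (by norm_num), ← ENNReal.ofReal_mul hN]
        exact ENNReal.ofReal_le_ofReal hAt
  have hloi : Integrable Flo volume :=
    ⟨(hF.indicator mlo).aestronglyMeasurable, lt_of_le_of_lt hlo ENNReal.ofReal_lt_top⟩
  have hlob : ∀ x, ‖𝓕⁻ Flo x‖ ≤ t / 2 := fun x => by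
    refine (norm_fourierInv_le Flo x).trans ?_
    rw [integral_norm_eq_lintegral_enorm hloi.1]
    exact ENNReal.toReal_le_of_le_ofReal (by positivity) hlo
  -- the high frequency part
  have hw2 : MemLp w 2 volume := ⟨hwm.aestronglyMeasurable, by rw [hFN]; exact ENNReal.ofReal_lt_top⟩
  have hhi2 : MemLp Fhi 2 volume := by
    refine MemLp.of_le_mul (c := A ^ (-s)) hw2 (hF.indicator mhi).aestronglyMeasurable
      (Filter.Eventually.of_forall fun ξ => ?_)
    by_cases hξ : A < ‖ξ‖
    · have h2 : ξ ∈ {ξ : Space d | A < ‖ξ‖} := hξ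
      have hξ0 : 0 < ‖ξ‖ := hA.trans hξ
      rw [hFhi, Set.indicator_of_mem h2, hw]
      simp only [norm_mul, Complex.norm_real]
      rw [Real.norm_of_nonneg (by positivity), ← mul_assoc]
      refine le_mul_of_one_le_left (norm_nonneg _) ?_
      rw [Real.rpow_neg hA.le, inv_mul_eq_div, one_le_div (by positivity)]
      exact Real.rpow_le_rpow hA.le hξ.le hs0.le
    · have h2 : ξ ∉ {ξ : Space d | A < ‖ξ‖} := hξ
      rw [hFhi, Set.indicator_of_notMem h2, norm_zero]
      positivity
  obtain ⟨fhi, hfhi2, hfhi, hnorm⟩ := exists_fourierInv_of_memLp_two hhi2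
  have hdec : f =ᵐ[volume] fun x => 𝓕⁻ Flo x + fhi x :=
    h.ae_eq_left (((isFourierPair_fourierInv hloi).add hfhi).congr (ae_eq_refl _)
      (Filter.Eventually.of_forall hsum))
  -- The low part never exceeds `t / 2`, so `‖f x‖ > t` forces the high part above `t / 2`;
  -- Chebyshev and Plancherel then conclude.
  have hsub : volume {x | t < ‖f x‖} ≤ volume {x | ENNReal.ofReal (t / 2) ≤ ‖fhi x‖ₑ} := by
    refine measure_mono_ae ?_
    filter_upwards [hdec] with x hx htx
    have htx : t < ‖f x‖ := htx
    change ENNReal.ofReal (t / 2) ≤ ‖fhi x‖ₑ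
    rw [← ofReal_norm]
    refine ENNReal.ofReal_le_ofReal ?_
    have := norm_add_le (𝓕⁻ Flo x) (fhi x)
    rw [← hx] at this
    linarith [hlob x]
  refine hsub.trans ((meas_ge_le_mul_pow_eLpNorm_enorm volume (p := 2) (by norm_num) (by norm_num) hfhi2.1
    (by simpa using ht) (fun h => absurd h ENNReal.ofReal_ne_top)).trans (le_of_eq ?_))
  rw [← hnorm, eLpNorm_eq_lintegral_rpow_enorm_toReal (by norm_num) (by norm_num)]
  simp only [ENNReal.toReal_ofNat]
  rw [← ENNReal.rpow_mul]
  norm_num only [ENNReal.rpow_one]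
  congr 1
  · rw [← ENNReal.ofReal_inv_of_pos (by positivity),
      ENNReal.ofReal_rpow_of_nonneg (by positivity) (by norm_num)]
    congr 1
    rw [Real.rpow_neg ht.le]
    norm_num
    field_simp
    norm_num
  · rw [← lintegral_indicator mhi]
    refine lintegral_congr fun ξ => ?_
    by_cases hξ : A < ‖ξ‖
    · simp [hFhi, hξ]
    · simp [hFhi, hξ]


/-- The homogeneous Sobolev inequality `Ḣˢ ⊂ L^{2d/(d-2s)}`, `0 < s < d/2`. -/
theorem exists_sobolev_const (hd : 1 ≤ d) {s p : ℝ} (hs0 : 0 < s) (hs : 2 * s < d)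
    (hp : p = 2 * d / (d - 2 * s)) :
    ∃ C : ℝ, 0 < C ∧ ∀ f F : Space d → ℂ, IsFourierPair f F →
      eLpNorm f (ENNReal.ofReal p) volume ≤
        ENNReal.ofReal C * eLpNorm (fun ξ => ((‖ξ‖ ^ s : ℝ) : ℂ) * F ξ) 2 volume := by
  obtain ⟨c, hc, hcA⟩ := integral_closedBall_norm_rpow (d := d) hd hs
  have hds : 0 < (d : ℝ) - 2 * s := by linarith
  have hd0 : (0 : ℝ) < d := by linarith
  have hp2 : 2 < p := by
    rw [hp, lt_div_iff₀ hds]; linarith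
  have hp0 : 0 < p := by linarith
  -- This identity between exponents is what turns the final frequency integral into the squared
  -- `Ḣˢ` norm.
  have hexp : ((d : ℝ) - 2 * s) / 2 * (p - 2) = 2 * s := by
    rw [hp]; field_simp; ring
  set e : ℝ := ((d : ℝ) - 2 * s) / 2 with he
  have he0 : 0 < e := by positivity
  -- `2 * N * b` bounds twice the low-frequency part at frequency one
  set b : ℝ := c ^ (1 / 2 : ℝ) + 1 with hb
  have hb0 : 0 < b := by positivity
  refine ⟨(p * (4 * ((2 * b) ^ (p - 2) / (p - 2)))) ^ (1 / p),
    Real.rpow_pos_of_pos (by have := sub_pos.2 hp2; positivity) _, fun f F h => ?_⟩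
  have hC0 : 0 < p * (4 * ((2 * b) ^ (p - 2) / (p - 2))) := by
    have := sub_pos.2 hp2; positivity
  wlog hFm : Measurable F generalizing F
  · have hF := h.2.1.1
    have := this (hF.mk F) (h.congr (ae_eq_refl _) hF.ae_eq_mk) hF.stronglyMeasurable_mk.measurable
    refine this.trans (le_of_eq (congrArg _ (eLpNorm_congr_ae ?_)))
    filter_upwards [hF.ae_eq_mk] with x hx
    rw [hx]
  set w : Space d → ℂ := fun ξ => ((‖ξ‖ ^ s : ℝ) : ℂ) * F ξ with hw
  have hwm : Measurable w := by fun_prop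
  by_cases htop : eLpNorm w 2 volume = ∞
  · rw [htop, ENNReal.mul_top]
    · exact le_top
    · simpa using Real.rpow_pos_of_pos hC0 _
  set N : ℝ := (eLpNorm w 2 volume).toReal with hNdef
  have hN : eLpNorm w 2 volume = ENNReal.ofReal N := (ENNReal.ofReal_toReal htop).symm
  by_cases hN0 : N = 0
  · rw [hN0, ENNReal.ofReal_zero, eLpNorm_eq_zero_iff hwm.aestronglyMeasurable (by norm_num)] at hN
    have : Nonempty (Fin d) := ⟨⟨0, hd⟩⟩
    have hF0 : F =ᵐ[volume] 0 := by
      filter_upwards [hN, compl_mem_ae_iff.2 (measure_singleton (0 : Space d))] with ξ hξ hξ0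
      have hξ0 : 0 < ‖ξ‖ := norm_pos_iff.2 hξ0
      have : (‖ξ‖ ^ s : ℝ) ≠ 0 := (Real.rpow_pos_of_pos hξ0 _).ne'
      simpa [hw, this] using hξ
    have hf0 : f =ᵐ[volume] 0 := by
      refine (h.congr (ae_eq_refl _) hF0).ae_eq_left ?_
      refine ⟨isTempered_of_memLp le_top MemLp.zero, isTempered_of_memLp le_top MemLp.zero, ?_⟩
      simp
    rw [eLpNorm_congr_ae hf0, eLpNorm_zero]
    exact zero_le
  have hNpos : 0 < N := lt_of_le_of_ne ENNReal.toReal_nonneg (Ne.symm hN0)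
  set K : ℝ := 2 * b * N with hK
  have hK0 : 0 < K := by positivity
  -- The cutoff frequency depends on the level: `A` solves `K * A ^ e = t`, which keeps the low part
  -- below `t / 2`.
  have hlevel : ∀ t : ℝ, 0 < t → volume {x | t < ‖f x‖} ≤
      ENNReal.ofReal (4 * t ^ (-2 : ℝ)) *
        ∫⁻ ξ in {ξ : Space d | t < K * ‖ξ‖ ^ e}, ‖F ξ‖ₑ ^ (2 : ℝ) := by
    intro t ht
    have hA : 0 < (t / K) ^ (1 / e) := by positivity
    have hAe : ((t / K) ^ (1 / e)) ^ e = t / K := by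
      rw [← Real.rpow_mul (by positivity), one_div_mul_cancel he0.ne', Real.rpow_one]
    have := measure_superlevel_le hd hs0 hc hcA h hFm hNpos.le hN hA ht ?_
    · have hset : {ξ : Space d | (t / K) ^ (1 / e) < ‖ξ‖} = {ξ | t < K * ‖ξ‖ ^ e} := by
        ext ξ
        simp only [Set.mem_ofPred_eq]
        rw [← Real.rpow_lt_rpow_iff hA.le (norm_nonneg ξ) he0, hAe, div_lt_iff₀ hK0, mul_comm K]
      rwa [hset] at this
    · have h1 : (c * ((t / K) ^ (1 / e)) ^ ((d : ℝ) - 2 * s)) ^ (1 / 2 : ℝ) =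
          c ^ (1 / 2 : ℝ) * (t / K) := by
        rw [Real.mul_rpow hc (by positivity), ← Real.rpow_mul hA.le]
        have : ((d : ℝ) - 2 * s) * (1 / 2) = e := by rw [he]; ring
        rw [this, hAe]
      rw [h1]
      calc N * (c ^ (1 / 2 : ℝ) * (t / K)) ≤ N * (b * (t / K)) := by
            have : c ^ (1 / 2 : ℝ) ≤ b := by rw [hb]; linarith
            gcongr
        _ = t / 2 := by rw [hK]; field_simp
  -- Layer-cake formula followed by Tonelli: for fixed `ξ` the levels run over `0 < t < K * ‖ξ‖ ^
  -- e`, where `t ^ (p - 3)` is integrable because `p > 2`.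
  have hmain : ∫⁻ x, ‖f x‖ₑ ^ p ≤
      ENNReal.ofReal (p * (4 * ((2 * b) ^ (p - 2) / (p - 2))) * N ^ p) := by
    have hcake := lintegral_rpow_eq_lintegral_meas_lt_mul volume (f := fun x => ‖f x‖)
      (Filter.Eventually.of_forall fun x => norm_nonneg _) h.1.1.norm.aemeasurable hp0
    have e1 : ∀ x, ‖f x‖ₑ ^ p = ENNReal.ofReal (‖f x‖ ^ p) := fun x => by
      rw [← ofReal_norm, ENNReal.ofReal_rpow_of_nonneg (norm_nonneg _) hp0.le]
    simp only [e1]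
    rw [hcake]
    set S : Set (ℝ × Space d) := {z | z.1 < K * ‖z.2‖ ^ e} with hS
    have hSm : MeasurableSet S := measurableSet_lt measurable_fst (by fun_prop)
    have step1 : ∫⁻ t in Set.Ioi (0 : ℝ), volume {x | t < ‖f x‖} * ENNReal.ofReal (t ^ (p - 1)) ≤
        ∫⁻ t in Set.Ioi (0 : ℝ), ∫⁻ ξ : Space d,
          S.indicator (fun z => ENNReal.ofReal (4 * z.1 ^ (p - 3)) * ‖F z.2‖ₑ ^ (2 : ℝ)) (t, ξ) := by
      refine setLIntegral_mono' measurableSet_Ioi fun t ht => ?_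
      have ht : 0 < t := ht
      have hm : MeasurableSet {ξ : Space d | t < K * ‖ξ‖ ^ e} :=
        measurableSet_lt measurable_const (by fun_prop)
      calc volume {x | t < ‖f x‖} * ENNReal.ofReal (t ^ (p - 1))
          ≤ (ENNReal.ofReal (4 * t ^ (-2 : ℝ)) *
            ∫⁻ ξ in {ξ : Space d | t < K * ‖ξ‖ ^ e}, ‖F ξ‖ₑ ^ (2 : ℝ)) *
              ENNReal.ofReal (t ^ (p - 1)) := by gcongr; exact hlevel t ht
        _ = ENNReal.ofReal (4 * t ^ (p - 3)) *
            ∫⁻ ξ in {ξ : Space d | t < K * ‖ξ‖ ^ e}, ‖F ξ‖ₑ ^ (2 : ℝ) := by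
          rw [mul_right_comm, ← ENNReal.ofReal_mul (by positivity), mul_assoc 4,
            ← Real.rpow_add ht]
          ring_nf
        _ = _ := by
          rw [← lintegral_const_mul _ (by fun_prop), ← lintegral_indicator hm]
          refine lintegral_congr fun ξ => ?_
          by_cases hξ : t < K * ‖ξ‖ ^ e
          · have h1 : ξ ∈ {ξ : Space d | t < K * ‖ξ‖ ^ e} := hξ
            have h2 : (t, ξ) ∈ S := hξ
            rw [Set.indicator_of_mem h1, Set.indicator_of_mem h2]
          · have h1 : ξ ∉ {ξ : Space d | t < K * ‖ξ‖ ^ e} := hξ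
            have h2 : (t, ξ) ∉ S := hξ
            rw [Set.indicator_of_notMem h1, Set.indicator_of_notMem h2]
    have step2 : ∀ ξ : Space d, ∫⁻ t in Set.Ioi (0 : ℝ),
          S.indicator (fun z => ENNReal.ofReal (4 * z.1 ^ (p - 3)) * ‖F z.2‖ₑ ^ (2 : ℝ)) (t, ξ) =
        ENNReal.ofReal (4 * (K ^ (p - 2) / (p - 2))) * ‖w ξ‖ₑ ^ (2 : ℝ) := by
      intro ξ
      have hnn : 0 ≤ K * ‖ξ‖ ^ e := by positivity
      have h1 : ∀ t, S.indicator
          (fun z => ENNReal.ofReal (4 * z.1 ^ (p - 3)) * ‖F z.2‖ₑ ^ (2 : ℝ)) (t, ξ) =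
          (Set.Iio (K * ‖ξ‖ ^ e)).indicator
            (fun t => ENNReal.ofReal (t ^ (p - 3)) * (ENNReal.ofReal 4 * ‖F ξ‖ₑ ^ (2 : ℝ))) t := by
        intro t
        by_cases ht : t < K * ‖ξ‖ ^ e
        · have h2 : (t, ξ) ∈ S := ht
          have h3 : t ∈ Set.Iio (K * ‖ξ‖ ^ e) := ht
          rw [Set.indicator_of_mem h2, Set.indicator_of_mem h3]
          simp only
          rw [ENNReal.ofReal_mul (by norm_num)]
          ring
        · have h2 : (t, ξ) ∉ S := ht
          have h3 : t ∉ Set.Iio (K * ‖ξ‖ ^ e) := ht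
          rw [Set.indicator_of_notMem h2, Set.indicator_of_notMem h3]
      simp only [h1]
      rw [setLIntegral_indicator measurableSet_Iio, Set.inter_comm, Set.Ioi_inter_Iio,
        lintegral_mul_const _ (by fun_prop), lintegral_rpow_Ioo (by linarith) hnn]
      have e2 : p - 3 + 1 = p - 2 := by ring
      rw [e2, Real.mul_rpow hK0.le (by positivity), ← Real.rpow_mul (norm_nonneg _), hexp]
      simp only [hw, enorm_mul]
      rw [ENNReal.mul_rpow_of_nonneg _ _ (by norm_num)]
      have e3 : ‖((‖ξ‖ ^ s : ℝ) : ℂ)‖ₑ ^ (2 : ℝ) = ENNReal.ofReal (‖ξ‖ ^ (2 * s)) := by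
        rw [← ofReal_norm, Complex.norm_real, Real.norm_of_nonneg (by positivity),
          ENNReal.ofReal_rpow_of_nonneg (by positivity) (by norm_num),
          ← Real.rpow_mul (norm_nonneg _), mul_comm s]
      have hp2' := sub_pos.2 hp2
      rw [e3, ← mul_assoc, ← mul_assoc, ← ENNReal.ofReal_mul (by positivity),
        ← ENNReal.ofReal_mul (by positivity)]
      congr 2
      ring
    have hmeas : Measurable
        (S.indicator (fun z => ENNReal.ofReal (4 * z.1 ^ (p - 3)) * ‖F z.2‖ₑ ^ (2 : ℝ))) :=
      Measurable.indicator (by fun_prop) hSm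
    have step3 : ∫⁻ ξ, ‖w ξ‖ₑ ^ (2 : ℝ) = ENNReal.ofReal (N ^ (2 : ℝ)) := by
      rw [← ENNReal.ofReal_rpow_of_nonneg hNpos.le (by norm_num), ← hN,
        eLpNorm_eq_lintegral_rpow_enorm_toReal (by norm_num) (by norm_num), ← ENNReal.rpow_mul]
      simp
    have hp2' := sub_pos.2 hp2
    calc ENNReal.ofReal p * ∫⁻ t in Set.Ioi (0 : ℝ),
          volume {x | t < ‖f x‖} * ENNReal.ofReal (t ^ (p - 1))
        ≤ ENNReal.ofReal p * ∫⁻ t in Set.Ioi (0 : ℝ), ∫⁻ ξ : Space d,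
          S.indicator (fun z => ENNReal.ofReal (4 * z.1 ^ (p - 3)) * ‖F z.2‖ₑ ^ (2 : ℝ)) (t, ξ) := by
          gcongr
      _ = ENNReal.ofReal p *
          ∫⁻ ξ, ENNReal.ofReal (4 * (K ^ (p - 2) / (p - 2))) * ‖w ξ‖ₑ ^ (2 : ℝ) := by
          rw [lintegral_lintegral_swap (f := fun t ξ => S.indicator
            (fun z => ENNReal.ofReal (4 * z.1 ^ (p - 3)) * ‖F z.2‖ₑ ^ (2 : ℝ)) (t, ξ))
            hmeas.aemeasurable]
          simp only [step2]
      _ = ENNReal.ofReal (p * (4 * (K ^ (p - 2) / (p - 2)) * N ^ (2 : ℝ))) := by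
          rw [lintegral_const_mul _ (by fun_prop), step3, ← ENNReal.ofReal_mul (by positivity),
            ← ENNReal.ofReal_mul hp0.le]
      _ = _ := by
          congr 1
          rw [hK, Real.mul_rpow (by positivity) hNpos.le]
          have : N ^ p = N ^ (p - 2) * N ^ (2 : ℝ) := by
            rw [← Real.rpow_add hNpos]; ring_nf
          rw [this]
          ring
  rw [eLpNorm_eq_lintegral_rpow_enorm_toReal (by simpa using hp0) ENNReal.ofReal_ne_top,
    ENNReal.toReal_ofReal hp0.le, hN, ← ENNReal.ofReal_mul (by positivity)]
  refine (ENNReal.rpow_le_rpow hmain (by positivity)).trans (le_of_eq ?_)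
  rw [ENNReal.ofReal_rpow_of_nonneg (by positivity) (by positivity)]
  congr 1
  rw [Real.mul_rpow hC0.le (by positivity), ← Real.rpow_mul hNpos.le, mul_one_div_cancel hp0.ne',
    Real.rpow_one]

/-! ### Schwartz functions flat at the origin -/

section Flat

variable {F : Type} [NormedAddCommGroup F] [NormedSpace ℝ F]

/-- All derivatives vanish at the origin. -/
def IsFlat (η : Space d → F) : Prop := ∀ n : ℕ, iteratedFDeriv ℝ n η 0 = 0

theorem IsFlat.fderivCLM {η : 𝓢(Space d, F)} (h : IsFlat η) :
    IsFlat (SchwartzMap.fderivCLM ℝ (Space d) F η) := fun n => by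
  have h1 : ((SchwartzMap.fderivCLM ℝ (Space d) F η : 𝓢(Space d, Space d →L[ℝ] F)) :
      Space d → Space d →L[ℝ] F) = fderiv ℝ η := by
    ext x; simp
  rw [h1, ← norm_eq_zero, norm_iteratedFDeriv_fderiv, h (n + 1), norm_zero]

theorem IsFlat.of_bilinear {E' G : Type} [NormedAddCommGroup E'] [NormedSpace ℝ E']
    [NormedAddCommGroup G] [NormedSpace ℝ G]
    (B : E' →L[ℝ] F →L[ℝ] G) {f : Space d → E'} {η : Space d → F}
    (hf : ContDiff ℝ ((⊤ : ℕ∞) : WithTop ℕ∞) f) (hη : ContDiff ℝ ((⊤ : ℕ∞) : WithTop ℕ∞) η)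
    (h : IsFlat η) : IsFlat (fun x => B (f x) (η x)) := fun n => by
  have := B.norm_iteratedFDeriv_le_of_bilinear hf hη 0 (n := n) (by exact_mod_cast le_top)
  rw [← norm_le_zero_iff]
  refine this.trans (le_of_eq ?_)
  simp [h _]

theorem IsFlat.smulRight {η : 𝓢(Space d, F)} (h : IsFlat η) :
    IsFlat (SchwartzMap.smulRightCLM ℝ F (innerSL ℝ : Space d →L[ℝ] Space d →L[ℝ] ℝ) η) := by
  have h1 : ((SchwartzMap.smulRightCLM ℝ F (innerSL ℝ : Space d →L[ℝ] Space d →L[ℝ] ℝ) η :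
      𝓢(Space d, Space d →L[ℝ] F)) : Space d → Space d →L[ℝ] F) =
      fun x => ContinuousLinearMap.smulRightL ℝ (Space d) F (innerSL ℝ x) (η x) := by
    ext x v; simp; rfl
  rw [h1]
  exact h.of_bilinear _ (innerSL ℝ).contDiff (η.smooth ⊤)

theorem IsFlat.apply_zero {η : Space d → F} (h : IsFlat η) : η 0 = 0 := by
  have := h 0
  rw [← norm_eq_zero, norm_iteratedFDeriv_zero] at this
  exact norm_eq_zero.1 this

/-- The derivative is again flat, so a bound of order `N` for it integrates along the segment from
the origin to one of order `N + 1` for `η`. The target space varies because each derivative takes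
values in a new space of linear maps. -/
theorem IsFlat.exists_le (N : ℕ) : ∀ {F : Type} [NormedAddCommGroup F] [NormedSpace ℝ F]
    {η : 𝓢(Space d, F)}, IsFlat η → ∃ C : ℝ, 0 ≤ C ∧ ∀ ξ, ‖η ξ‖ ≤ C * ‖ξ‖ ^ N := by
  induction N with
  | zero =>
    intro F _ _ η _
    exact ⟨_, apply_nonneg _ _, fun ξ => by simpa using SchwartzMap.norm_le_seminorm ℝ η ξ⟩
  | succ N ih =>
    intro F _ _ η h
    obtain ⟨C, hC, hb⟩ := ih h.fderivCLM
    refine ⟨C, hC, fun ξ => ?_⟩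
    have := (convex_segment (0 : Space d) ξ).norm_image_sub_le_of_norm_fderiv_le (𝕜 := ℝ)
      (f := η) (C := C * ‖ξ‖ ^ N) (fun x _ => η.differentiableAt) (fun x hx => ?_)
      (left_mem_segment ℝ 0 ξ) (right_mem_segment ℝ 0 ξ)
    · rw [h.apply_zero, sub_zero, sub_zero] at this
      rw [pow_succ, ← mul_assoc]; exact this
    · have hx' : ‖x‖ ≤ ‖ξ‖ := by
        rw [segment_eq_image] at hx
        obtain ⟨t, ⟨ht0, ht1⟩, htx⟩ := hx
        simp only at htx
        rw [← htx, smul_zero, zero_add, norm_smul, Real.norm_of_nonneg ht0]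
        exact mul_le_of_le_one_left (norm_nonneg _) ht1
      have h2 := hb x
      rw [SchwartzMap.fderivCLM_apply] at h2
      exact h2.trans (by gcongr)

/-- Near the origin a flat function times a power of the norm is as small as we please. -/
theorem IsFlat.exists_rpow_le {η : 𝓢(Space d, F)} (h : IsFlat η) (s : ℝ) (k : ℕ) :
    ∃ C : ℝ, 0 ≤ C ∧ ∀ ξ, ‖ξ‖ ≤ 1 → ‖(‖ξ‖ ^ s) • η ξ‖ ≤ C * ‖ξ‖ ^ k := by
  obtain ⟨N, hN⟩ := exists_nat_ge (k - s)
  obtain ⟨C, hC, hb⟩ := h.exists_le N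
  refine ⟨C, hC, fun ξ hξ => ?_⟩
  rcases eq_or_ne ξ 0 with rfl | hξ0
  · rw [h.apply_zero, smul_zero, norm_zero]; positivity
  have hpos : 0 < ‖ξ‖ := norm_pos_iff.2 hξ0
  rw [norm_smul, Real.norm_of_nonneg (by positivity)]
  calc ‖ξ‖ ^ s * ‖η ξ‖ ≤ ‖ξ‖ ^ s * (C * ‖ξ‖ ^ N) := by gcongr; exact hb ξ
    _ = C * ‖ξ‖ ^ (s + N) := by rw [Real.rpow_add hpos, Real.rpow_natCast]; ring
    _ ≤ C * ‖ξ‖ ^ (k : ℝ) := by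
      gcongr C * ?_
      exact Real.rpow_le_rpow_of_exponent_ge hpos hξ (by linarith)
    _ = C * ‖ξ‖ ^ k := by rw [Real.rpow_natCast]

theorem hasFDerivAt_norm_rpow_of_ne {ξ : Space d} (hξ : ξ ≠ 0) (s : ℝ) :
    HasFDerivAt (fun x : Space d => ‖x‖ ^ s) ((s * ‖ξ‖ ^ (s - 2)) • innerSL ℝ ξ) ξ := by
  have hpos : 0 < ‖ξ‖ := norm_pos_iff.2 hξ
  have h1 : HasFDerivAt (fun x : Space d => ‖x‖ ^ 2) (2 • innerSL ℝ ξ) ξ :=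
    (hasStrictFDerivAt_norm_sq ξ).hasFDerivAt
  have h2 := h1.rpow_const (p := s / 2) (Or.inl (by positivity))
  have e : (fun x : Space d => (‖x‖ ^ 2) ^ (s / 2)) = fun x => ‖x‖ ^ s := by
    ext x
    rw [← Real.rpow_natCast, ← Real.rpow_mul (norm_nonneg _)]
    congr 1; push_cast; ring
  rw [e] at h2
  have e2 : (‖ξ‖ ^ 2) ^ (s / 2 - 1) = ‖ξ‖ ^ (s - 2) := by
    rw [← Real.rpow_natCast, ← Real.rpow_mul (norm_nonneg _)]
    congr 1; push_cast; ring
  rw [e2] at h2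
  refine h2.congr_fderiv ?_
  ext v
  simp
  ring

/-- The derivative is again a sum of powers of `‖x‖` times flat Schwartz functions, with exponents
`s` and `s - 2`, so the family is closed under differentiation. At the origin flatness beats any
negative power. -/
theorem IsFlat.hasFDerivAt {η : 𝓢(Space d, F)} (h : IsFlat η) (s : ℝ) (ξ : Space d) :
    HasFDerivAt (fun x : Space d => (‖x‖ ^ s) • η x)
      ((‖ξ‖ ^ s) • (SchwartzMap.fderivCLM ℝ (Space d) F η ξ) + (‖ξ‖ ^ (s - 2)) •
        ((s • SchwartzMap.smulRightCLM ℝ F (innerSL ℝ : Space d →L[ℝ] Space d →L[ℝ] ℝ) η :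
          𝓢(Space d, Space d →L[ℝ] F)) ξ)) ξ := by
  rcases eq_or_ne ξ 0 with rfl | hξ
  · have z : ((‖(0 : Space d)‖ ^ s) • (SchwartzMap.fderivCLM ℝ (Space d) F η 0) +
        (‖(0 : Space d)‖ ^ (s - 2)) •
        ((s • SchwartzMap.smulRightCLM ℝ F (innerSL ℝ : Space d →L[ℝ] Space d →L[ℝ] ℝ) η :
          𝓢(Space d, Space d →L[ℝ] F)) 0)) = 0 := by
      rw [h.fderivCLM.apply_zero, smul_zero, zero_add, smul_apply,
        h.smulRight.apply_zero, smul_zero, smul_zero]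
    rw [z]
    obtain ⟨C, hC, hb⟩ := h.exists_rpow_le s 2
    refine HasFDerivAt.of_isLittleO ?_
    have e : (fun x' : Space d => ‖x'‖ ^ s • η x' - ‖(0 : Space d)‖ ^ s • η 0 -
        (0 : Space d →L[ℝ] F) (x' - 0)) = fun x' => ‖x'‖ ^ s • η x' := by
      ext x; simp [h.apply_zero]
    rw [e]
    have hO : (fun x' : Space d => ‖x'‖ ^ s • η x') =O[nhds 0] fun x' => ‖x' - 0‖ ^ 2 := by
      refine Asymptotics.IsBigO.of_bound C ?_
      filter_upwards [Metric.closedBall_mem_nhds (0 : Space d) one_pos] with x hx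
      have := hb x (by simpa using hx)
      simpa using this
    exact hO.trans_isLittleO (Asymptotics.isLittleO_norm_pow_id one_lt_two |>.congr_left (by simp)
      |>.congr_right (by simp))
  · have := (hasFDerivAt_norm_rpow_of_ne hξ s).smul η.differentiableAt.hasFDerivAt
    refine this.congr_fderiv ?_
    ext v
    simp only [add_apply, smul_apply, SchwartzMap.fderivCLM_apply,
      SchwartzMap.smulRightCLM_apply_apply, ContinuousLinearMap.smulRight_apply, smul_smul,
      smul_eq_mul]
    ring_nf

/-- Induction with the target space and the exponent both free: one derivative turns the function
into two of the same kind. Boundedness comes from flatness in the unit ball and from Schwartz decay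
outside it. -/
theorem IsFlat.contDiff_and_decay (n : ℕ) : ∀ {F : Type} [NormedAddCommGroup F] [NormedSpace ℝ F]
    {η : 𝓢(Space d, F)}, IsFlat η → ∀ s : ℝ,
      ContDiff ℝ n (fun ξ => (‖ξ‖ ^ s) • η ξ) ∧ ∀ k : ℕ, ∃ C : ℝ, ∀ ξ,
        ‖ξ‖ ^ k * ‖iteratedFDeriv ℝ n (fun ξ => (‖ξ‖ ^ s) • η ξ) ξ‖ ≤ C := by
  induction n with
  | zero =>
    intro F _ _ η h s
    refine ⟨contDiff_zero.2 (continuous_iff_continuousAt.2 fun ξ =>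
      (h.hasFDerivAt s ξ).continuousAt), fun k => ?_⟩
    obtain ⟨C, hC, hb⟩ := h.exists_rpow_le s 0
    obtain ⟨m, hm⟩ := exists_nat_ge s
    refine ⟨max C (SchwartzMap.seminorm ℝ (k + m) 0 η), fun ξ => ?_⟩
    rw [norm_iteratedFDeriv_zero]
    rcases le_or_gt ‖ξ‖ 1 with hξ | hξ
    · refine le_max_of_le_left ?_
      calc ‖ξ‖ ^ k * ‖(‖ξ‖ ^ s) • η ξ‖ ≤ 1 * (C * ‖ξ‖ ^ 0) := by
            gcongr
            · exact pow_le_one₀ (norm_nonneg _) hξ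
            · exact hb ξ hξ
        _ = C := by simp
    · refine le_max_of_le_right ?_
      have h1 := SchwartzMap.norm_pow_mul_le_seminorm ℝ η (k + m) ξ
      refine le_trans ?_ h1
      rw [norm_smul, Real.norm_of_nonneg (by positivity), ← mul_assoc, pow_add]
      gcongr
      rw [← Real.rpow_natCast ‖ξ‖ m]
      exact Real.rpow_le_rpow_of_exponent_le hξ.le hm
  | succ n ih =>
    intro F _ _ η h s
    have hT2 : IsFlat ((s • SchwartzMap.smulRightCLM ℝ F
        (innerSL ℝ : Space d →L[ℝ] Space d →L[ℝ] ℝ) η : 𝓢(Space d, Space d →L[ℝ] F))) := fun n => by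
      have : ((s • SchwartzMap.smulRightCLM ℝ F (innerSL ℝ : Space d →L[ℝ] Space d →L[ℝ] ℝ) η :
        𝓢(Space d, Space d →L[ℝ] F)) : Space d → Space d →L[ℝ] F) =
        s • (SchwartzMap.smulRightCLM ℝ F (innerSL ℝ : Space d →L[ℝ] Space d →L[ℝ] ℝ) η :
        𝓢(Space d, Space d →L[ℝ] F)) := rfl
      rw [this, iteratedFDeriv_const_smul_apply]
      · rw [h.smulRight n, smul_zero]
      · exact (SchwartzMap.smooth _ n).contDiffAt
    obtain ⟨c1, b1⟩ := ih h.fderivCLM s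
    obtain ⟨c2, b2⟩ := ih hT2 (s - 2)
    have hfd : fderiv ℝ (fun ξ => (‖ξ‖ ^ s) • η ξ) = _ := funext fun ξ => (h.hasFDerivAt s ξ).fderiv
    refine ⟨?_, fun k => ?_⟩
    · push_cast
      rw [contDiff_succ_iff_fderiv]
      refine ⟨fun ξ => (h.hasFDerivAt s ξ).differentiableAt, by simp, ?_⟩
      rw [hfd]
      exact c1.add c2
    · obtain ⟨C1, hC1⟩ := b1 k
      obtain ⟨C2, hC2⟩ := b2 k
      refine ⟨C1 + C2, fun ξ => ?_⟩
      rw [← norm_iteratedFDeriv_fderiv, hfd]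
      have := iteratedFDeriv_add_apply (x := ξ) c1.contDiffAt c2.contDiffAt
      refine (mul_le_mul_of_nonneg_left ((congrArg norm this).le.trans (norm_add_le _ _))
        (by positivity)).trans ?_
      rw [mul_add]
      exact add_le_add (hC1 ξ) (hC2 ξ)

end Flat

/-- A power of `|2πξ|` times a flat Schwartz function is a Schwartz function. -/
theorem IsFlat.exists_schwartz {η : 𝓢(Space d, ℂ)} (h : IsFlat η) (s : ℝ) :
    ∃ v : 𝓢(Space d, ℂ), ∀ ξ, v ξ = (((2 * Real.pi * ‖ξ‖) ^ s : ℝ) : ℂ) * η ξ := by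
  let u : 𝓢(Space d, ℂ) :=
    { toFun := fun ξ => (‖ξ‖ ^ s) • η ξ
      smooth' := contDiff_infty.2 fun n => (h.contDiff_and_decay n s).1
      decay' := fun k n => (h.contDiff_and_decay n s).2 k }
  refine ⟨((2 * Real.pi) ^ s : ℝ) • u, fun ξ => ?_⟩
  have : u ξ = (‖ξ‖ ^ s) • η ξ := rfl
  rw [smul_apply, this, Real.mul_rpow (by positivity) (norm_nonneg _)]
  simp [mul_assoc]

/-! ### The symbol of `|∇|^s` -/

/-- The symbol `|2πξ|^s`. -/
def absSymbol (s : ℝ) (ξ : Space d) : ℂ := (((2 * Real.pi * ‖ξ‖) ^ s : ℝ) : ℂ)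

theorem measurable_absSymbol (s : ℝ) : Measurable (absSymbol s : Space d → ℂ) := by
  unfold absSymbol; fun_prop

theorem absSymbol_ne_zero (s : ℝ) {ξ : Space d} (hξ : ξ ≠ 0) : absSymbol s ξ ≠ 0 := by
  have : 0 < ‖ξ‖ := norm_pos_iff.2 hξ
  simp only [absSymbol, ne_eq, Complex.ofReal_eq_zero]
  positivity

theorem norm_absSymbol (s : ℝ) (ξ : Space d) : ‖absSymbol s ξ‖ = (2 * Real.pi * ‖ξ‖) ^ s := by
  rw [absSymbol, Complex.norm_real, Real.norm_of_nonneg (by positivity)]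

theorem absSymbol_two (ξ : Space d) : absSymbol 2 ξ = ((2 * Real.pi * ‖ξ‖) ^ 2 : ℝ) := by
  rw [absSymbol]; norm_cast

theorem fourier_fourierInv_schwartz (φ : 𝓢(Space d, ℂ)) :
    𝓕 ((𝓕⁻ φ : 𝓢(Space d, ℂ)) : Space d → ℂ) = φ := by
  rw [← SchwartzMap.fourier_coe, fourier_fourierInv_eq]

theorem fourierInv_fourier_schwartz (φ : 𝓢(Space d, ℂ)) :
    𝓕⁻ ((𝓕 φ : 𝓢(Space d, ℂ)) : Space d → ℂ) = φ := by
  rw [← SchwartzMap.fourierInv_coe, fourierInv_fourier_eq]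

/-- Reflecting `ξ` exchanges the two transforms and puts `𝓕` outermost, the shape in which
`IsFourierPair` tests. -/
theorem absGrad_eq_fourier (s : ℝ) (φ : 𝓢(Space d, ℂ)) :
    absGrad s φ = 𝓕 (fun ξ => absSymbol s ξ * (𝓕⁻ φ : 𝓢(Space d, ℂ)) ξ) := by
  rw [absGrad, Real.fourierInv_eq_fourier_comp_neg]
  congr 1
  ext ξ
  rw [SchwartzMap.fourierInv_coe, Real.fourierInv_eq_fourier_neg, norm_neg]
  rfl

theorem IsFlat.comp_clm {F : Type} [NormedAddCommGroup F] [NormedSpace ℝ F] {η : Space d → F}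
    (h : IsFlat η) (hη : ContDiff ℝ ((⊤ : ℕ∞) : WithTop ℕ∞) η) (g : Space d →L[ℝ] Space d) :
    IsFlat (fun x => η (g x)) := fun n => by
  have := g.iteratedFDeriv_comp_right hη 0 (i := n) (by exact_mod_cast le_top)
  change iteratedFDeriv ℝ n (η ∘ g) 0 = 0
  rw [this, map_zero, h n]
  ext; simp

theorem isFlat_fourierInv {φ : 𝓢(Space d, ℂ)} (h : φ ∈ schwartzZero d) :
    IsFlat ((𝓕⁻ φ : 𝓢(Space d, ℂ)) : Space d → ℂ) := by
  have h' : IsFlat ((𝓕 φ : 𝓢(Space d, ℂ)) : Space d → ℂ) := h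
  have := h'.comp_clm ((𝓕 φ).smooth ⊤) (-ContinuousLinearMap.id ℝ (Space d))
  convert this using 2 with ξ
  rw [SchwartzMap.fourierInv_coe, Real.fourierInv_eq_fourier_neg]
  rfl

theorem fourier_mem_schwartzZero {η : 𝓢(Space d, ℂ)} (h : IsFlat η) :
    (𝓕 η : 𝓢(Space d, ℂ)) ∈ schwartzZero d := by
  have := h.comp_clm (η.smooth ⊤) (-ContinuousLinearMap.id ℝ (Space d))
  change IsFlat (𝓕 ((𝓕 η : 𝓢(Space d, ℂ)) : Space d → ℂ))
  convert this using 2 with ξ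
  have e : 𝓕 ((𝓕 η : 𝓢(Space d, ℂ)) : Space d → ℂ) ξ
      = 𝓕⁻ ((𝓕 η : 𝓢(Space d, ℂ)) : Space d → ℂ) (-ξ) := by
    rw [Real.fourierInv_eq_fourier_neg, neg_neg]
  rw [e, fourierInv_fourier_schwartz]
  rfl

theorem isFlat_of_zero_notMem_tsupport {η : Space d → ℂ} (h : (0 : Space d) ∉ tsupport η) :
    IsFlat η := fun n => by
  have : (0 : Space d) ∉ tsupport (iteratedFDeriv ℝ n η) :=
    fun h' => h (tsupport_iteratedFDeriv_subset n h')
  exact image_eq_zero_of_notMem_tsupport this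

/-- `|∇|^s` maps `𝓢₀` to Schwartz functions. -/
theorem exists_absGrad_eq (s : ℝ) {φ : 𝓢(Space d, ℂ)} (h : φ ∈ schwartzZero d) :
    ∃ v : 𝓢(Space d, ℂ), (∀ ξ, v ξ = absSymbol s ξ * (𝓕⁻ φ : 𝓢(Space d, ℂ)) ξ) ∧
      absGrad s φ = 𝓕 (v : Space d → ℂ) := by
  obtain ⟨v, hv⟩ := (isFlat_fourierInv h).exists_schwartz s
  refine ⟨v, hv, ?_⟩
  rw [absGrad_eq_fourier]
  congr 1
  ext ξ
  exact (hv ξ).symm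

theorem isAbsGrad_of_isFourierPair {γ : ℝ} {f F g G : Space d → ℂ} (hf : IsFourierPair f F)
    (hg : MemLp g 2 volume) (hG : IsFourierPair g G)
    (h : G =ᵐ[volume] fun ξ => absSymbol γ ξ * F ξ) : IsAbsGrad γ f g := by
  refine ⟨hg, fun φ hφ => ?_⟩
  obtain ⟨v, hv, he⟩ := exists_absGrad_eq γ hφ
  rw [he, hf.2.2]
  have e : ∀ x, φ x = 𝓕 ((𝓕⁻ φ : 𝓢(Space d, ℂ)) : Space d → ℂ) x := fun x => by
    rw [fourier_fourierInv_schwartz]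
  calc ∫ ξ, F ξ * v ξ = ∫ ξ, G ξ * (𝓕⁻ φ : 𝓢(Space d, ℂ)) ξ := by
        refine integral_congr_ae ?_
        filter_upwards [h] with ξ hξ
        rw [hv, hξ]; ring
    _ = ∫ x, g x * φ x := by
        rw [← hG.2.2]; simp only [fourier_fourierInv_schwartz]

/-- Testing on `𝓢₀` determines the Fourier transform of `g` only off the origin, but that transform
is a function and the origin is a null set, so no polynomial ambiguity survives in `L²`. -/
theorem IsAbsGrad.ae_unique (hd : 1 ≤ d) {γ : ℝ} {f g g' : Space d → ℂ} (h : IsAbsGrad γ f g)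
    (h' : IsAbsGrad γ f g') : g =ᵐ[volume] g' := by
  obtain ⟨G, hG2, hG, -⟩ := exists_fourier_of_memLp_two h.1
  obtain ⟨G', hG2', hG', -⟩ := exists_fourier_of_memLp_two h'.1
  have hsub := (hG.2.1.sub hG'.2.1).locallyIntegrable
  have : (fun ξ => G ξ - G' ξ) =ᵐ[volume] 0 := by
    refine ae_eq_zero_of_forall_schwartz_away hd (hsub.locallyIntegrableOn _) fun η _ hs => ?_
    have hfl : IsFlat η := isFlat_of_zero_notMem_tsupport fun h0 => hs h0 rfl
    have hmem := fourier_mem_schwartzZero hfl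
    simp only [sub_mul]
    rw [integral_sub (hG.2.1.2 η) (hG'.2.1.2 η), ← hG.2.2, ← hG'.2.2, sub_eq_zero]
    exact (h.2 _ hmem).symm.trans (h'.2 _ hmem)
  have hGG : G =ᵐ[volume] G' := by
    filter_upwards [this] with ξ hξ
    exact sub_eq_zero.1 hξ
  exact hG.ae_eq_left (hG'.congr (ae_eq_refl _) hGG.symm)

theorem IsAbsGrad.hdotNorm_eq (hd : 1 ≤ d) {γ : ℝ} {f g : Space d → ℂ} (h : IsAbsGrad γ f g) :
    hdotNorm γ f = eLpNorm g 2 volume := by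
  refine le_antisymm (iInf₂_le g h) (le_iInf₂ fun g' h' => ?_)
  rw [eLpNorm_congr_ae (h.ae_unique hd h')]

theorem exists_isAbsGrad_of_hdotNorm_lt {γ : ℝ} {f : Space d → ℂ} (h : hdotNorm γ f < ∞) :
    ∃ g, IsAbsGrad γ f g := by
  by_contra! hne
  have : hdotNorm γ f = ∞ := by
    simp [hdotNorm, hne]
  exact h.ne this

theorem IsAbsGrad.hdotNorm_lt (hd : 1 ≤ d) {γ : ℝ} {f g : Space d → ℂ} (h : IsAbsGrad γ f g) :
    hdotNorm γ f < ∞ := by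
  rw [h.hdotNorm_eq hd]; exact h.1.2

theorem IsTempered.integrable_mul_absGrad {f : Space d → ℂ} (hf : IsTempered f) (γ : ℝ)
    {φ : 𝓢(Space d, ℂ)} (h : φ ∈ schwartzZero d) : Integrable (fun x => f x * absGrad γ φ x) := by
  obtain ⟨v, -, he⟩ := exists_absGrad_eq γ h
  rw [he]
  exact hf.2 (𝓕 v)

theorem IsAbsGrad.add {γ : ℝ} {f f' g g' : Space d → ℂ} (hf : IsTempered f) (hf' : IsTempered f')
    (h : IsAbsGrad γ f g) (h' : IsAbsGrad γ f' g') :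
    IsAbsGrad γ (fun x => f x + f' x) (fun x => g x + g' x) := by
  refine ⟨h.1.add h'.1, fun φ hφ => ?_⟩
  simp only [add_mul]
  rw [integral_add (hf.integrable_mul_absGrad γ hφ) (hf'.integrable_mul_absGrad γ hφ), h.2 φ hφ,
    h'.2 φ hφ, integral_add]
  · exact (isTempered_of_memLp (by norm_num) h.1).2 φ
  · exact (isTempered_of_memLp (by norm_num) h'.1).2 φ

theorem IsAbsGrad.const_mul {γ : ℝ} {f g : Space d → ℂ} (h : IsAbsGrad γ f g) (c : ℂ) :
    IsAbsGrad γ (fun x => c * f x) (fun x => c * g x) := by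
  refine ⟨h.1.const_mul c, fun φ hφ => ?_⟩
  simp only [mul_assoc]
  rw [integral_const_mul, integral_const_mul, h.2 φ hφ]

theorem IsAbsGrad.sub {γ : ℝ} {f f' g g' : Space d → ℂ} (hf : IsTempered f) (hf' : IsTempered f')
    (h : IsAbsGrad γ f g) (h' : IsAbsGrad γ f' g') :
    IsAbsGrad γ (fun x => f x - f' x) (fun x => g x - g' x) := by
  have := h.add hf (hf'.const_mul (-1)) (h'.const_mul (-1))
  simpa [sub_eq_add_neg] using this

/-! ### Affine changes of variables -/

theorem integral_affine (f : Space d → ℂ) {lam : ℝ} (hl : 0 < lam) (x₀ : Space d) :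
    ∫ x, f (lam • x + x₀) = (((lam ^ d)⁻¹ : ℝ) : ℂ) * ∫ x, f x := by
  rw [Measure.integral_comp_smul volume (fun y => f (y + x₀)) lam, integral_add_right_eq_self]
  simp [abs_of_pos hl]

theorem map_affine {lam : ℝ} (hl : 0 < lam) (x₀ : Space d) :
    (volume : Measure (Space d)).map (fun x => lam • x + x₀) =
      ENNReal.ofReal ((lam ^ d)⁻¹) • volume := by
  have : (fun x : Space d => lam • x + x₀) = (fun y => y + x₀) ∘ (fun x => lam • x) := rfl
  rw [this, ← Measure.map_map (by fun_prop) (by fun_prop), Measure.map_addHaar_smul _ hl.ne']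
  rw [Measure.map_smul, map_add_right_eq_self]
  simp [abs_of_pos hl]

theorem measurableEmbedding_affine {lam : ℝ} (hl : 0 < lam) (x₀ : Space d) :
    MeasurableEmbedding (fun x : Space d => lam • x + x₀) :=
  (MeasurableEquiv.addRight x₀).measurableEmbedding.comp (measurableEmbedding_const_smul₀ hl.ne')

theorem quasiMeasurePreserving_affine {lam : ℝ} (hl : 0 < lam) (x₀ : Space d) :
    Measure.QuasiMeasurePreserving (fun x : Space d => lam • x + x₀) volume volume := by
  refine ⟨by fun_prop, ?_⟩
  rw [map_affine hl]
  exact Measure.smul_absolutelyContinuous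

theorem eLpNorm_affine (f : Space d → ℂ) {lam : ℝ} (hl : 0 < lam) (x₀ : Space d) {p : ℝ}
    (hp : 0 < p) :
    eLpNorm (fun x => f (lam • x + x₀)) (ENNReal.ofReal p) volume =
      ENNReal.ofReal (lam ^ (-(d : ℝ) / p)) * eLpNorm f (ENNReal.ofReal p) volume := by
  have h := (measurableEmbedding_affine hl x₀).eLpNorm_map_measure (μ := volume) (g := f)
    (p := ENNReal.ofReal p)
  rw [map_affine hl, eLpNorm_smul_measure_of_ne_top ENNReal.ofReal_ne_top] at h
  change eLpNorm (f ∘ fun x => lam • x + x₀) _ _ = _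
  rw [← h, smul_eq_mul, ENNReal.toReal_div, ENNReal.toReal_one, ENNReal.toReal_ofReal hp.le,
    ENNReal.ofReal_rpow_of_nonneg (by positivity) (by positivity)]
  congr 2
  rw [← Real.rpow_natCast, ← Real.rpow_neg hl.le, ← Real.rpow_mul hl.le]
  congr 1
  ring

theorem eLpNorm_affine_mul (f : Space d → ℂ) (a : ℂ) {lam : ℝ} (hl : 0 < lam) (x₀ : Space d) {p : ℝ}
    (hp : 0 < p) :
    eLpNorm (fun x => a * f (lam • x + x₀)) (ENNReal.ofReal p) volume =
      ENNReal.ofReal (‖a‖ * lam ^ (-(d : ℝ) / p)) * eLpNorm f (ENNReal.ofReal p) volume := by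
  have : (fun x => a * f (lam • x + x₀)) = a • fun x => f (lam • x + x₀) := rfl
  rw [this, eLpNorm_const_smul, eLpNorm_affine f hl x₀ hp, ENNReal.ofReal_mul (norm_nonneg _),
    ofReal_norm, mul_assoc]

theorem memLp_affine {f : Space d → ℂ} {p : ℝ≥0∞} (h : MemLp f p volume) {lam : ℝ} (hl : 0 < lam)
    (x₀ : Space d) : MemLp (fun x => f (lam • x + x₀)) p volume := by
  refine (measurableEmbedding_affine hl x₀).memLp_map_measure_iff.1 ?_
  rw [map_affine hl]
  exact h.smul_measure ENNReal.ofReal_ne_top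

theorem integrable_affine {f : Space d → ℂ} (h : Integrable f volume) {lam : ℝ} (hl : 0 < lam)
    (x₀ : Space d) : Integrable (fun x => f (lam • x + x₀)) volume :=
  memLp_one_iff_integrable.1 (memLp_affine (memLp_one_iff_integrable.2 h) hl x₀)

/-- The Schwartz function `x ↦ φ (lam x + x₀)`. -/
theorem exists_schwartz_affine (φ : 𝓢(Space d, ℂ)) {lam : ℝ} (hl : 0 < lam) (x₀ : Space d) :
    ∃ ψ : 𝓢(Space d, ℂ), ∀ x, ψ x = φ (lam • x + x₀) := by
  refine ⟨SchwartzMap.compCLMOfContinuousLinearEquiv ℂ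
    (ContinuousLinearEquiv.smulLeft (Units.mk0 lam hl.ne')) (SchwartzMap.compSubConstCLM ℂ (-x₀) φ),
    fun x => ?_⟩
  simp [SchwartzMap.compCLMOfContinuousLinearEquiv_apply, sub_neg_eq_add]

theorem affine_inv {lam : ℝ} (hl : 0 < lam) (x₀ x : Space d) :
    lam⁻¹ • (lam • x + x₀) + (-(lam⁻¹ • x₀)) = x := by
  rw [smul_add, smul_smul, inv_mul_cancel₀ hl.ne', one_smul]; abel

theorem IsTempered.affine {f : Space d → ℂ} (h : IsTempered f) {lam : ℝ} (hl : 0 < lam)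
    (x₀ : Space d) : IsTempered (fun x => f (lam • x + x₀)) := by
  refine ⟨h.1.comp_quasiMeasurePreserving (quasiMeasurePreserving_affine hl x₀), fun φ => ?_⟩
  obtain ⟨ψ, hψ⟩ := exists_schwartz_affine φ (inv_pos.2 hl) (-(lam⁻¹ • x₀))
  have := integrable_affine (h.2 ψ) hl x₀
  simpa only [hψ, affine_inv hl] using this

/-- The inverse Fourier transform after an affine change of variables. -/
theorem fourierInv_affine (f : Space d → ℂ) {lam : ℝ} (hl : 0 < lam) (x₀ ξ : Space d) :
    𝓕⁻ (fun x => f (lam • x + x₀)) ξ =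
      (((lam ^ d)⁻¹ : ℝ) : ℂ) * ((Real.fourierChar (-inner ℝ x₀ (lam⁻¹ • ξ)) : ℂ) *
        𝓕⁻ f (lam⁻¹ • ξ)) := by
  have h := integral_affine
    (fun z => (Real.fourierChar (inner ℝ (z - x₀) (lam⁻¹ • ξ)) : ℂ) * f z) hl x₀
  rw [Real.fourierInv_eq, Real.fourierInv_eq]
  calc ∫ x, Real.fourierChar (inner ℝ x ξ) • f (lam • x + x₀)
      = ∫ x, (Real.fourierChar (inner ℝ (lam • x + x₀ - x₀) (lam⁻¹ • ξ)) : ℂ) *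
          f (lam • x + x₀) := by
        refine integral_congr_ae (Filter.Eventually.of_forall fun x => ?_)
        simp only [Circle.smul_def, smul_eq_mul, add_sub_cancel_right, inner_smul_left,
          inner_smul_right]
        simp [hl.ne']
    _ = _ := h
    _ = _ := by
        refine congrArg _ ?_
        rw [← integral_const_mul]
        refine integral_congr_ae (Filter.Eventually.of_forall fun z => ?_)
        simp only [Circle.smul_def, smul_eq_mul, ← mul_assoc, ← Circle.coe_mul,
          ← AddChar.map_add_eq_mul, inner_sub_left]
        congr 3
        ring

theorem fourier_affine (f : Space d → ℂ) {lam : ℝ} (hl : 0 < lam) (x₀ ξ : Space d) :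
    𝓕 (fun x => f (lam • x + x₀)) ξ =
      (((lam ^ d)⁻¹ : ℝ) : ℂ) * ((Real.fourierChar (inner ℝ x₀ (lam⁻¹ • ξ)) : ℂ) *
        𝓕 f (lam⁻¹ • ξ)) := by
  have := fourierInv_affine f hl x₀ (-ξ)
  rwa [Real.fourierInv_eq_fourier_neg, Real.fourierInv_eq_fourier_neg, neg_neg, smul_neg, neg_neg,
    inner_neg_right, neg_neg] at this

theorem absGrad_affine (γ : ℝ) {φ ψ : 𝓢(Space d, ℂ)} {lam : ℝ} (hl : 0 < lam) {x₀ : Space d}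
    (h : ∀ x, ψ x = φ (lam • x + x₀)) (x : Space d) :
    absGrad γ ψ x = ((lam ^ γ : ℝ) : ℂ) * absGrad γ φ (lam • x + x₀) := by
  have hψ : (ψ : Space d → ℂ) = fun x => φ (lam • x + x₀) := funext h
  set H : Space d → ℂ := fun ξ => (Real.fourierChar (inner ℝ ξ (lam • x + x₀)) : ℂ) *
    ((((2 * Real.pi * ‖ξ‖) ^ γ : ℝ) : ℂ) * 𝓕 (φ : Space d → ℂ) ξ) with hH
  have hint := integral_affine H (inv_pos.2 hl) (0 : Space d)
  simp only [add_zero] at hint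
  have e2 : absGrad γ φ (lam • x + x₀) = ∫ ξ, H ξ := by
    rw [absGrad, Real.fourierInv_eq]
    simp only [Circle.smul_def, smul_eq_mul, hH]
  have hlc : (lam : ℂ) ≠ 0 := by exact_mod_cast hl.ne'
  have e3 : ∫ ξ, H ξ = (((lam ^ d)⁻¹ : ℝ) : ℂ) * ∫ ξ, H (lam⁻¹ • ξ) := by
    rw [hint, ← mul_assoc, ← Complex.ofReal_mul, inv_pow, inv_inv,
      inv_mul_cancel₀ (pow_pos hl d).ne', Complex.ofReal_one, one_mul]
  rw [e2, e3, absGrad, Real.fourierInv_eq, ← integral_const_mul, ← integral_const_mul]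
  refine integral_congr_ae (Filter.Eventually.of_forall fun ξ => ?_)
  simp only [hψ, Circle.smul_def, smul_eq_mul, hH]
  rw [fourier_affine _ hl, norm_smul, Real.norm_of_nonneg (inv_pos.2 hl).le]
  have e4 : ((lam ^ γ : ℝ) : ℂ) * (((2 * Real.pi * (lam⁻¹ * ‖ξ‖)) ^ γ : ℝ) : ℂ) =
      (((2 * Real.pi * ‖ξ‖) ^ γ : ℝ) : ℂ) := by
    rw [← Complex.ofReal_mul, ← Real.mul_rpow hl.le (by positivity)]
    congr 2
    field_simp
  have e5 : (Real.fourierChar (inner ℝ (lam⁻¹ • ξ) (lam • x + x₀)) : ℂ) =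
      (Real.fourierChar (inner ℝ ξ x) : ℂ) * (Real.fourierChar (inner ℝ x₀ (lam⁻¹ • ξ)) : ℂ) := by
    rw [← Circle.coe_mul, ← AddChar.map_add_eq_mul]
    congr 2
    rw [inner_add_right, inner_smul_left, inner_smul_right, real_inner_comm x₀]
    simp [hl.ne']
  rw [e5, ← e4]
  ring

theorem affine_mem_schwartzZero {φ ψ : 𝓢(Space d, ℂ)} {lam : ℝ} (hl : 0 < lam) {x₀ : Space d}
    (h : ∀ x, ψ x = φ (lam • x + x₀)) (hφ : φ ∈ schwartzZero d) : ψ ∈ schwartzZero d := by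
  have hψ : (ψ : Space d → ℂ) = fun x => φ (lam • x + x₀) := funext h
  have h1 : IsFlat ((𝓕 φ : 𝓢(Space d, ℂ)) : Space d → ℂ) := hφ
  have h2 := h1.comp_clm ((𝓕 φ).smooth ⊤) (lam⁻¹ • ContinuousLinearMap.id ℝ (Space d))
  have hsm : ContDiff ℝ ((⊤ : ℕ∞) : WithTop ℕ∞) (fun ξ : Space d =>
      (((lam ^ d)⁻¹ : ℝ) : ℂ) * (Real.fourierChar (inner ℝ x₀ (lam⁻¹ • ξ)) : ℂ)) := by
    simp only [Real.fourierChar_apply]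
    refine contDiff_const.mul (Complex.contDiff_exp.comp (ContDiff.mul ?_ contDiff_const))
    refine Complex.ofRealCLM.contDiff.comp ?_
    exact contDiff_const.mul (contDiff_const.inner ℝ (contDiff_const_smul _))
  have h3 := h2.of_bilinear (ContinuousLinearMap.mul ℝ ℂ) hsm
    (((𝓕 φ).smooth ⊤).comp (lam⁻¹ • ContinuousLinearMap.id ℝ (Space d)).contDiff)
  change IsFlat (𝓕 (ψ : Space d → ℂ))
  convert h3 using 2 with ξ
  rw [hψ, fourier_affine _ hl]
  simp [mul_assoc, SchwartzMap.fourier_coe]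

/-- The change of variables is moved onto the test function: `𝓢₀` is invariant under it and the
symbol is homogeneous of degree `γ`. -/
theorem IsAbsGrad.affine {γ : ℝ} {f g : Space d → ℂ} (h : IsAbsGrad γ f g) (a : ℂ) {lam : ℝ}
    (hl : 0 < lam) (x₀ : Space d) :
    IsAbsGrad γ (fun x => a * f (lam • x + x₀))
      (fun x => (a * ((lam ^ γ : ℝ) : ℂ)) * g (lam • x + x₀)) := by
  refine ⟨(memLp_affine h.1 hl x₀).const_mul _, fun φ hφ => ?_⟩
  obtain ⟨ψ, hψ⟩ := exists_schwartz_affine φ (inv_pos.2 hl) (-(lam⁻¹ • x₀))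
  have hψ0 := affine_mem_schwartzZero (inv_pos.2 hl) hψ hφ
  have key := h.2 ψ hψ0
  have hA : ∀ x, absGrad γ φ x = ((lam ^ γ : ℝ) : ℂ) * absGrad γ ψ (lam • x + x₀) := fun x => by
    rw [absGrad_affine γ (inv_pos.2 hl) hψ, affine_inv hl, ← mul_assoc, ← Complex.ofReal_mul,
      ← Real.mul_rpow hl.le (inv_pos.2 hl).le, mul_inv_cancel₀ hl.ne']
    simp
  have hP : ∀ x, φ x = ψ (lam • x + x₀) := fun x => by rw [hψ, affine_inv hl]
  calc ∫ x, a * f (lam • x + x₀) * absGrad γ φ x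
      = ∫ x, (fun y => (a * ((lam ^ γ : ℝ) : ℂ)) * (f y * absGrad γ ψ y)) (lam • x + x₀) := by
        refine integral_congr_ae (Filter.Eventually.of_forall fun x => ?_)
        simp only [hA]; ring
    _ = ∫ x, (fun y => (a * ((lam ^ γ : ℝ) : ℂ)) * (g y * ψ y)) (lam • x + x₀) := by
        rw [integral_affine (fun y => (a * ((lam ^ γ : ℝ) : ℂ)) * (f y * absGrad γ ψ y)) hl,
          integral_affine (fun y => (a * ((lam ^ γ : ℝ) : ℂ)) * (g y * ψ y)) hl,
          integral_const_mul, integral_const_mul, key]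
    _ = _ := by
        refine integral_congr_ae (Filter.Eventually.of_forall fun x => ?_)
        simp only [← hP]; ring

theorem IsFourierPair.const_mul {f F : Space d → ℂ} (h : IsFourierPair f F) (a : ℂ) :
    IsFourierPair (fun x => a * f x) (fun x => a * F x) := by
  refine ⟨h.1.const_mul a, h.2.1.const_mul a, fun φ => ?_⟩
  simp only [mul_assoc]
  rw [integral_const_mul, integral_const_mul, h.2.2]

theorem IsFourierPair.affine {f F : Space d → ℂ} (h : IsFourierPair f F) {lam : ℝ}
    (hl : 0 < lam) (x₀ : Space d) :
    IsFourierPair (fun x => f (lam • x + x₀)) (fun ξ => (((lam ^ d)⁻¹ : ℝ) : ℂ) *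
      ((Real.fourierChar (inner ℝ x₀ (lam⁻¹ • ξ)) : ℂ) * F (lam⁻¹ • ξ))) := by
  -- Pulling `𝓕 φ` back by the inverse affine map gives the transform of a test function `ψ`, which
  -- is a modulated dilate of `φ`.
  have key : ∀ φ : 𝓢(Space d, ℂ), ∃ ψ : 𝓢(Space d, ℂ),
      (∀ x, 𝓕 (ψ : Space d → ℂ) (lam • x + x₀) = 𝓕 (φ : Space d → ℂ) x) ∧
      ∀ ξ, ψ (lam⁻¹ • ξ) = ((lam ^ d : ℝ) : ℂ) *
        ((Real.fourierChar (inner ℝ x₀ (lam⁻¹ • ξ)) : ℂ) * φ ξ) := by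
    intro φ
    obtain ⟨χ, hχ⟩ := exists_schwartz_affine (𝓕 φ) (inv_pos.2 hl) (-(lam⁻¹ • x₀))
    refine ⟨𝓕⁻ χ, fun x => ?_, fun ξ => ?_⟩
    · rw [fourier_fourierInv_schwartz, hχ, affine_inv hl, SchwartzMap.fourier_coe]
    · rw [SchwartzMap.fourierInv_coe, show (χ : Space d → ℂ) = _ from funext hχ,
        fourierInv_affine _ (inv_pos.2 hl), fourierInv_fourier_schwartz, inv_inv, smul_smul,
        mul_inv_cancel₀ hl.ne', one_smul, inner_neg_left, neg_neg, inner_smul_left,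
        inner_smul_right]
      simp
  refine ⟨h.1.affine hl x₀, ⟨?_, fun φ => ?_⟩, fun φ => ?_⟩
  · have h1 : AEStronglyMeasurable (fun ξ => F (lam⁻¹ • ξ + 0)) volume :=
      h.2.1.1.comp_quasiMeasurePreserving (quasiMeasurePreserving_affine (inv_pos.2 hl) 0)
    simp only [add_zero] at h1
    refine AEStronglyMeasurable.const_mul (AEStronglyMeasurable.mul ?_ h1) _
    refine Continuous.aestronglyMeasurable ?_
    fun_prop
  · obtain ⟨ψ, -, hψ⟩ := key φ
    have := (integrable_affine (h.2.1.2 ψ) (inv_pos.2 hl) 0).const_mul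
      (((lam ^ d)⁻¹ : ℝ) * ((lam ^ d)⁻¹ : ℝ) : ℂ)
    simp only [add_zero, hψ] at this
    refine this.congr (Filter.Eventually.of_forall fun ξ => ?_)
    have hlc : (lam : ℂ) ≠ 0 := by exact_mod_cast hl.ne'
    push_cast
    field_simp
  · obtain ⟨ψ, hψ1, hψ2⟩ := key φ
    have hlc : (lam : ℂ) ≠ 0 := by exact_mod_cast hl.ne'
    have h1 := integral_affine (fun y => f y * 𝓕 (ψ : Space d → ℂ) y) hl x₀
    simp only [hψ1] at h1
    have h2 := integral_affine (fun y => F y * ψ y) (inv_pos.2 hl) 0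
    simp only [add_zero, hψ2] at h2
    rw [h1, h.2.2]
    have h3 : ∫ ξ, F ξ * ψ ξ = (((lam ^ d)⁻¹ : ℝ) : ℂ) * ∫ ξ, F (lam⁻¹ • ξ) *
        (((lam ^ d : ℝ) : ℂ) * ((Real.fourierChar (inner ℝ x₀ (lam⁻¹ • ξ)) : ℂ) * φ ξ)) := by
      rw [h2, ← mul_assoc, ← Complex.ofReal_mul, inv_pow, inv_inv,
        inv_mul_cancel₀ (pow_pos hl d).ne', Complex.ofReal_one, one_mul]
    rw [h3, ← integral_const_mul, ← integral_const_mul]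
    refine integral_congr_ae (Filter.Eventually.of_forall fun ξ => ?_)
    simp only
    push_cast
    field_simp

/-! ### Uniqueness of the distributional Fourier transform -/

/-- The product `u · 𝓕 φ` is integrable, and pairing its transform with `θ` tests `u` against the
transform of the convolution of `φ` and `θ`, which is compactly supported. Injectivity of `𝓕` on
`L¹` concludes. -/
theorem ae_eq_zero_mul_fourier {u : Space d → ℂ} (hu : IsTempered u)
    (h : ∀ φ : 𝓢(Space d, ℂ), HasCompactSupport φ → ∫ x, u x * 𝓕 (φ : Space d → ℂ) x = 0)
    {φ : 𝓢(Space d, ℂ)} (hφ : HasCompactSupport φ) :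
    (fun x => u x * 𝓕 (φ : Space d → ℂ) x) =ᵐ[volume] 0 := by
  have hv : Integrable (fun x => u x * 𝓕 (φ : Space d → ℂ) x) volume := hu.2 (𝓕 φ)
  set v := fun x => u x * 𝓕 (φ : Space d → ℂ) x with hvdef
  have h0 : 𝓕 v =ᵐ[volume] 0 := by
    refine ae_eq_zero_of_forall_schwartz (continuous_fourier hv).locallyIntegrable fun θ hθ => ?_
    rw [integral_fourier_mul_eq hv θ.integrable]
    set c := SchwartzMap.convolution (ContinuousLinearMap.mul ℂ ℂ) φ θ with hc
    have hcc : HasCompactSupport c := by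
      have e : (c : Space d → ℂ) = _ :=
        funext fun x => SchwartzMap.convolution_apply (ContinuousLinearMap.mul ℂ ℂ) φ θ x
      rw [e]
      exact hφ.convolution (ContinuousLinearMap.mul ℂ ℂ) hθ (μ := volume)
    rw [← h c hcc]
    refine integral_congr_ae (Filter.Eventually.of_forall fun x => ?_)
    have : 𝓕 (c : Space d → ℂ) x = 𝓕 (φ : Space d → ℂ) x * 𝓕 (θ : Space d → ℂ) x :=
      (DFunLike.congr_fun (SchwartzMap.fourier_convolution (ContinuousLinearMap.mul ℂ ℂ) φ θ) x).trans
        (SchwartzMap.pairing_apply_apply _ _ _ _)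
    simp only [hvdef, this, mul_assoc]
  refine ((isFourierPair_fourier hv).congr (ae_eq_refl _) h0).ae_eq_left ?_
  exact ⟨isTempered_of_memLp le_top MemLp.zero, isTempered_of_memLp le_top MemLp.zero, by simp⟩

/-- A tempered function is determined by its Fourier transform as a distribution. -/
theorem ae_eq_zero_of_fourier_eq_zero {u : Space d → ℂ} (hu : IsTempered u)
    (h : ∀ φ : 𝓢(Space d, ℂ), HasCompactSupport φ → ∫ x, u x * 𝓕 (φ : Space d → ℂ) x = 0) :
    u =ᵐ[volume] 0 := by
  -- A bump has positive integral, so its transform is nonzero at the origin and near it.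
  let b : ContDiffBump (0 : Space d) := ⟨1, 2, one_pos, one_lt_two⟩
  obtain ⟨φ, hφc, hφb⟩ := toSchwartz_exists (b.contDiff (n := ⊤)) b.hasCompactSupport
  have hφ0 : 𝓕 (φ : Space d → ℂ) 0 ≠ 0 := by
    rw [Real.fourier_eq]
    simp only [inner_zero_right, neg_zero, AddChar.map_zero_eq_one, one_smul, hφb]
    rw [integral_complex_ofReal]
    exact_mod_cast (b.integral_pos (μ := volume)).ne'
  rw [Filter.EventuallyEq, ae_iff]
  refine measure_null_of_locally_null _ fun y _ => ?_
  -- Translating `𝓕 φ` to `y` amounts to modulating `φ`, so the test function keeps its compact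
  -- support while its transform is nonzero near `y`.
  obtain ⟨χ, hχ⟩ := exists_schwartz_affine (𝓕 φ) one_pos (-y)
  have hφy : HasCompactSupport ((𝓕⁻ χ : 𝓢(Space d, ℂ)) : Space d → ℂ) := by
    refine hφc.mono fun ξ hξ => ?_
    contrapose! hξ
    have hφξ : φ ξ = 0 := by simpa using hξ
    rw [Function.notMem_support, SchwartzMap.fourierInv_coe,
      show (χ : Space d → ℂ) = _ from funext hχ,
      fourierInv_affine _ one_pos, fourierInv_fourier_schwartz, inv_one, one_smul, hφξ]
    simp
  have h1 := ae_eq_zero_mul_fourier hu h hφy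
  rw [fourier_fourierInv_schwartz] at h1
  have hχy : χ y ≠ 0 := by
    rw [hχ, one_smul, add_neg_cancel]
    exact hφ0
  have hnhds : {x | χ x ≠ 0} ∈ nhds y := χ.continuous.continuousAt.eventually_ne hχy
  refine ⟨{x | ¬ u x = (0 : Space d → ℂ) x} ∩ {x | χ x ≠ 0},
    Filter.inter_mem self_mem_nhdsWithin (mem_nhdsWithin_of_mem_nhds hnhds), ?_⟩
  rw [Filter.EventuallyEq, ae_iff] at h1
  refine measure_mono_null (fun x hx => ?_) h1
  exact fun h0 => hx.1 ((mul_eq_zero.1 h0).resolve_right hx.2)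

/-! ### Representation of `Ḣ^γ` -/

/-- Low-frequency half of dividing by the symbol: `2γ < d` makes its inverse square integrable at
the origin. -/
theorem memLp_indicator_inv_absSymbol (hd : 1 ≤ d) {γ : ℝ} (hγ : 2 * γ < d) :
    MemLp ({ξ : Space d | ‖ξ‖ ≤ 1}.indicator fun ξ => (absSymbol γ ξ)⁻¹) 2 volume := by
  obtain ⟨c, hc, hcA⟩ := integral_closedBall_norm_rpow (d := d) hd hγ
  have mlo : MeasurableSet {ξ : Space d | ‖ξ‖ ≤ 1} := measurableSet_le measurable_norm measurable_const
  refine ⟨((measurable_absSymbol γ).inv.indicator mlo).aestronglyMeasurable, ?_⟩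
  rw [eLpNorm_lt_top_iff_lintegral_rpow_enorm_lt_top (by norm_num) (by norm_num)]
  have hk := hcA 1 one_pos
  have hlt : ∫⁻ ξ : Space d, ENNReal.ofReal ((2 * Real.pi) ^ (-(2 * γ))) * ENNReal.ofReal
      ((Set.Iic (1 : ℝ)).indicator (fun t : ℝ => t ^ (-(2 * γ))) ‖ξ‖) < ∞ := by
    rw [lintegral_const_mul' _ _ ENNReal.ofReal_ne_top, hk]
    exact ENNReal.mul_lt_top ENNReal.ofReal_lt_top ENNReal.ofReal_lt_top
  refine lt_of_le_of_lt (lintegral_mono fun ξ => ?_) hlt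
  by_cases hξ : ‖ξ‖ ≤ 1
  · have h1 : ξ ∈ {ξ : Space d | ‖ξ‖ ≤ 1} := hξ
    have h2 : ‖ξ‖ ∈ Set.Iic (1 : ℝ) := hξ
    rw [Set.indicator_of_mem h1, Set.indicator_of_mem h2, ← ofReal_norm, norm_inv,
      norm_absSymbol, ENNReal.ofReal_rpow_of_nonneg (by positivity) (by norm_num),
      ← ENNReal.ofReal_mul (by positivity), ← Real.mul_rpow (by positivity) (norm_nonneg _)]
    refine ENNReal.ofReal_le_ofReal (le_of_eq ?_)
    rw [← Real.rpow_neg (by positivity), ← Real.rpow_mul (by positivity)]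
    congr 1
    norm_num
    ring
  · have h1 : ξ ∉ {ξ : Space d | ‖ξ‖ ≤ 1} := hξ
    simp [Set.indicator_of_notMem h1]

/-- A square integrable function divided by `|2πξ|^γ`, `γ < d/2`, is a Fourier transform. -/
theorem exists_isFourierPair_div (hd : 1 ≤ d) {γ : ℝ} (hγ0 : 0 < γ) (hγ : 2 * γ < d)
    {H : Space d → ℂ} (hH : MemLp H 2 volume) :
    ∃ f, IsFourierPair f (fun ξ => (absSymbol γ ξ)⁻¹ * H ξ) := by
  set F : Space d → ℂ := fun ξ => (absSymbol γ ξ)⁻¹ * H ξ with hF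
  have hFm : AEStronglyMeasurable F volume :=
    (measurable_absSymbol γ).inv.aestronglyMeasurable.mul hH.1
  have mhi : MeasurableSet {ξ : Space d | 1 < ‖ξ‖} := measurableSet_lt measurable_const measurable_norm
  have hinv := memLp_indicator_inv_absSymbol hd hγ
  -- Below frequency one the quotient is a product of two `L²` functions, hence in `L¹`; above it
  -- the inverse symbol is at most one and the quotient stays in `L²`. Each piece is a Fourier
  -- transform.
  have hlo : Integrable ({ξ : Space d | ‖ξ‖ ≤ 1}.indicator F) volume := by
    have := hinv.integrable_mul hH
    refine this.congr (Filter.Eventually.of_forall fun ξ => ?_)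
    simp only [Pi.mul_apply, hF, Set.indicator_apply]
    split_ifs <;> simp
  have hhi : MemLp ({ξ : Space d | 1 < ‖ξ‖}.indicator F) 2 volume := by
    refine MemLp.of_le_mul (c := 1) hH (hFm.indicator mhi) (Filter.Eventually.of_forall fun ξ => ?_)
    by_cases hξ : 1 < ‖ξ‖
    · have h1 : ξ ∈ {ξ : Space d | 1 < ‖ξ‖} := hξ
      rw [Set.indicator_of_mem h1, hF]
      simp only [norm_mul, norm_inv, norm_absSymbol]
      gcongr
      refine inv_le_one_of_one_le₀ (Real.one_le_rpow ?_ hγ0.le)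
      nlinarith [Real.pi_gt_three]
    · have h1 : ξ ∉ {ξ : Space d | 1 < ‖ξ‖} := hξ
      rw [Set.indicator_of_notMem h1, norm_zero]; positivity
  obtain ⟨fhi, -, hfhi, -⟩ := exists_fourierInv_of_memLp_two hhi
  refine ⟨_, ((isFourierPair_fourierInv hlo).add hfhi).congr (ae_eq_refl _)
    (Filter.Eventually.of_forall fun ξ => ?_)⟩
  by_cases hξ : ‖ξ‖ ≤ 1
  · simp [hξ, hξ.not_gt]
  · simp [hξ, not_le.1 hξ]

/-- Elements of `Ḣ^γ` with locally integrable Fourier transform are Riesz potentials of `L²`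
functions. -/
theorem exists_riesz_representation (hd : 1 ≤ d) {γ : ℝ} (hγ0 : 0 < γ) (hγ : 2 * γ < d)
    {f h H : Space d → ℂ} (hf : IsTempered f) (hloc : HasLocIntFourier f) (hh : IsAbsGrad γ f h)
    (hH : IsFourierPair h H) : IsFourierPair f (fun ξ => (absSymbol γ ξ)⁻¹ * H ξ) := by
  have : Nonempty (Fin d) := ⟨⟨0, hd⟩⟩
  have hH2 : MemLp H 2 volume := (eLpNorm_eq_of_isFourierPair hh.1 hH).1
  obtain ⟨f', hf'⟩ := exists_isFourierPair_div hd hγ0 hγ hH2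
  obtain ⟨G, hG, hGf⟩ := hloc
  have hcont : Continuous (absSymbol γ : Space d → ℂ) := by
    unfold absSymbol
    exact Complex.continuous_ofReal.comp ((continuous_const.mul continuous_norm).rpow_const
      fun _ => Or.inr hγ0.le)
  have hGl : LocallyIntegrable (fun ξ => absSymbol γ ξ * G ξ) volume := by
    rw [← locallyIntegrableOn_univ] at hG ⊢
    exact hG.continuousOn_mul hcont.continuousOn isOpen_univ.isLocallyClosed
  have hHl := hH.2.1.locallyIntegrable
  -- The relation in `𝓢₀'` identifies the transforms off the origin only. Both sides are locally
  -- integrable, so they agree a.e.; this is where `HasLocIntFourier` excludes polynomials.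
  have hz : (fun ξ => absSymbol γ ξ * G ξ - H ξ) =ᵐ[volume] 0 := by
    refine ae_eq_zero_of_forall_schwartz_away hd ((hGl.sub hHl).locallyIntegrableOn _)
      fun η hηc hs => ?_
    have hfl : IsFlat η := isFlat_of_zero_notMem_tsupport fun h0 => hs h0 rfl
    have hmem := fourier_mem_schwartzZero hfl
    obtain ⟨v, hv, he⟩ := exists_absGrad_eq γ hmem
    rw [fourierInv_fourier_eq] at hv
    have hvc : HasCompactSupport v := hηc.mono fun ξ hξ => by
      contrapose! hξ
      have : η ξ = 0 := by simpa using hξ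
      simp [hv, this]
    have h1 := hGf v hvc
    rw [← he, hh.2 _ hmem, SchwartzMap.fourier_coe, hH.2.2] at h1
    have hi1 : Integrable (fun ξ => absSymbol γ ξ * G ξ * η ξ) volume := by
      have := hG.integrable_smul_left_of_hasCompactSupport v.continuous hvc
      refine this.congr (Filter.Eventually.of_forall fun ξ => ?_)
      simp only [hv, smul_eq_mul]; ring
    simp only [sub_mul]
    rw [integral_sub hi1 (hH.2.1.2 η), h1, sub_eq_zero]
    refine integral_congr_ae (Filter.Eventually.of_forall fun ξ => ?_)
    simp only [hv]; ring
  have hGF : G =ᵐ[volume] fun ξ => (absSymbol γ ξ)⁻¹ * H ξ := by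
    filter_upwards [hz, compl_mem_ae_iff.2 (measure_singleton (0 : Space d))] with ξ hξ hξ0
    have h2 := sub_eq_zero.1 hξ
    have := absSymbol_ne_zero γ (ξ := ξ) hξ0
    rw [← h2, ← mul_assoc, inv_mul_cancel₀ this, one_mul]
  -- The Riesz potential `f'` and `f` have the same distributional transform on compactly supported
  -- tests, and such tests suffice.
  have hu : (fun x => f' x - f x) =ᵐ[volume] 0 := by
    refine ae_eq_zero_of_fourier_eq_zero (hf'.1.sub hf) fun φ hφ => ?_
    simp only [sub_mul]
    have i1 : Integrable (fun x => f' x * 𝓕 (φ : Space d → ℂ) x) volume := hf'.1.2 (𝓕 φ)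
    have i2 : Integrable (fun x => f x * 𝓕 (φ : Space d → ℂ) x) volume := hf.2 (𝓕 φ)
    rw [integral_sub i1 i2, hGf φ hφ, hf'.2.2, sub_eq_zero]
    refine integral_congr_ae ?_
    filter_upwards [hGF] with ξ hξ
    rw [hξ]
  refine hf'.congr ?_ (ae_eq_refl _)
  filter_upwards [hu] with x hx
  exact sub_eq_zero.1 hx

/-- Converse of the Riesz representation: membership in the space is checked through it each time a
new function is formed. -/
theorem mem_sobolevSpace_of_riesz (hd : 1 ≤ d) {γ : ℝ} {f h H g : Space d → ℂ}
    (hh : MemLp h 2 volume) (hH : IsFourierPair h H)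
    (hf : IsFourierPair f (fun ξ => (absSymbol γ ξ)⁻¹ * H ξ)) (hg : IsAbsGrad 2 f g) :
    f ∈ sobolevSpace d γ ∧ IsAbsGrad γ f h := by
  have : Nonempty (Fin d) := ⟨⟨0, hd⟩⟩
  have hA : IsAbsGrad γ f h := by
    refine isAbsGrad_of_isFourierPair hf hh hH ?_
    filter_upwards [compl_mem_ae_iff.2 (measure_singleton (0 : Space d))] with ξ hξ0
    rw [← mul_assoc, mul_inv_cancel₀ (absSymbol_ne_zero γ (ξ := ξ) hξ0), one_mul]
  exact ⟨⟨hf.1, ⟨_, hf.2.1.locallyIntegrable, fun φ _ => hf.2.2 φ⟩, hA.hdotNorm_lt hd,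
    hg.hdotNorm_lt hd⟩, hA⟩

/-! ### A smooth high-frequency inverse of `-Δ` -/

/-- To be evaluated at `t = 1 / (1 + |2πξ|²)`, where `t / (1 - t) = |2πξ|⁻²`. High frequencies
correspond to small `t`, and the cutoff near `t = 1` removes the singularity at `ξ = 0`. -/
theorem exists_cutoff_inverse : ∃ κ : ℝ → ℝ, ContDiff ℝ ((⊤ : ℕ∞) : WithTop ℕ∞) κ ∧
    HasCompactSupport κ ∧ (∀ t, 0 ≤ t → t ≤ 1 / 2 → κ t = t / (1 - t)) ∧
    (∀ t, 3 / 4 ≤ t → κ t = 0) ∧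
    (∀ t, 0 ≤ t → t ≤ 1 → 0 ≤ κ t ∧ κ t ≤ 3 ∧ (1 - t) * κ t ≤ t) := by
  let b : ContDiffBump (0 : ℝ) := ⟨1 / 2, 3 / 4, by norm_num, by norm_num⟩
  have hb0 : ∀ t : ℝ, 3 / 4 ≤ t → b t = 0 := fun t ht =>
    b.zero_of_le_dist (by rw [Real.dist_eq, sub_zero]; exact ht.trans (le_abs_self t))
  refine ⟨fun t => b t * (t / (1 - t)), ?_, b.hasCompactSupport.mul_right, ?_, ?_, ?_⟩
  · rw [contDiff_iff_contDiffAt]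
    intro t
    rcases lt_or_ge t 1 with ht | ht
    · refine b.contDiff.contDiffAt.mul ?_
      exact contDiffAt_id.div (contDiffAt_const.sub contDiffAt_id) (sub_pos.2 ht).ne'
    · have : (fun t => b t * (t / (1 - t))) =ᶠ[nhds t] fun _ => 0 := by
        filter_upwards [lt_mem_nhds (show (3 / 4 : ℝ) < t by linarith)] with y hy
        rw [hb0 y hy.le, zero_mul]
      exact contDiffAt_const.congr_of_eventuallyEq this
  · intro t h0 h1
    have : b t = 1 := b.one_of_mem_closedBall (by
      rw [Metric.mem_closedBall, Real.dist_eq, sub_zero, abs_of_nonneg h0]; exact h1)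
    simp [this]
  · intro t ht
    simp [hb0 t ht]
  · intro t h0 h1
    rcases le_or_gt (3 / 4) t with ht | ht
    · simp [hb0 t ht, h0]
    · have hb1 := b.le_one (x := t)
      have hbn := b.nonneg (x := t)
      have hpos : 0 < 1 - t := by linarith
      have hq : 0 ≤ t / (1 - t) := by positivity
      have hq3 : t / (1 - t) ≤ 3 := by rw [div_le_iff₀ hpos]; linarith
      have hle : b t * (t / (1 - t)) ≤ t / (1 - t) := mul_le_of_le_one_left hq hb1
      refine ⟨by positivity, hle.trans hq3, ?_⟩
      calc (1 - t) * (b t * (t / (1 - t))) ≤ (1 - t) * (t / (1 - t)) := by gcongr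
        _ = t := by field_simp

/-- A smooth multiplier equal to `|2πξ|⁻²` for large `ξ` and to `0` near the origin. -/
theorem exists_highFreq_multiplier : ∃ m : Space d → ℝ, m.HasTemperateGrowth ∧
    (0 : Space d) ∉ tsupport m ∧ HasCompactSupport (fun ξ => 1 - (2 * Real.pi * ‖ξ‖) ^ 2 * m ξ) ∧
    (∀ ξ, 0 ≤ m ξ) ∧ (∀ ξ, m ξ ≤ 3) ∧ ∀ ξ, (2 * Real.pi * ‖ξ‖) ^ 2 * m ξ ≤ 1 := by
  obtain ⟨κ, hκ, hκc, hκ1, hκ0, hκb⟩ := exists_cutoff_inverse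
  -- The symbol `1 / (1 + |2πξ|²)` has temperate growth, hence so does `κ ∘ ρ`.
  set ρ : Space d → ℝ := fun ξ => (1 + ‖(2 * Real.pi) • ξ‖ ^ 2) ^ (-1 : ℝ) with hρ
  have hρe : ∀ ξ, ρ ξ = 1 / (1 + (2 * Real.pi * ‖ξ‖) ^ 2) := fun ξ => by
    simp only [hρ]
    rw [Real.rpow_neg_one, norm_smul, Real.norm_of_nonneg (by positivity), one_div]
  have hρt : ρ.HasTemperateGrowth := by
    have h1 := Function.hasTemperateGrowth_one_add_norm_sq_rpow (Space d) (-1)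
    exact h1.comp (((2 * Real.pi) • ContinuousLinearMap.id ℝ (Space d)).hasTemperateGrowth)
  have hρ01 : ∀ ξ, 0 ≤ ρ ξ ∧ ρ ξ ≤ 1 := fun ξ => by
    rw [hρe]
    exact ⟨by positivity, by rw [div_le_one (by positivity)]; nlinarith [sq_nonneg (2 * Real.pi * ‖ξ‖)]⟩
  have hρid : ∀ ξ, (2 * Real.pi * ‖ξ‖) ^ 2 * ρ ξ = 1 - ρ ξ := fun ξ => by
    rw [hρe]; field_simp; ring
  have hρpos : ∀ ξ, 0 < ρ ξ := fun ξ => by rw [hρe]; positivity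
  refine ⟨fun ξ => κ (ρ ξ), (hκc.hasTemperateGrowth hκ).comp hρt, ?_, ?_, fun ξ => (hκb _ (hρ01 ξ).1
    (hρ01 ξ).2).1, fun ξ => (hκb _ (hρ01 ξ).1 (hρ01 ξ).2).2.1, fun ξ => ?_⟩
  · rw [notMem_tsupport_iff_eventuallyEq]
    have hc : ContinuousAt ρ 0 := hρt.1.continuous.continuousAt
    have h0 : (3 / 4 : ℝ) < ρ 0 := by rw [hρe]; norm_num
    filter_upwards [hc.eventually_const_lt h0] with ξ hξ
    exact hκ0 _ hξ.le
  · refine HasCompactSupport.intro (isCompact_closedBall (0 : Space d) 1) fun ξ hξ => ?_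
    have hξ1 : 1 < ‖ξ‖ := by simpa using hξ
    have hbig : 1 ≤ (2 * Real.pi * ‖ξ‖) ^ 2 := by
      have : 1 ≤ 2 * Real.pi * ‖ξ‖ := by nlinarith [Real.pi_gt_three]
      nlinarith
    have hhalf : ρ ξ ≤ 1 / 2 := by
      rw [hρe]; exact one_div_le_one_div_of_le (by norm_num) (by linarith)
    simp only [hκ1 _ (hρ01 ξ).1 hhalf]
    have := hρid ξ
    have h2 : 1 - ρ ξ ≠ 0 := by linarith
    rw [mul_div_assoc', this, div_self h2, sub_self]
  · have h1 := (hκb _ (hρ01 ξ).1 (hρ01 ξ).2).2.2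
    rw [← hρid ξ] at h1
    have := hρpos ξ
    by_contra! hlt
    nlinarith

/-- The multiplier is `A⁻² m(ξ / A)`. The power `A ^ (s - 2)` is the gain that makes the high part
small in every norm of order `s < 2` as `A` grows. -/
theorem exists_highFreq_multiplier_scaled {A : ℝ} (hA : 0 < A) :
    ∃ m : Space d → ℝ, m.HasTemperateGrowth ∧
    (0 : Space d) ∉ tsupport m ∧ HasCompactSupport (fun ξ => 1 - (2 * Real.pi * ‖ξ‖) ^ 2 * m ξ) ∧
    ∀ s : ℝ, 0 ≤ s → s ≤ 2 → ∀ ξ, ‖ξ‖ ^ s * |m ξ| ≤ 3 * A ^ (s - 2) := by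
  obtain ⟨m, hm, hm0, hmc, hmn, hm3, hm1⟩ := exists_highFreq_multiplier (d := d)
  set L : Space d →L[ℝ] Space d := A⁻¹ • ContinuousLinearMap.id ℝ (Space d) with hL
  have hLn : ∀ ξ, ‖L ξ‖ = A⁻¹ * ‖ξ‖ := fun ξ => by
    simp [hL, norm_smul, abs_of_pos hA]
  have hLcont : Continuous L := L.continuous
  let e : Space d ≃ₜ Space d := Homeomorph.smulOfNeZero A⁻¹ (inv_pos.2 hA).ne'
  have heL : ∀ ξ, L ξ = e ξ := fun ξ => by simp [hL, e]
  refine ⟨fun ξ => (A ^ 2)⁻¹ * m (L ξ), ?_, ?_, ?_, ?_⟩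
  · exact (Function.HasTemperateGrowth.const _).mul (hm.comp L.hasTemperateGrowth)
  · rw [notMem_tsupport_iff_eventuallyEq] at hm0 ⊢
    have ht : Filter.Tendsto L (nhds 0) (nhds 0) := by
      have := hLcont.tendsto 0
      rwa [map_zero] at this
    filter_upwards [ht.eventually hm0] with ξ hξ
    simp only [Pi.zero_apply] at hξ ⊢
    rw [hξ, mul_zero]
  · have := hmc.comp_homeomorph e
    convert this using 1
    ext ξ
    simp only [Function.comp, ← heL, hLn]
    field_simp
  · intro s hs0 hs2 ξ
    have hmL := hm3 (L ξ)
    have hm1L := hm1 (L ξ)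
    have hmnL := hmn (L ξ)
    have hstep : ‖L ξ‖ ^ s * m (L ξ) ≤ 3 := by
      rcases le_or_gt ‖L ξ‖ 1 with h1 | h1
      · calc ‖L ξ‖ ^ s * m (L ξ) ≤ 1 * 3 := by
              gcongr
              exact Real.rpow_le_one (norm_nonneg _) h1 hs0
          _ = 3 := by norm_num
      · have h2 : ‖L ξ‖ ^ s ≤ (2 * Real.pi * ‖L ξ‖) ^ 2 := by
          calc ‖L ξ‖ ^ s ≤ ‖L ξ‖ ^ (2 : ℝ) := Real.rpow_le_rpow_of_exponent_le h1.le hs2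
            _ = ‖L ξ‖ ^ 2 := by norm_cast
            _ ≤ (2 * Real.pi * ‖L ξ‖) ^ 2 := by
              gcongr
              nlinarith [Real.pi_gt_three]
        calc ‖L ξ‖ ^ s * m (L ξ) ≤ (2 * Real.pi * ‖L ξ‖) ^ 2 * m (L ξ) := by gcongr
          _ ≤ 3 := by linarith
    have hxi : ‖ξ‖ = A * ‖L ξ‖ := by rw [hLn]; field_simp
    rw [abs_of_nonneg (by positivity), hxi, Real.mul_rpow hA.le (norm_nonneg _), Real.rpow_sub hA,
      Real.rpow_two]
    calc A ^ s * ‖L ξ‖ ^ s * ((A ^ 2)⁻¹ * m (L ξ)) = (‖L ξ‖ ^ s * m (L ξ)) * (A ^ s / A ^ 2) := by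
          rw [div_eq_mul_inv]; ring
      _ ≤ 3 * (A ^ s / A ^ 2) := by gcongr

/-! ### Smoothing with a Schwartz kernel -/

/-- The correlation `x ↦ ∫ f(y) Ψ(y - x) dy`. -/
def corr (Ψ : 𝓢(Space d, ℂ)) (f : Space d → ℂ) (x : Space d) : ℂ := ∫ y, f y * Ψ (y - x)

/-- The constant in Hölder's inequality for `corr`. -/
def corrConst (r : ℝ≥0∞) (Ψ : 𝓢(Space d, ℂ)) : ℝ :=
  (eLpNorm Ψ (ENNReal.conjExponent r) volume).toReal

theorem corrConst_nonneg (r : ℝ≥0∞) (Ψ : 𝓢(Space d, ℂ)) : 0 ≤ corrConst r Ψ := ENNReal.toReal_nonneg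

theorem ofReal_corrConst (r : ℝ≥0∞) (Ψ : 𝓢(Space d, ℂ)) :
    ENNReal.ofReal (corrConst r Ψ) = eLpNorm Ψ (ENNReal.conjExponent r) volume :=
  ENNReal.ofReal_toReal (Ψ.memLp (ENNReal.conjExponent r) volume).2.ne

theorem lintegral_corr_le {r : ℝ≥0∞} (hr : 1 ≤ r) (Ψ : 𝓢(Space d, ℂ)) {f : Space d → ℂ}
    (hf : MemLp f r volume) (x : Space d) :
    ∫⁻ y, ‖f y * Ψ (y - x)‖ₑ ≤ ENNReal.ofReal (corrConst r Ψ) * eLpNorm f r volume := by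
  have : ENNReal.HolderConjugate r (ENNReal.conjExponent r) := ENNReal.HolderConjugate.conjExponent hr
  have hΨ : eLpNorm (fun y => Ψ (y - x)) (ENNReal.conjExponent r) volume =
      eLpNorm Ψ (ENNReal.conjExponent r) volume :=
    eLpNorm_comp_measurePreserving Ψ.continuous.aestronglyMeasurable (measurePreserving_sub_right volume x)
  have hm : AEStronglyMeasurable (fun y => Ψ (y - x)) volume :=
    (Ψ.continuous.comp (continuous_id.sub continuous_const)).aestronglyMeasurable
  have := eLpNorm_smul_le_mul_eLpNorm (p := r) (q := ENNReal.conjExponent r) (r := 1)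
    (μ := volume) hm hf.1
  rw [eLpNorm_one_eq_lintegral_enorm, hΨ, ← ofReal_corrConst, mul_comm] at this
  exact this

theorem norm_corr_le {r : ℝ≥0∞} (hr : 1 ≤ r) (Ψ : 𝓢(Space d, ℂ)) {f : Space d → ℂ}
    (hf : MemLp f r volume) (x : Space d) :
    ‖corr Ψ f x‖ ≤ corrConst r Ψ * (eLpNorm f r volume).toReal := by
  have h1 := (enorm_integral_le_lintegral_enorm (μ := volume) (fun y => f y * Ψ (y - x))).trans
    (lintegral_corr_le hr Ψ hf x)
  rw [← toReal_enorm]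
  refine (ENNReal.toReal_mono (ENNReal.mul_ne_top ENNReal.ofReal_ne_top hf.2.ne) h1).trans ?_
  rw [ENNReal.toReal_mul, ENNReal.toReal_ofReal (corrConst_nonneg r Ψ)]

theorem aestronglyMeasurable_corr_kernel (Ψ : 𝓢(Space d, ℂ)) {f : Space d → ℂ}
    (hf : AEStronglyMeasurable f volume) :
    AEStronglyMeasurable (fun z : Space d × Space d => f z.2 * Ψ (z.2 - z.1))
      (volume.prod volume) :=
  hf.comp_snd.mul (Ψ.continuous.comp (continuous_snd.sub continuous_fst)).aestronglyMeasurable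

theorem aestronglyMeasurable_corr (Ψ : 𝓢(Space d, ℂ)) {f : Space d → ℂ}
    (hf : AEStronglyMeasurable f volume) : AEStronglyMeasurable (corr Ψ f) volume :=
  (aestronglyMeasurable_corr_kernel Ψ hf).integral_prod_right'

/-- The convolution theorem, written with the kernel `y - x` that occurs in `corr`; it is obtained
by applying the transform once more and inverting. -/
theorem fourier_mul_eq_integral {χ η v : 𝓢(Space d, ℂ)} (hv : ∀ ξ, v ξ = χ ξ * η ξ) (y : Space d) :
    𝓕 (v : Space d → ℂ) y =
      ∫ x, (𝓕 χ : 𝓢(Space d, ℂ)) (y - x) * (𝓕 η : 𝓢(Space d, ℂ)) x := by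
  have h1 := SchwartzMap.convolution_apply (ContinuousLinearMap.mul ℂ ℂ) (𝓕 η) (𝓕 χ) y
  have h2 := SchwartzMap.fourier_convolution (ContinuousLinearMap.mul ℂ ℂ) (𝓕 η) (𝓕 χ)
  have h3 : SchwartzMap.convolution (ContinuousLinearMap.mul ℂ ℂ) (𝓕 η) (𝓕 χ) = 𝓕 v := by
    have e : SchwartzMap.convolution (ContinuousLinearMap.mul ℂ ℂ) (𝓕 η) (𝓕 χ) =
        𝓕⁻ (𝓕 (SchwartzMap.convolution (ContinuousLinearMap.mul ℂ ℂ) (𝓕 η) (𝓕 χ))) :=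
      (fourierInv_fourier_eq _).symm
    rw [e, h2]
    ext x
    rw [SchwartzMap.fourierInv_coe, SchwartzMap.fourier_coe, Real.fourierInv_eq_fourier_comp_neg]
    refine congrFun (congrArg (fun h : Space d → ℂ => 𝓕 h) (funext fun ξ => ?_)) x
    have hneg : ∀ (w : 𝓢(Space d, ℂ)), (𝓕 (𝓕 w) : 𝓢(Space d, ℂ)) (-ξ) = w ξ := fun w => by
      rw [SchwartzMap.fourier_coe, ← Real.fourierInv_eq_fourier_neg, fourierInv_fourier_schwartz]
    simp only [SchwartzMap.pairing_apply_apply, ContinuousLinearMap.mul_apply', hneg, hv, mul_comm]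
  rw [h3] at h1
  rw [← SchwartzMap.fourier_coe, h1]
  simp only [convolution, ContinuousLinearMap.mul_apply', mul_comm]

/-- Identifies the low-frequency part of `f` as a correlation by Fubini, without assuming that `f`
has a Fourier transform that is a function. Hölder makes the double integral absolutely convergent.
-/
theorem integral_mul_fourier_mul {r : ℝ≥0∞} (hr : 1 ≤ r) {f : Space d → ℂ} (hf : MemLp f r volume)
    {χ η v : 𝓢(Space d, ℂ)} (hv : ∀ ξ, v ξ = χ ξ * η ξ) :
    ∫ y, f y * 𝓕 (v : Space d → ℂ) y = ∫ x, corr (𝓕 χ) f x * (𝓕 η : 𝓢(Space d, ℂ)) x := by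
  have hker := aestronglyMeasurable_corr_kernel (𝓕 χ) hf.1
  have hint : Integrable (fun z : Space d × Space d =>
      f z.2 * (𝓕 χ : 𝓢(Space d, ℂ)) (z.2 - z.1) * (𝓕 η : 𝓢(Space d, ℂ)) z.1)
      (volume.prod volume) := by
    have hm : AEStronglyMeasurable (fun z : Space d × Space d =>
      f z.2 * (𝓕 χ : 𝓢(Space d, ℂ)) (z.2 - z.1) * (𝓕 η : 𝓢(Space d, ℂ)) z.1)
      (volume.prod volume) :=
      hker.mul ((𝓕 η).continuous.comp continuous_fst).aestronglyMeasurable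
    refine ⟨hm, ?_⟩
    rw [HasFiniteIntegral, lintegral_prod _ hm.enorm]
    simp only [enorm_mul]
    calc ∫⁻ x, ∫⁻ y, ‖f y‖ₑ * ‖(𝓕 χ : 𝓢(Space d, ℂ)) (y - x)‖ₑ * ‖(𝓕 η : 𝓢(Space d, ℂ)) x‖ₑ
        ≤ ∫⁻ x, (ENNReal.ofReal (corrConst r (𝓕 χ)) * eLpNorm f r volume) *
          ‖(𝓕 η : 𝓢(Space d, ℂ)) x‖ₑ := by
          refine lintegral_mono fun x => ?_
          rw [lintegral_mul_const' _ _ enorm_ne_top]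
          gcongr
          simpa only [enorm_mul] using lintegral_corr_le hr (𝓕 χ) hf x
      _ < ∞ := by
          rw [lintegral_const_mul' _ _ (ENNReal.mul_ne_top ENNReal.ofReal_ne_top hf.2.ne)]
          exact ENNReal.mul_lt_top (ENNReal.mul_lt_top ENNReal.ofReal_lt_top hf.2)
            (𝓕 η).integrable.2
  have hswap := integral_integral_swap
    (f := fun x y => f y * (𝓕 χ : 𝓢(Space d, ℂ)) (y - x) * (𝓕 η : 𝓢(Space d, ℂ)) x) hint
  simp only [fourier_mul_eq_integral hv, corr]
  calc ∫ y, f y * ∫ x, (𝓕 χ : 𝓢(Space d, ℂ)) (y - x) * (𝓕 η : 𝓢(Space d, ℂ)) x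
      = ∫ y, ∫ x, f y * (𝓕 χ : 𝓢(Space d, ℂ)) (y - x) * (𝓕 η : 𝓢(Space d, ℂ)) x := by
        simp only [mul_assoc, integral_const_mul]
    _ = _ := hswap.symm
    _ = _ := by simp only [integral_mul_const]

/-! ### Splitting into low and high frequencies -/

theorem exists_schwartz_mul {m : Space d → ℝ} (hm : m.HasTemperateGrowth) (η : 𝓢(Space d, ℂ)) :
    ∃ v : 𝓢(Space d, ℂ), ∀ ξ, v ξ = (m ξ : ℂ) * η ξ := by
  refine ⟨SchwartzMap.smulLeftCLM ℂ (fun ξ => m ξ) η, fun ξ => ?_⟩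
  rw [SchwartzMap.smulLeftCLM_apply_apply hm]
  simp

theorem hasTemperateGrowth_absSymbol_two :
    (fun ξ : Space d => (2 * Real.pi * ‖ξ‖) ^ 2).HasTemperateGrowth := by
  have := (Function.HasTemperateGrowth.const (E := Space d) ((2 * Real.pi) ^ 2)).mul
    (Function.hasTemperateGrowth_norm_sq (H := Space d))
  have e : (fun ξ : Space d => (2 * Real.pi * ‖ξ‖) ^ 2) =
      (fun _ => (2 * Real.pi) ^ 2) * fun ξ => ‖ξ‖ ^ 2 := by
    ext ξ
    simp [mul_pow]
  rw [e]
  exact this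

/-- The low-frequency cutoff attached to a high-frequency multiplier. -/
theorem exists_lowFreq {m : Space d → ℝ} (hm : m.HasTemperateGrowth)
    (hmc : HasCompactSupport (fun ξ => 1 - (2 * Real.pi * ‖ξ‖) ^ 2 * m ξ)) :
    ∃ χ : 𝓢(Space d, ℂ), ∀ ξ, χ ξ = 1 - absSymbol 2 ξ * (m ξ : ℂ) := by
  have ht : (fun ξ : Space d => 1 - (2 * Real.pi * ‖ξ‖) ^ 2 * m ξ).HasTemperateGrowth :=
    (Function.HasTemperateGrowth.const 1).sub (hasTemperateGrowth_absSymbol_two.mul hm)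
  obtain ⟨χ, -, hχ⟩ := toSchwartz_exists ht.1 hmc
  exact ⟨χ, fun ξ => by rw [hχ, absSymbol_two]; push_cast; ring⟩

/-- Since `m` vanishes near the origin, `m η` is flat, so its transform is an admissible test
function in `𝓢₀`. -/
theorem IsAbsGrad.integral_highFreq {f g : Space d → ℂ} (h : IsAbsGrad 2 f g) {m : Space d → ℝ}
    (hm0 : (0 : Space d) ∉ tsupport m) {η v w : 𝓢(Space d, ℂ)} (hv : ∀ ξ, v ξ = (m ξ : ℂ) * η ξ)
    (hw : ∀ ξ, w ξ = absSymbol 2 ξ * (m ξ : ℂ) * η ξ) :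
    ∫ x, f x * 𝓕 (w : Space d → ℂ) x = ∫ x, g x * 𝓕 (v : Space d → ℂ) x := by
  have hfl : IsFlat v := isFlat_of_zero_notMem_tsupport fun h0 => hm0 (by
    refine closure_mono (fun ξ hξ => ?_) h0
    contrapose! hξ
    have : m ξ = 0 := by simpa using hξ
    simp [hv, this])
  have hmem := fourier_mem_schwartzZero hfl
  have := h.2 _ hmem
  rw [absGrad_eq_fourier, fourierInv_fourier_eq] at this
  rw [← SchwartzMap.fourier_coe v, ← this]
  have e : (w : Space d → ℂ) = fun ξ => absSymbol 2 ξ * v ξ := funext fun ξ => by rw [hw, hv]; ring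
  rw [e]

/-- On the Fourier side `1 = χ + |2πξ|² m`: the first term gives the correlation, and the second
depends on `f` only through `g`. The kernel depends on `A` alone, not on `f` or `r`, which is
essential for detection later. -/
theorem exists_decomposition {A : ℝ} (hA : 0 < A) :
    ∃ Ψ : 𝓢(Space d, ℂ), ∀ r : ℝ≥0∞, 1 ≤ r → ∀ f g : Space d → ℂ, MemLp f r volume →
      IsAbsGrad 2 f g → ∃ t T : Space d → ℂ, MemLp t 2 volume ∧ IsFourierPair t T ∧
        f =ᵐ[volume] (fun x => corr Ψ f x + t x) ∧
        ∀ s : ℝ, 0 ≤ s → s ≤ 2 → eLpNorm (fun ξ => ((‖ξ‖ ^ s : ℝ) : ℂ) * T ξ) 2 volume ≤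
          ENNReal.ofReal (3 * A ^ (s - 2)) * eLpNorm g 2 volume := by
  obtain ⟨m, hm, hm0, hmc, hmb⟩ := exists_highFreq_multiplier_scaled (d := d) hA
  obtain ⟨χ, hχ⟩ := exists_lowFreq hm hmc
  refine ⟨𝓕 χ, fun r hr f g hf hg => ?_⟩
  obtain ⟨G, hG2, hG, hGn⟩ := exists_fourier_of_memLp_two hg.1
  have hbound : ∀ s : ℝ, 0 ≤ s → s ≤ 2 →
      eLpNorm (fun ξ => ((‖ξ‖ ^ s : ℝ) : ℂ) * ((m ξ : ℂ) * G ξ)) 2 volume ≤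
        ENNReal.ofReal (3 * A ^ (s - 2)) * eLpNorm g 2 volume := by
    intro s hs0 hs2
    rw [← hGn]
    refine eLpNorm_le_mul_eLpNorm_of_ae_le_mul (Filter.Eventually.of_forall fun ξ => ?_) 2
    rw [norm_mul, norm_mul, Complex.norm_real, Complex.norm_real,
      Real.norm_of_nonneg (by positivity), Real.norm_eq_abs, ← mul_assoc]
    exact mul_le_mul_of_nonneg_right (hmb s hs0 hs2 ξ) (norm_nonneg _)
  have hT2 : MemLp (fun ξ => (m ξ : ℂ) * G ξ) 2 volume := by
    refine ⟨(Complex.continuous_ofReal.comp hm.1.continuous).aestronglyMeasurable.mul hG2.1, ?_⟩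
    have := hbound 0 le_rfl (by norm_num)
    simp only [Real.rpow_zero, Complex.ofReal_one, one_mul] at this
    exact lt_of_le_of_lt this (ENNReal.mul_lt_top ENNReal.ofReal_lt_top hg.1.2)
  obtain ⟨t, ht2, ht, -⟩ := exists_fourierInv_of_memLp_two hT2
  refine ⟨t, _, ht2, ht, ?_, hbound⟩
  have hlow : IsTempered (corr (𝓕 χ) f) :=
    isTempered_of_bounded (aestronglyMeasurable_corr _ hf.1) (norm_corr_le hr _ hf)
  have hft : IsTempered f := isTempered_of_memLp hr hf
  refine hft.ae_eq (hlow.add ht.1) fun φ => ?_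
  set η : 𝓢(Space d, ℂ) := 𝓕⁻ φ with hη
  have hφ : 𝓕 η = φ := by rw [hη, fourier_fourierInv_eq]
  have hφ' : 𝓕 (η : Space d → ℂ) = φ := fourier_fourierInv_schwartz φ
  obtain ⟨v, hv⟩ := exists_schwartz_mul hm η
  obtain ⟨u, hu⟩ : ∃ u : 𝓢(Space d, ℂ), ∀ ξ, u ξ = χ ξ * η ξ := by
    refine ⟨SchwartzMap.pairing (ContinuousLinearMap.mul ℂ ℂ) χ η, fun ξ => ?_⟩
    rw [SchwartzMap.pairing_apply_apply]; rfl
  have hw : ∀ ξ, (η - u) ξ = absSymbol 2 ξ * (m ξ : ℂ) * η ξ := fun ξ => by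
    rw [sub_apply, hu, hχ]; ring
  have h1 := hg.integral_highFreq hm0 hv hw
  have h2 := integral_mul_fourier_mul hr hf hu
  rw [hG.2.2] at h1
  have h3 : ∫ x, t x * φ x = ∫ ξ, G ξ * v ξ := by
    rw [← hφ', ht.2.2]
    refine integral_congr_ae (Filter.Eventually.of_forall fun ξ => ?_)
    simp only [hv]; ring
  simp only [add_mul]
  have i1 : Integrable (fun x => f x * 𝓕 (u : Space d → ℂ) x) volume := hft.2 (𝓕 u)
  have i2 : Integrable (fun x => f x * 𝓕 ((η - u : 𝓢(Space d, ℂ)) : Space d → ℂ) x) volume :=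
    hft.2 (𝓕 (η - u))
  rw [integral_add (hlow.2 φ) (ht.1.2 φ), h3, ← h1, ← hφ, ← h2, ← integral_add i1 i2]
  refine integral_congr_ae (Filter.Eventually.of_forall fun x => ?_)
  have hlin : 𝓕 η = 𝓕 u + 𝓕 (η - u) := by rw [← FourierTransform.fourier_add, add_sub_cancel]
  simp only
  rw [hlin, add_apply, SchwartzMap.fourier_coe, SchwartzMap.fourier_coe]
  ring

/-! ### The additive Gagliardo–Nirenberg inequality -/

/-- The relations between the exponents: `q` and `p` are the Sobolev exponents of `γ < s`. -/
structure Exponents (d : ℕ) (γ q s p : ℝ) : Prop where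
  dim : 1 ≤ d
  γ_pos : 0 < γ
  γ_lt : γ < 2
  γ_dim : 2 * γ < d
  q_eq : q = 2 * d / (d - 2 * γ)
  s_pos : 0 < s
  s_lt : s < 2
  s_dim : 2 * s < d
  p_eq : p = 2 * d / (d - 2 * s)
  γ_s : γ < s

namespace Exponents

variable {γ q s p : ℝ}

theorem q_gt (E : Exponents d γ q s p) : 2 < q := by
  have := E.γ_dim
  have := E.γ_pos
  rw [E.q_eq, lt_div_iff₀ (by linarith)]; linarith

theorem q_lt_p (E : Exponents d γ q s p) : q < p := by
  have h1 := E.γ_dim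
  have h2 := E.s_dim
  have h3 := E.γ_s
  have h4 : (0 : ℝ) < d := by exact_mod_cast E.dim
  rw [E.q_eq, E.p_eq]
  exact div_lt_div_of_pos_left (by linarith) (by linarith) (by linarith)

theorem q_pos (E : Exponents d γ q s p) : 0 < q := by linarith [E.q_gt]

theorem p_pos (E : Exponents d γ q s p) : 0 < p := by linarith [E.q_pos, E.q_lt_p]

theorem one_le_q (E : Exponents d γ q s p) : 1 ≤ ENNReal.ofReal q := by
  rw [← ENNReal.ofReal_one]; exact ENNReal.ofReal_le_ofReal (by linarith [E.q_gt])

theorem one_le_p (E : Exponents d γ q s p) : 1 ≤ ENNReal.ofReal p := by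
  rw [← ENNReal.ofReal_one]; exact ENNReal.ofReal_le_ofReal (by linarith [E.q_gt, E.q_lt_p])

end Exponents

theorem eLpNorm_rpow_eq {p : ℝ} (hp : 0 < p) (u : Space d → ℂ) :
    eLpNorm u (ENNReal.ofReal p) volume ^ p = ∫⁻ x, ‖u x‖ₑ ^ p := by
  rw [eLpNorm_eq_lintegral_rpow_enorm_toReal (by simpa using hp) ENNReal.ofReal_ne_top,
    ENNReal.toReal_ofReal hp.le, ← ENNReal.rpow_mul, one_div_mul_cancel hp.ne', ENNReal.rpow_one]

theorem eLpNorm_interp {q p : ℝ} (hq : 0 < q) (hqp : q < p) {u : Space d → ℂ} {M : ℝ≥0∞}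
    (hM : M ≠ ∞) (hu : ∀ x, ‖u x‖ₑ ≤ M) :
    eLpNorm u (ENNReal.ofReal p) volume ^ p ≤
      M ^ (p - q) * eLpNorm u (ENNReal.ofReal q) volume ^ q := by
  rw [eLpNorm_rpow_eq (hq.trans hqp), eLpNorm_rpow_eq hq,
    ← lintegral_const_mul' _ _ (ENNReal.rpow_ne_top_of_nonneg (by linarith) hM)]
  refine lintegral_mono fun x => ?_
  calc ‖u x‖ₑ ^ p = ‖u x‖ₑ ^ (p - q) * ‖u x‖ₑ ^ q := by
        rw [← ENNReal.rpow_add_of_nonneg _ _ (by linarith) hq.le]; ring_nf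
    _ ≤ M ^ (p - q) * ‖u x‖ₑ ^ q := by
        gcongr
        exact hu x

/-- Low/high frequency splitting with `L^q` and `L^p` bounds for both parts. -/
theorem Exponents.exists_splitting {γ q s p : ℝ} (E : Exponents d γ q s p) :
    ∃ C : ℝ, 0 < C ∧ ∀ A : ℝ, 0 < A → ∃ Ψ : 𝓢(Space d, ℂ), ∀ f g : Space d → ℂ,
      MemLp f (ENNReal.ofReal q) volume → IsAbsGrad 2 f g →
        eLpNorm f (ENNReal.ofReal p) volume ≤ eLpNorm (corr Ψ f) (ENNReal.ofReal p) volume +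
          ENNReal.ofReal (C * A ^ (s - 2)) * eLpNorm g 2 volume ∧
        eLpNorm (corr Ψ f) (ENNReal.ofReal q) volume ≤ eLpNorm f (ENNReal.ofReal q) volume +
          ENNReal.ofReal (C * A ^ (γ - 2)) * eLpNorm g 2 volume := by
  obtain ⟨C1, hC1, hS1⟩ := exists_sobolev_const (d := d) E.dim E.γ_pos E.γ_dim E.q_eq
  obtain ⟨C2, hC2, hS2⟩ := exists_sobolev_const (d := d) E.dim E.s_pos E.s_dim E.p_eq
  refine ⟨3 * (C1 + C2), by positivity, fun A hA => ?_⟩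
  obtain ⟨Ψ, hΨ⟩ := exists_decomposition (d := d) hA
  refine ⟨Ψ, fun f g hf hg => ?_⟩
  obtain ⟨t, T, ht2, hT, hdec, hb⟩ := hΨ _ E.one_le_q f g hf hg
  have hcm := aestronglyMeasurable_corr Ψ hf.1
  have key : ∀ (σ C : ℝ), 0 < C → C ≤ C1 + C2 → 0 ≤ σ → σ ≤ 2 → ∀ r : ℝ,
      eLpNorm t (ENNReal.ofReal r) volume ≤
        ENNReal.ofReal C * eLpNorm (fun ξ => ((‖ξ‖ ^ σ : ℝ) : ℂ) * T ξ) 2 volume →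
      eLpNorm t (ENNReal.ofReal r) volume ≤
        ENNReal.ofReal (3 * (C1 + C2) * A ^ (σ - 2)) * eLpNorm g 2 volume := by
    intro σ C hC hCC h0 h2 r h
    calc _ ≤ _ := h
      _ ≤ ENNReal.ofReal C * (ENNReal.ofReal (3 * A ^ (σ - 2)) * eLpNorm g 2 volume) := by
          gcongr; exact hb σ h0 h2
      _ = ENNReal.ofReal (C * (3 * A ^ (σ - 2))) * eLpNorm g 2 volume := by
          rw [← mul_assoc, ← ENNReal.ofReal_mul hC.le]
      _ ≤ _ := by
          gcongr ?_ * _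
          refine ENNReal.ofReal_le_ofReal ?_
          have : 0 < A ^ (σ - 2) := by positivity
          nlinarith
  constructor
  · rw [eLpNorm_congr_ae hdec]
    refine (eLpNorm_add_le hcm ht2.1 E.one_le_p).trans ?_
    gcongr
    exact key s C2 hC2 (by linarith) E.s_pos.le E.s_lt.le p (hS2 t T hT)
  · have hc : corr Ψ f =ᵐ[volume] fun x => f x - t x := by
      filter_upwards [hdec] with x hx
      rw [hx]; ring
    rw [eLpNorm_congr_ae hc]
    refine (eLpNorm_sub_le hf.1 ht2.1 E.one_le_q).trans ?_
    gcongr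
    exact key γ C1 hC1 (by linarith) E.γ_pos.le E.γ_lt.le q (hS1 t T hT)

theorem enorm_corr_le {r : ℝ≥0∞} (hr : 1 ≤ r) (Ψ : 𝓢(Space d, ℂ)) {f : Space d → ℂ}
    (hf : MemLp f r volume) (x : Space d) :
    ‖corr Ψ f x‖ₑ ≤ ENNReal.ofReal (corrConst r Ψ) * eLpNorm f r volume :=
  (enorm_integral_le_lintegral_enorm _).trans (lintegral_corr_le hr Ψ hf x)

/-- Split at frequency one. The low part is bounded pointwise and in `L^q`, hence in `L^p` by
interpolation; the high part is controlled by the Sobolev inequality of order `s`. -/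
theorem Exponents.exists_additive_bound {γ q s p : ℝ} (E : Exponents d γ q s p) :
    ∃ C : ℝ, 0 < C ∧ ∀ f g : Space d → ℂ,
      MemLp f (ENNReal.ofReal q) volume → IsAbsGrad 2 f g →
        eLpNorm f (ENNReal.ofReal p) volume ≤
          ENNReal.ofReal C * (eLpNorm f (ENNReal.ofReal q) volume + eLpNorm g 2 volume) := by
  obtain ⟨C, hC, h⟩ := E.exists_splitting
  obtain ⟨Ψ, hΨ⟩ := h 1 one_pos
  set K := corrConst (ENNReal.ofReal q) Ψ with hK
  have hK0 : 0 ≤ K := corrConst_nonneg _ _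
  refine ⟨(K + 1 + C) + C, by positivity, fun f g hf hg => ?_⟩
  obtain ⟨h1, h2⟩ := hΨ f g hf hg
  simp only [Real.one_rpow, mul_one] at h1 h2
  set a := eLpNorm f (ENNReal.ofReal q) volume with ha
  set b := eLpNorm g 2 volume with hb
  have hab : a + b ≠ ∞ := ENNReal.add_ne_top.2 ⟨hf.2.ne, hg.1.2.ne⟩
  set D := ENNReal.ofReal (K + 1 + C) * (a + b) with hD
  have hp := E.p_pos
  have hq := E.q_pos
  have hsup : ∀ x, ‖corr Ψ f x‖ₑ ≤ D := fun x => by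
    refine (enorm_corr_le E.one_le_q Ψ hf x).trans ?_
    rw [hD]
    gcongr
    · linarith
    · exact le_self_add
  have hq' : eLpNorm (corr Ψ f) (ENNReal.ofReal q) volume ≤ D := by
    refine h2.trans ?_
    rw [hD, mul_add]
    gcongr
    · refine le_mul_of_one_le_left zero_le ?_
      rw [← ENNReal.ofReal_one]
      exact ENNReal.ofReal_le_ofReal (by linarith)
    · linarith
  have hlow : eLpNorm (corr Ψ f) (ENNReal.ofReal p) volume ≤ D := by
    rw [← ENNReal.rpow_le_rpow_iff hp]
    refine (eLpNorm_interp hq E.q_lt_p (M := D)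
      (ENNReal.mul_ne_top ENNReal.ofReal_ne_top hab) hsup).trans ?_
    calc D ^ (p - q) * eLpNorm (corr Ψ f) (ENNReal.ofReal q) volume ^ q
        ≤ D ^ (p - q) * D ^ q := by gcongr
      _ = D ^ p := by
        rw [← ENNReal.rpow_add_of_nonneg _ _ (by linarith [E.q_lt_p]) hq.le]; ring_nf
  calc eLpNorm f (ENNReal.ofReal p) volume ≤ D + ENNReal.ofReal C * b := by
        refine h1.trans ?_
        gcongr
    _ ≤ D + ENNReal.ofReal C * (a + b) := by gcongr; exact le_add_self
    _ = _ := by rw [hD, ← add_mul, ← ENNReal.ofReal_add (by positivity) hC.le]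

/-- A function with large `L^p` norm is detected by a fixed smoothing kernel. -/
theorem Exponents.exists_detect {γ q s p : ℝ} (E : Exponents d γ q s p) {M c : ℝ} (hM : 0 < M)
    (hc : 0 < c) :
    ∃ (Ψ : 𝓢(Space d, ℂ)) (δ : ℝ), 0 < δ ∧ ∀ f g : Space d → ℂ,
      MemLp f (ENNReal.ofReal q) volume → IsAbsGrad 2 f g →
        eLpNorm f (ENNReal.ofReal q) volume ≤ ENNReal.ofReal M →
        eLpNorm g 2 volume ≤ ENNReal.ofReal M →
        ENNReal.ofReal c ≤ eLpNorm f (ENNReal.ofReal p) volume →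
        ∃ x, δ ≤ ‖corr Ψ f x‖ := by
  obtain ⟨C, hC, h⟩ := E.exists_splitting
  have hs := E.s_lt
  have hp := E.p_pos
  have hq := E.q_pos
  have hqp := E.q_lt_p
  -- a frequency above which the high part is at most `c / 2`
  set A : ℝ := (c / (2 * C * M)) ^ (1 / (s - 2)) with hA
  have hA0 : 0 < A := by positivity
  have hAs : C * A ^ (s - 2) * M = c / 2 := by
    rw [hA, ← Real.rpow_mul (by positivity), one_div_mul_cancel (by linarith), Real.rpow_one]
    field_simp
  obtain ⟨Ψ, hΨ⟩ := h A hA0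
  set N : ℝ := M + C * A ^ (γ - 2) * M with hN
  have hN0 : 0 < N := by positivity
  -- With `N` bounding the low part in `L^q`, a supremum below `δ` would bound it by `c / 4` in
  -- `L^p`; together with `c / 2` from the high part this falls short of `c`.
  set δ : ℝ := ((c / 4) ^ p / N ^ q) ^ (1 / (p - q)) with hδ
  have hδ0 : 0 < δ := by positivity
  have hδp : δ ^ (p - q) * N ^ q = (c / 4) ^ p := by
    rw [hδ, ← Real.rpow_mul (by positivity), one_div_mul_cancel (by linarith), Real.rpow_one]
    field_simp
  refine ⟨Ψ, δ, hδ0, fun f g hf hg hfM hgM hfc => ?_⟩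
  by_contra! hlt
  obtain ⟨h1, h2⟩ := hΨ f g hf hg
  have hq' : eLpNorm (corr Ψ f) (ENNReal.ofReal q) volume ≤ ENNReal.ofReal N := by
    refine h2.trans ?_
    rw [hN, ENNReal.ofReal_add (by positivity) (by positivity),
      ENNReal.ofReal_mul (p := C * A ^ (γ - 2)) (by positivity)]
    gcongr
  have hlow : eLpNorm (corr Ψ f) (ENNReal.ofReal p) volume ≤ ENNReal.ofReal (c / 4) := by
    rw [← ENNReal.rpow_le_rpow_iff hp]
    refine (eLpNorm_interp hq hqp (M := ENNReal.ofReal δ) ENNReal.ofReal_ne_top fun x => ?_).trans ?_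
    · rw [← ofReal_norm]
      exact ENNReal.ofReal_le_ofReal (hlt x).le
    · calc ENNReal.ofReal δ ^ (p - q) * eLpNorm (corr Ψ f) (ENNReal.ofReal q) volume ^ q
          ≤ ENNReal.ofReal δ ^ (p - q) * ENNReal.ofReal N ^ q := by gcongr
        _ = ENNReal.ofReal (c / 4) ^ p := by
          rw [ENNReal.ofReal_rpow_of_pos hδ0, ENNReal.ofReal_rpow_of_pos hN0,
            ENNReal.ofReal_rpow_of_pos (by positivity), ← ENNReal.ofReal_mul (by positivity), hδp]
  have : ENNReal.ofReal c ≤ ENNReal.ofReal (c / 4 + c / 2) := by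
    refine hfc.trans (h1.trans ?_)
    rw [ENNReal.ofReal_add (by positivity) (by positivity), ← hAs,
      ENNReal.ofReal_mul (p := C * A ^ (s - 2)) (by positivity)]
    gcongr
  rw [ENNReal.ofReal_le_ofReal_iff (by positivity)] at this
  linarith

/-! ### The Laplacian -/

theorem absGrad_two (φ : 𝓢(Space d, ℂ)) (x : Space d) : absGrad 2 φ x = -(Δ φ) x := by
  rw [SchwartzMap.laplacian_eq_fourierMultiplierCLM, SchwartzMap.fourierMultiplierCLM_apply]
  have hm : (fun ξ : Space d => ‖ξ‖ ^ 2).HasTemperateGrowth :=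
    Function.hasTemperateGrowth_norm_sq _
  rw [neg_smul, neg_apply, smul_apply, neg_neg]
  have e : (fun ξ : Space d => (((2 * Real.pi * ‖ξ‖) ^ (2 : ℝ) : ℝ) : ℂ) * 𝓕 (φ : Space d → ℂ) ξ) =
      (((2 * Real.pi) ^ 2 • SchwartzMap.smulLeftCLM ℂ (fun ξ : Space d => ‖ξ‖ ^ 2) (𝓕 φ) :
        𝓢(Space d, ℂ)) : Space d → ℂ) := by
    ext ξ
    rw [smul_apply, SchwartzMap.smulLeftCLM_apply_apply hm]
    simp [mul_pow, SchwartzMap.fourier_coe, mul_assoc]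
  rw [absGrad, e, ← SchwartzMap.fourierInv_coe, FourierTransform.fourierInv_smul, smul_apply]

/-- The failure of `-Δf = g` as tempered distributions. -/
def laplaceDefect (f g : Space d → ℂ) (φ : 𝓢(Space d, ℂ)) : ℂ :=
  (∫ x, f x * absGrad 2 φ x) - ∫ x, g x * φ x

/-- The defect vanishes at high frequencies, so it is a difference of correlations with fixed
Schwartz kernels, that is, a bounded function. Hence only the `L¹` norm of `φ` enters. -/
theorem exists_laplaceDefect_le {r : ℝ≥0∞} (hr : 1 ≤ r) :
    ∃ C : ℝ, 0 < C ∧ ∀ f g : Space d → ℂ, MemLp f r volume → IsAbsGrad 2 f g →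
      ∀ φ : 𝓢(Space d, ℂ), ‖laplaceDefect f g φ‖ ≤
        C * ((eLpNorm f r volume).toReal + (eLpNorm g 2 volume).toReal) * ∫ x, ‖φ x‖ := by
  obtain ⟨m, hm, hm0, hmc, -⟩ := exists_highFreq_multiplier_scaled (d := d) one_pos
  obtain ⟨χ, hχ⟩ := exists_lowFreq hm hmc
  obtain ⟨χ₂, hχ₂⟩ := exists_schwartz_mul hasTemperateGrowth_absSymbol_two χ
  have hsym : ∀ ξ : Space d, (((2 * Real.pi * ‖ξ‖) ^ 2 : ℝ) : ℂ) = absSymbol 2 ξ := fun ξ =>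
    (absSymbol_two ξ).symm
  simp only [hsym] at hχ₂
  set K₁ := corrConst r (𝓕 χ₂) with hK₁
  set K₂ := corrConst 2 (𝓕 χ) with hK₂
  have hK₁0 : 0 ≤ K₁ := corrConst_nonneg _ _
  have hK₂0 : 0 ≤ K₂ := corrConst_nonneg _ _
  refine ⟨K₁ + K₂ + 1, by positivity, fun f g hf hg φ => ?_⟩
  set η : 𝓢(Space d, ℂ) := 𝓕⁻ φ with hη
  have hφ : 𝓕 η = φ := by rw [hη, fourier_fourierInv_eq]
  have hft : IsTempered f := isTempered_of_memLp hr hf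
  have hgt : IsTempered g := isTempered_of_memLp (by norm_num) hg.1
  obtain ⟨v, hv⟩ := exists_schwartz_mul hm η
  obtain ⟨w₀, hw₀⟩ := exists_schwartz_mul hasTemperateGrowth_absSymbol_two v
  obtain ⟨w, hw⟩ := exists_schwartz_mul hasTemperateGrowth_absSymbol_two w₀
  obtain ⟨e, he⟩ := exists_schwartz_mul hasTemperateGrowth_absSymbol_two η
  simp only [hsym] at hw₀ hw he
  -- the defect only sees low frequencies
  have hu : ∀ ξ, (η - w₀) ξ = χ ξ * η ξ := fun ξ => by rw [sub_apply, hw₀, hv, hχ]; ring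
  have hu₂ : ∀ ξ, (e - w) ξ = χ₂ ξ * η ξ := fun ξ => by
    rw [sub_apply, hw, hw₀, hv, hχ₂, hχ, he]; ring
  have h1 := hg.integral_highFreq hm0 (η := e) (v := w₀) (w := w)
    (fun ξ => by rw [hw₀, hv, he]; ring) (fun ξ => by rw [hw, hw₀, hv, he]; ring)
  have h2 := integral_mul_fourier_mul hr hf hu₂
  have h3 := integral_mul_fourier_mul (r := 2) (by norm_num) hg.1 hu
  have habs : absGrad 2 φ = 𝓕 (e : Space d → ℂ) := by
    rw [absGrad_eq_fourier, show (e : Space d → ℂ) = _ from funext he]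
  have split : ∀ (u : Space d → ℂ), IsTempered u → ∀ a b : 𝓢(Space d, ℂ),
      ∫ x, u x * 𝓕 (a : Space d → ℂ) x =
        (∫ x, u x * 𝓕 ((a - b : 𝓢(Space d, ℂ)) : Space d → ℂ) x) +
          ∫ x, u x * 𝓕 (b : Space d → ℂ) x := by
    intro u hu a b
    have i1 : Integrable (fun x => u x * 𝓕 ((a - b : 𝓢(Space d, ℂ)) : Space d → ℂ) x) volume :=
      hu.2 (𝓕 (a - b))
    have i2 : Integrable (fun x => u x * 𝓕 (b : Space d → ℂ) x) volume := hu.2 (𝓕 b)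
    rw [← integral_add i1 i2]
    refine integral_congr_ae (Filter.Eventually.of_forall fun x => ?_)
    have hlin : 𝓕 a = 𝓕 (a - b) + 𝓕 b := by rw [← FourierTransform.fourier_add, sub_add_cancel]
    simp only [← SchwartzMap.fourier_coe]
    rw [hlin, add_apply]
    ring
  have hφ' : (φ : Space d → ℂ) = 𝓕 (η : Space d → ℂ) := (fourier_fourierInv_schwartz φ).symm
  have hdef : laplaceDefect f g φ = (∫ x, corr (𝓕 χ₂) f x * φ x) - ∫ x, corr (𝓕 χ) g x * φ x := by
    rw [laplaceDefect, habs, split f hft e w, h1, h2]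
    have hgφ : ∫ x, g x * φ x = ∫ x, g x * 𝓕 (η : Space d → ℂ) x := by rw [← hφ']
    rw [hgφ, split g hgt η w₀, h3, hφ]
    ring
  have hbd : ∀ (r : ℝ≥0∞), 1 ≤ r → ∀ (Ψ : 𝓢(Space d, ℂ)) (u : Space d → ℂ), MemLp u r volume →
      ‖∫ x, corr Ψ u x * φ x‖ ≤ corrConst r Ψ * (eLpNorm u r volume).toReal * ∫ x, ‖φ x‖ := by
    intro r hr Ψ u hu
    rw [← integral_const_mul]
    refine norm_integral_le_of_norm_le (φ.integrable.norm.const_mul _)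
      (Filter.Eventually.of_forall fun x => ?_)
    rw [norm_mul]
    exact mul_le_mul_of_nonneg_right (norm_corr_le hr Ψ hu x) (norm_nonneg _)
  rw [hdef]
  have hI : 0 ≤ ∫ x, ‖φ x‖ := integral_nonneg fun x => norm_nonneg _
  have ha : 0 ≤ (eLpNorm f r volume).toReal := ENNReal.toReal_nonneg
  have hb : 0 ≤ (eLpNorm g 2 volume).toReal := ENNReal.toReal_nonneg
  calc _ ≤ K₁ * (eLpNorm f r volume).toReal * (∫ x, ‖φ x‖) +
        K₂ * (eLpNorm g 2 volume).toReal * ∫ x, ‖φ x‖ :=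
        (norm_sub_le _ _).trans (add_le_add (hbd r hr _ f hf) (hbd 2 (by norm_num) _ g hg.1))
    _ ≤ _ := by
        rw [← add_mul]
        refine mul_le_mul_of_nonneg_right ?_ hI
        nlinarith

/-- For `f ∈ L^q` the relation `-Δf = g` holds against all Schwartz functions. -/
theorem IsAbsGrad.laplaceDefect_eq_zero (hd : 1 ≤ d) {q : ℝ} (hq : 1 ≤ q) {f g : Space d → ℂ}
    (hf : MemLp f (ENNReal.ofReal q) volume) (hg : IsAbsGrad 2 f g) (φ : 𝓢(Space d, ℂ)) :
    laplaceDefect f g φ = 0 := by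
  have hq1 : 1 ≤ ENNReal.ofReal q := by rw [← ENNReal.ofReal_one]; exact ENNReal.ofReal_le_ofReal hq
  obtain ⟨C, hC, hb⟩ := exists_laplaceDefect_le (d := d) hq1
  set a := (eLpNorm f (ENNReal.ofReal q) volume).toReal
  set b := (eLpNorm g 2 volume).toReal
  set I := ∫ x, ‖φ x‖
  -- The bound is applied to dilates of `f`, `g` and `φ`. Relative to the factor `lam ^ (2 - d)` of
  -- the defect, both terms carry negative powers of `lam`, so letting `lam → ∞` kills it.
  have key : ∀ lam : ℝ, 0 < lam → ‖laplaceDefect f g φ‖ ≤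
      C * (lam ^ (-(2 + d / q) : ℝ) * a + lam ^ (-(d / 2) : ℝ) * b) * I := by
    intro lam hl
    obtain ⟨ψ, hψ⟩ := exists_schwartz_affine φ hl 0
    have hfl := memLp_affine hf hl 0
    have hgl := hg.affine 1 hl 0
    simp only [one_mul] at hgl
    have h := hb _ _ hfl hgl ψ
    have e1 : laplaceDefect (fun x => f (lam • x + 0))
        (fun x => ((lam ^ (2 : ℝ) : ℝ) : ℂ) * g (lam • x + 0)) ψ =
        ((lam ^ (2 - d : ℝ) : ℝ) : ℂ) * laplaceDefect f g φ := by
      have i1 := integral_affine (fun y => ((lam ^ (2 : ℝ) : ℝ) : ℂ) * (f y * absGrad 2 φ y)) hl 0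
      have i2 := integral_affine (fun y => ((lam ^ (2 : ℝ) : ℝ) : ℂ) * (g y * φ y)) hl 0
      have hexp : ((lam ^ (2 - d : ℝ) : ℝ) : ℂ) =
          (((lam ^ d)⁻¹ : ℝ) : ℂ) * ((lam ^ (2 : ℝ) : ℝ) : ℂ) := by
        rw [← Complex.ofReal_mul, Real.rpow_sub hl, Real.rpow_natCast]
        congr 1
        field_simp
      rw [laplaceDefect, laplaceDefect, hexp, mul_sub, mul_assoc, mul_assoc,
        ← integral_const_mul, ← integral_const_mul (μ := volume) _ (fun y => g y * φ y), ← i1, ← i2]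
      congr 1
      · refine integral_congr_ae (Filter.Eventually.of_forall fun x => ?_)
        simp only [absGrad_affine 2 hl hψ]; ring
      · refine integral_congr_ae (Filter.Eventually.of_forall fun x => ?_)
        simp only [hψ]; ring
    have e2 : (eLpNorm (fun x => f (lam • x + 0)) (ENNReal.ofReal q) volume).toReal =
        lam ^ (-(d : ℝ) / q) * a := by
      rw [eLpNorm_affine f hl 0 (by linarith), ENNReal.toReal_mul,
        ENNReal.toReal_ofReal (by positivity)]
    have e3 : (eLpNorm (fun x => ((lam ^ (2 : ℝ) : ℝ) : ℂ) * g (lam • x + 0)) 2 volume).toReal =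
        lam ^ (2 - d / 2 : ℝ) * b := by
      have := eLpNorm_affine_mul g ((lam ^ (2 : ℝ) : ℝ) : ℂ) hl 0 (p := 2) (by norm_num)
      rw [ENNReal.ofReal_ofNat] at this
      rw [this, ENNReal.toReal_mul, ENNReal.toReal_ofReal (by positivity), Complex.norm_real,
        Real.norm_of_nonneg (by positivity), ← Real.rpow_add hl]
      congr 2
      ring
    have e4 : ∫ x, ‖ψ x‖ = lam ^ (-(d : ℝ)) * I := by
      simp only [hψ, add_zero]
      rw [Measure.integral_comp_smul volume (fun y => ‖φ y‖) lam]
      simp [abs_of_pos hl, Real.rpow_neg hl.le, I]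
    rw [e1, e2, e3, e4, norm_mul, Complex.norm_real, Real.norm_of_nonneg (by positivity)] at h
    have hpos : 0 < lam ^ (2 - d : ℝ) := by positivity
    rw [← mul_le_mul_iff_right₀ hpos]
    refine h.trans (le_of_eq ?_)
    have x1 : lam ^ (2 - d : ℝ) * lam ^ (-(2 + d / q) : ℝ) =
        lam ^ (-(d : ℝ) / q) * lam ^ (-(d : ℝ)) := by
      rw [← Real.rpow_add hl, ← Real.rpow_add hl]; ring_nf
    have x2 : lam ^ (2 - d : ℝ) * lam ^ (-(d / 2) : ℝ) =
        lam ^ (2 - d / 2 : ℝ) * lam ^ (-(d : ℝ)) := by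
      rw [← Real.rpow_add hl, ← Real.rpow_add hl]; ring_nf
    linear_combination -C * a * I * x1 - C * b * I * x2
  have hlim : Filter.Tendsto (fun lam : ℝ =>
      C * (lam ^ (-(2 + d / q) : ℝ) * a + lam ^ (-(d / 2) : ℝ) * b) * I) Filter.atTop (nhds 0) := by
    have hd' : (0 : ℝ) < d := by exact_mod_cast hd
    have t1 := (tendsto_rpow_neg_atTop (y := 2 + d / q) (by positivity)).mul_const a
    have t2 := (tendsto_rpow_neg_atTop (y := d / 2) (by positivity)).mul_const b
    have := ((t1.add t2).const_mul C).mul_const I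
    simpa using this
  have : ‖laplaceDefect f g φ‖ ≤ 0 :=
    ge_of_tendsto hlim (by filter_upwards [Filter.eventually_gt_atTop 0] with lam hl using key lam hl)
  exact norm_le_zero_iff.1 this

/-! ### Weak and local compactness -/

/-- Weak convergence in `L²`, tested against the bilinear pairing. -/
def WeakLim (g : ℕ → Space d → ℂ) (G : Space d → ℂ) : Prop :=
  MemLp G 2 volume ∧ ∀ v : Space d → ℂ, MemLp v 2 volume →
    Filter.Tendsto (fun n => ∫ x, g n x * v x) Filter.atTop (nhds (∫ x, G x * v x))

theorem memLp_conj {v : Space d → ℂ} {p : ℝ≥0∞} (hv : MemLp v p volume) :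
    MemLp (fun x => (starRingEnd ℂ) (v x)) p volume :=
  hv.of_le (Complex.continuous_conj.comp_aestronglyMeasurable hv.1)
    (Filter.Eventually.of_forall fun x => by simp)

theorem inner_toLp_conj {g v : Space d → ℂ} (hg : MemLp g 2 volume) (hv : MemLp v 2 volume) :
    inner ℂ ((memLp_conj hv).toLp _) (hg.toLp g) = ∫ x, g x * v x := by
  rw [L2.inner_def]
  refine integral_congr_ae ?_
  filter_upwards [hg.coeFn_toLp, (memLp_conj hv).coeFn_toLp] with x h1 h2
  rw [h1, h2]
  simp

theorem WeakLim.comp {g : ℕ → Space d → ℂ} {G : Space d → ℂ} (h : WeakLim g G) {k : ℕ → ℕ}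
    (hk : StrictMono k) : WeakLim (fun n => g (k n)) G :=
  ⟨h.1, fun v hv => (h.2 v hv).comp hk.tendsto_atTop⟩

/-- Sequential Banach–Alaoglu through the Riesz isomorphism; the conjugations pass between the inner
product and the bilinear pairing. -/
theorem exists_weakLim {g : ℕ → Space d → ℂ} (hg : ∀ n, MemLp (g n) 2 volume) {M : ℝ} (hM0 : 0 ≤ M)
    (hM : ∀ n, eLpNorm (g n) 2 volume ≤ ENNReal.ofReal M) :
    ∃ k : ℕ → ℕ, StrictMono k ∧ ∃ G, WeakLim (fun n => g (k n)) G := by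
  have hb : ∀ n, StrongDual.toWeakDual
      (InnerProductSpace.toDual ℂ (Lp ℂ 2 (volume : Measure (Space d))) ((hg n).toLp (g n))) ∈
      WeakDual.toStrongDual ⁻¹' Metric.closedBall
        (0 : StrongDual ℂ (Lp ℂ 2 (volume : Measure (Space d)))) M := by
    intro n
    rw [Set.mem_preimage, mem_closedBall_zero_iff]
    have : ‖(hg n).toLp (g n)‖ ≤ M := by
      rw [Lp.norm_toLp]
      exact ENNReal.toReal_le_of_le_ofReal hM0 (hM n)
    refine le_trans (le_of_eq ?_) this
    exact (InnerProductSpace.toDual ℂ (Lp ℂ 2 (volume : Measure (Space d)))).norm_map _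
  have : Fact ((2 : ℝ≥0∞) ≠ ∞) := ⟨by norm_num⟩
  obtain ⟨ℓ, -, k, hk, hlim⟩ := WeakDual.isSeqCompact_closedBall ℂ _ _ _ hb
  obtain ⟨G, hG⟩ := (InnerProductSpace.toDual ℂ (Lp ℂ 2 (volume : Measure (Space d)))).surjective
    (WeakDual.toStrongDual ℓ)
  refine ⟨k, hk, G, Lp.memLp G, fun v hv => ?_⟩
  have h1 := ((WeakBilin.eval_continuous _ ((memLp_conj hv).toLp _)).tendsto ℓ).comp hlim
  have h2 := (Complex.continuous_conj.tendsto _).comp h1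
  have e1 : ∀ n, (starRingEnd ℂ) (inner ℂ ((hg n).toLp (g n)) ((memLp_conj hv).toLp _)) =
      ∫ x, g n x * v x := fun n => by rw [inner_conj_symm, inner_toLp_conj (hg n) hv]
  have e2 : (starRingEnd ℂ) (WeakDual.toStrongDual ℓ ((memLp_conj hv).toLp _)) =
      ∫ x, G x * v x := by
    rw [← hG, InnerProductSpace.toDual_apply_apply, inner_conj_symm]
    have := inner_toLp_conj (Lp.memLp G) hv
    rwa [Lp.toLp_coeFn] at this
  rw [← e2]
  refine h2.congr fun n => ?_
  exact e1 (k n)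

theorem WeakLim.of_tendsto {g : ℕ → Space d → ℂ} (hg : ∀ n, MemLp (g n) 2 volume)
    {G : Space d → ℂ} (hG : MemLp G 2 volume)
    (h : Filter.Tendsto (fun n => (hg n).toLp (g n)) Filter.atTop (nhds (hG.toLp G))) :
    WeakLim g G := by
  refine ⟨hG, fun v hv => ?_⟩
  have := (tendsto_const_nhds (x := (memLp_conj hv).toLp _)).inner (𝕜 := ℂ) h
  rw [inner_toLp_conj hG hv] at this
  exact this.congr fun n => inner_toLp_conj (hg n) hv

/-- A polynomial weight. -/
def weight (x : Space d) : ℝ := ((1 + ‖x‖) ^ (d + 1))⁻¹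

theorem weight_pos (x : Space d) : 0 < weight x := by unfold weight; positivity

theorem weight_le_one (x : Space d) : weight x ≤ 1 :=
  inv_le_one_of_one_le₀ (one_le_pow₀ (by linarith [norm_nonneg x]))

theorem continuous_weight : Continuous (weight : Space d → ℝ) := by
  unfold weight
  exact Continuous.inv₀ (by fun_prop) fun x => by positivity

theorem memLp_weight : MemLp (weight : Space d → ℝ) 2 volume := by
  rw [memLp_two_iff_integrable_sq continuous_weight.aestronglyMeasurable]
  have h : Integrable (fun x : Space d => (1 + ‖x‖) ^ (-(2 * (d + 1) : ℕ) : ℝ)) volume := by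
    refine integrable_one_add_norm ?_
    rw [finrank_euclideanSpace_fin]
    push_cast
    linarith
  refine h.congr (Filter.Eventually.of_forall fun x => ?_)
  simp only [weight]
  rw [Real.rpow_neg (by positivity), Real.rpow_natCast, inv_pow, ← pow_mul, mul_comm 2]

theorem memLp_inv_weight_mul (ψ : 𝓢(Space d, ℂ)) :
    MemLp (fun x => ((weight x)⁻¹ : ℝ) * ψ x) 2 volume := by
  have hdec := SchwartzMap.one_add_le_sup_seminorm_apply (𝕜 := ℝ) (m := (2 * (d + 1), 0))
    (k := 2 * (d + 1)) (n := 0) le_rfl le_rfl ψ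
  set c := 2 ^ (2 * (d + 1), 0).1 * (Finset.Iic (2 * (d + 1), 0)).sup
      (fun m => SchwartzMap.seminorm ℝ m.1 m.2) ψ
  refine MemLp.of_le_mul (c := c) (memLp_weight (d := d)) ?_
    (Filter.Eventually.of_forall fun x => ?_)
  · refine ((Complex.continuous_ofReal.comp ?_).mul ψ.continuous).aestronglyMeasurable
    exact continuous_weight.inv₀ fun x => (weight_pos x).ne'
  · have hw := weight_pos x
    rw [norm_mul, Complex.norm_real, Real.norm_of_nonneg (by positivity),
      Real.norm_of_nonneg hw.le, ← div_le_iff₀ hw]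
    refine le_trans (le_of_eq ?_) (hdec x)
    rw [norm_iteratedFDeriv_zero]
    simp only [weight, inv_inv]
    field_simp
    ring

/-- Embeds `L^q`, `q ≥ 2`, into a weighted `L²`: where `|f| ≤ 1` the weight dominates, and where
`|f| ≥ 1` one has `|f|² ≤ |f|^q`. -/
theorem eLpNorm_weight_mul_le {q : ℝ} (hq : 2 ≤ q) (f : Space d → ℂ) :
    eLpNorm (fun x => (weight x : ℂ) * f x) 2 volume ^ (2 : ℝ) ≤
      eLpNorm (weight : Space d → ℝ) 2 volume ^ (2 : ℝ) +
        eLpNorm f (ENNReal.ofReal q) volume ^ q := by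
  have h2 := eLpNorm_rpow_eq (p := 2) (by norm_num) (fun x => (weight x : ℂ) * f x)
  have h3 := eLpNorm_rpow_eq (p := 2) (by norm_num) (fun x : Space d => (weight x : ℂ))
  have h4 : eLpNorm (fun x : Space d => (weight x : ℂ)) 2 volume =
      eLpNorm (weight : Space d → ℝ) 2 volume :=
    eLpNorm_congr_norm_ae (Filter.Eventually.of_forall fun x => by simp)
  rw [ENNReal.ofReal_ofNat] at h2 h3
  rw [← h4, h2, h3, eLpNorm_rpow_eq (by linarith), ← lintegral_add_left']
  · refine lintegral_mono fun x => ?_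
    have hw : ‖(weight x : ℂ)‖ₑ ≤ 1 := by
      rw [← ofReal_norm, Complex.norm_real, Real.norm_of_nonneg (weight_pos x).le]
      simpa using weight_le_one x
    rw [enorm_mul, ENNReal.mul_rpow_of_nonneg _ _ (by norm_num)]
    rcases le_total ‖f x‖ₑ 1 with h | h
    · refine le_add_right ?_
      exact (mul_le_mul_right (ENNReal.rpow_le_one h (by norm_num)) _).trans (mul_one _).le
    · refine le_add_left ?_
      refine (mul_le_mul_left (ENNReal.rpow_le_one hw (by norm_num)) _).trans ?_
      rw [one_mul]
      exact ENNReal.rpow_le_rpow_of_exponent_le h hq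
  · exact ((Complex.continuous_ofReal.comp
      continuous_weight).measurable.enorm.pow_const _).aemeasurable

theorem memLp_weight_mul {q : ℝ} (hq : 2 ≤ q) {f : Space d → ℂ}
    (hf : MemLp f (ENNReal.ofReal q) volume) : MemLp (fun x => (weight x : ℂ) * f x) 2 volume := by
  refine ⟨(Complex.continuous_ofReal.comp continuous_weight).aestronglyMeasurable.mul hf.1, ?_⟩
  have h := eLpNorm_weight_mul_le hq f
  have h1 : eLpNorm (weight : Space d → ℝ) 2 volume ^ (2 : ℝ) +
        eLpNorm f (ENNReal.ofReal q) volume ^ q < ∞ :=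
    ENNReal.add_lt_top.2 ⟨ENNReal.rpow_lt_top_of_nonneg (by norm_num) memLp_weight.2.ne,
      ENNReal.rpow_lt_top_of_nonneg (by linarith) hf.2.ne⟩
  exact (ENNReal.rpow_lt_top_iff_of_pos (by norm_num)).1 (h.trans_lt h1)

theorem exists_bound_weight_mul {q : ℝ} (hq : 2 ≤ q) (M : ℝ) :
    ∃ M' : ℝ, 0 ≤ M' ∧ ∀ f : Space d → ℂ, eLpNorm f (ENNReal.ofReal q) volume ≤ ENNReal.ofReal M →
      eLpNorm (fun x => (weight x : ℂ) * f x) 2 volume ≤ ENNReal.ofReal M' := by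
  set B := eLpNorm (weight : Space d → ℝ) 2 volume ^ (2 : ℝ) + ENNReal.ofReal M ^ q with hB
  have hBt : B ≠ ∞ := ENNReal.add_ne_top.2
    ⟨(ENNReal.rpow_lt_top_of_nonneg (by norm_num) memLp_weight.2.ne).ne,
      (ENNReal.rpow_lt_top_of_nonneg (by linarith) ENNReal.ofReal_ne_top).ne⟩
  have hBt' : B ^ (1 / 2 : ℝ) ≠ ∞ := (ENNReal.rpow_lt_top_of_nonneg (by norm_num) hBt).ne
  refine ⟨(B ^ (1 / 2 : ℝ)).toReal, ENNReal.toReal_nonneg, fun f hf => ?_⟩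
  rw [ENNReal.ofReal_toReal hBt', one_div, ENNReal.le_rpow_inv_iff (by norm_num)]
  refine (eLpNorm_weight_mul_le hq f).trans ?_
  exact add_le_add le_rfl (ENNReal.rpow_le_rpow hf (by linarith))

theorem integral_eq_weight (f : Space d → ℂ) (ψ : Space d → ℂ) :
    ∫ x, f x * ψ x = ∫ x, ((weight x : ℂ) * f x) * (((weight x)⁻¹ : ℝ) * ψ x) := by
  refine integral_congr_ae (Filter.Eventually.of_forall fun x => ?_)
  have : (weight x : ℂ) ≠ 0 := Complex.ofReal_ne_zero.2 (weight_pos x).ne'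
  push_cast
  field_simp

theorem tendsto_eLpNorm_weight_mul {v : ℕ → Space d → ℂ} {V : Space d → ℂ} {K : ℝ}
    (hv : ∀ n, AEStronglyMeasurable (v n) volume) (hK : ∀ n x, ‖v n x‖ ≤ K)
    (hlim : ∀ x, Filter.Tendsto (fun n => v n x) Filter.atTop (nhds (V x))) :
    Filter.Tendsto (fun n => eLpNorm (fun x => (weight x : ℂ) * (v n x - V x)) 2 volume)
      Filter.atTop (nhds 0) := by
  have hV : AEStronglyMeasurable V volume :=
    aestronglyMeasurable_of_tendsto_ae _ hv (Filter.Eventually.of_forall hlim)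
  have hw : Continuous fun x : Space d => (weight x : ℂ) :=
    Complex.continuous_ofReal.comp continuous_weight
  have hVK : ∀ x, ‖V x‖ ≤ K := fun x =>
    le_of_tendsto (hlim x).norm (Filter.Eventually.of_forall fun n => hK n x)
  have key : Filter.Tendsto (fun n => ∫⁻ x, ‖(weight x : ℂ) * (v n x - V x)‖ₑ ^ (2 : ℝ))
      Filter.atTop (nhds (∫⁻ _ : Space d, 0)) := by
    refine tendsto_lintegral_of_dominated_convergence'
      (fun x => ‖((2 * K : ℝ) : ℂ) * (weight x : ℂ)‖ₑ ^ (2 : ℝ)) ?_ ?_ ?_ ?_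
    · exact fun n => (hw.aestronglyMeasurable.mul ((hv n).sub hV)).enorm.pow_const _
    · refine fun n => Filter.Eventually.of_forall fun x => ?_
      refine ENNReal.rpow_le_rpow ?_ (by norm_num)
      rw [enorm_le_iff_norm_le, norm_mul, norm_mul, mul_comm]
      refine mul_le_mul_of_nonneg_right ?_ (norm_nonneg _)
      refine (norm_sub_le _ _).trans ?_
      rw [Complex.norm_real]
      exact le_trans (by linarith [hK n x, hVK x]) (le_abs_self _)
    · have := eLpNorm_rpow_eq (p := 2) (by norm_num)
        (fun x : Space d => ((2 * K : ℝ) : ℂ) * (weight x : ℂ))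
      rw [← this]
      refine (ENNReal.rpow_lt_top_of_nonneg (by norm_num) ?_).ne
      rw [ENNReal.ofReal_ofNat]
      have h1 : MemLp (fun x : Space d => (weight x : ℂ)) 2 volume := memLp_weight.ofReal
      exact (h1.const_mul _).2.ne
    · refine Filter.Eventually.of_forall fun x => ?_
      have h1 := (((hlim x).sub_const (V x)).const_mul (weight x : ℂ)).enorm.ennrpow_const 2
      simpa using h1
  simp only [lintegral_zero] at key
  have h2 := key.ennrpow_const (1 / 2)
  have h3 : (0 : ℝ≥0∞) ^ (1 / 2 : ℝ) = 0 := ENNReal.zero_rpow_of_pos (by norm_num)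
  rw [h3] at h2
  refine h2.congr fun n => ?_
  have := eLpNorm_rpow_eq (p := 2) (by norm_num) (fun x => (weight x : ℂ) * (v n x - V x))
  rw [← this, ← ENNReal.rpow_mul, ENNReal.ofReal_ofNat]
  norm_num

open Filter in
/-- If `f n ∈ L^q` and `|∇|² (f n)` are bounded and the pairings of `f n` with Schwartz functions
converge, then `f n` is Cauchy in a weighted `L²` space. -/
theorem cauchySeq_weight_mul {q : ℝ} (hq : 2 ≤ q) {f g : ℕ → Space d → ℂ}
    (hf : ∀ n, MemLp (f n) (ENNReal.ofReal q) volume) (hg : ∀ n, IsAbsGrad 2 (f n) (g n)) {M : ℝ}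
    (hM : 0 < M)
    (hfM : ∀ n, eLpNorm (f n) (ENNReal.ofReal q) volume ≤ ENNReal.ofReal M)
    (hgM : ∀ n, eLpNorm (g n) 2 volume ≤ ENNReal.ofReal M)
    (hconv : ∀ ψ : 𝓢(Space d, ℂ), ∃ l : ℂ, Tendsto (fun n => ∫ x, f n x * ψ x) atTop (nhds l)) :
    CauchySeq (fun n => (memLp_weight_mul hq (hf n)).toLp _) := by
  have hq1 : 1 ≤ ENNReal.ofReal q := by
    rw [← ENNReal.ofReal_one]; exact ENNReal.ofReal_le_ofReal (by linarith)
  rw [EMetric.cauchySeq_iff]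
  intro ε hε
  obtain ⟨ε₁, hε₁, hε₁'⟩ : ∃ ε₁ : ℝ, 0 < ε₁ ∧ ENNReal.ofReal ε₁ ≤ ε := by
    rcases eq_or_ne ε ∞ with h | h
    · exact ⟨1, one_pos, by rw [h]; exact le_top⟩
    · exact ⟨ε.toReal, ENNReal.toReal_pos hε.ne' h, (ENNReal.ofReal_toReal h).le⟩
  -- Chosen so that all high parts have `L²` norm at most `ε₁ / 5`, uniformly in `n`.
  set A : ℝ := (15 * M / ε₁) ^ (1 / 2 : ℝ) with hA
  have hA0 : 0 < A := by positivity
  have hA2 : 3 * A ^ ((0 : ℝ) - 2) * M = ε₁ / 5 := by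
    rw [hA, ← Real.rpow_mul (by positivity)]
    norm_num
    rw [Real.rpow_neg_one]
    field_simp
    norm_num
  obtain ⟨Ψ, hΨ⟩ := exists_decomposition (d := d) hA0
  choose t T ht hT hdec hs using fun n => hΨ _ hq1 (f n) (g n) (hf n) (hg n)
  have ht' : ∀ n, eLpNorm (t n) 2 volume ≤ ENNReal.ofReal (ε₁ / 5) := by
    intro n
    have h := hs n 0 le_rfl (by norm_num)
    simp only [Real.rpow_zero, Complex.ofReal_one, one_mul] at h
    rw [← (eLpNorm_eq_of_isFourierPair (ht n) (hT n)).2, ← hA2, ENNReal.ofReal_mul (by positivity)]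
    exact h.trans (mul_le_mul_right (hgM n) _)
  -- The value of a low part at `x` is the pairing with a translate of the fixed kernel, so it
  -- converges; uniform boundedness then gives convergence in the weighted norm.
  have htr : ∀ x : Space d, ∃ l : ℂ, Tendsto (fun n => corr Ψ (f n) x) atTop (nhds l) := by
    intro x
    obtain ⟨ψ, hψ⟩ := exists_schwartz_affine Ψ one_pos (-x)
    obtain ⟨l, hl⟩ := hconv ψ
    refine ⟨l, hl.congr fun n => ?_⟩
    simp only [corr, hψ, one_smul, sub_eq_add_neg]
  choose V hV using htr
  have hvK : ∀ n x, ‖corr Ψ (f n) x‖ ≤ corrConst (ENNReal.ofReal q) Ψ * M := by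
    intro n x
    refine (norm_corr_le hq1 Ψ (hf n) x).trans ?_
    exact mul_le_mul_of_nonneg_left (ENNReal.toReal_le_of_le_ofReal hM.le (hfM n))
      (corrConst_nonneg _ _)
  have hvm := fun n => aestronglyMeasurable_corr Ψ (hf n).1
  have hVm : AEStronglyMeasurable V volume :=
    aestronglyMeasurable_of_tendsto_ae _ hvm (Eventually.of_forall hV)
  have hwm : AEStronglyMeasurable (fun x : Space d => (weight x : ℂ)) volume :=
    (Complex.continuous_ofReal.comp continuous_weight).aestronglyMeasurable
  have hlim := tendsto_eLpNorm_weight_mul hvm hvK hV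
  obtain ⟨N, hN⟩ := eventually_atTop.1
    (hlim.eventually_le_const (v := 0) (u := ENNReal.ofReal (ε₁ / 5))
      (by rw [ENNReal.ofReal_pos]; positivity))
  have hpart : ∀ n ≥ N, eLpNorm (fun x => (weight x : ℂ) * (f n x - V x)) 2 volume ≤
      ENNReal.ofReal (2 * ε₁ / 5) := by
    intro n hn
    have e : (fun x => (weight x : ℂ) * (f n x - V x)) =ᵐ[volume]
        (fun x => (weight x : ℂ) * (corr Ψ (f n) x - V x)) + fun x => (weight x : ℂ) * t n x := by
      filter_upwards [hdec n] with x hx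
      rw [Pi.add_apply, hx]; ring
    rw [eLpNorm_congr_ae e]
    refine (eLpNorm_add_le (hwm.mul ((hvm n).sub hVm)) (hwm.mul (ht n).1) (by norm_num)).trans ?_
    have e2 : ENNReal.ofReal (2 * ε₁ / 5) = ENNReal.ofReal (ε₁ / 5) + ENNReal.ofReal (ε₁ / 5) := by
      rw [← ENNReal.ofReal_add (by positivity) (by positivity)]; ring_nf
    rw [e2]
    refine add_le_add (hN n hn) ((eLpNorm_mono fun x => ?_).trans (ht' n))
    rw [Pi.mul_apply, norm_mul, Complex.norm_real, Real.norm_of_nonneg (weight_pos x).le]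
    exact mul_le_of_le_one_left (norm_nonneg _) (weight_le_one x)
  refine ⟨N, fun m hm n hn => ?_⟩
  rw [Lp.edist_toLp_toLp]
  have e : (fun x => (weight x : ℂ) * f m x) - (fun x => (weight x : ℂ) * f n x) =
      (fun x => (weight x : ℂ) * (f m x - V x)) - fun x => (weight x : ℂ) * (f n x - V x) := by
    ext x; simp only [Pi.sub_apply]; ring
  rw [e]
  refine (eLpNorm_sub_le (hwm.mul ((hf m).1.sub hVm)) (hwm.mul ((hf n).1.sub hVm))
    (by norm_num)).trans_lt ?_
  refine (add_le_add (hpart m hm) (hpart n hn)).trans_lt (lt_of_lt_of_le ?_ hε₁')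
  rw [← ENNReal.ofReal_add (by positivity) (by positivity)]
  exact (ENNReal.ofReal_lt_ofReal_iff hε₁).2 (by linarith)

open Filter in
/-- Local compactness for sequences bounded in `L^q ∩ Ḣ²`. -/
theorem exists_local_limit {q : ℝ} (hq : 2 ≤ q) {f g : ℕ → Space d → ℂ}
    (hf : ∀ n, MemLp (f n) (ENNReal.ofReal q) volume) (hg : ∀ n, IsAbsGrad 2 (f n) (g n)) {M : ℝ}
    (hM : 0 < M)
    (hfM : ∀ n, eLpNorm (f n) (ENNReal.ofReal q) volume ≤ ENNReal.ofReal M)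
    (hgM : ∀ n, eLpNorm (g n) 2 volume ≤ ENNReal.ofReal M) :
    ∃ k : ℕ → ℕ, StrictMono k ∧ ∃ F G : Space d → ℂ, MemLp F (ENNReal.ofReal q) volume ∧
      IsAbsGrad 2 F G ∧ WeakLim (fun n => g (k n)) G ∧
      (∀ᵐ x, Tendsto (fun n => f (k n) x) atTop (nhds (F x))) ∧
      ∀ ψ : 𝓢(Space d, ℂ),
        Tendsto (fun n => ∫ x, f (k n) x * ψ x) atTop (nhds (∫ x, F x * ψ x)) := by
  have hq1 : 1 ≤ ENNReal.ofReal q := by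
    rw [← ENNReal.ofReal_one]; exact ENNReal.ofReal_le_ofReal (by linarith)
  have hwc : Continuous (fun x : Space d => (weight x : ℂ)) :=
    Complex.continuous_ofReal.comp continuous_weight
  have hw0 : ∀ x : Space d, (weight x : ℂ) ≠ 0 := fun x =>
    Complex.ofReal_ne_zero.2 (weight_pos x).ne'
  obtain ⟨M', hM', hb⟩ := exists_bound_weight_mul (d := d) hq M
  -- Weak convergence in the weighted `L²` space already makes all pairings with Schwartz functions
  -- converge, since these functions absorb the inverse weight.
  obtain ⟨k₁, hk₁, u, hu⟩ := exists_weakLim (fun n => memLp_weight_mul hq (hf n)) hM'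
    fun n => hb _ (hfM n)
  obtain ⟨k₂, hk₂, G, hG⟩ := exists_weakLim (fun n => (hg (k₁ n)).1) hM.le fun n => hgM (k₁ n)
  set k₃ : ℕ → ℕ := fun n => k₁ (k₂ n) with hk₃
  have hconv : ∀ ψ : 𝓢(Space d, ℂ), ∃ l : ℂ,
      Tendsto (fun n => ∫ x, f (k₃ n) x * ψ x) atTop (nhds l) := fun ψ =>
    ⟨_, ((hu.comp hk₂).2 _ (memLp_inv_weight_mul ψ)).congr fun n => (integral_eq_weight _ _).symm⟩
  -- Bounded Laplacians upgrade this to strong convergence in the weighted space, and a further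
  -- subsequence converges a.e.
  obtain ⟨W, hW⟩ := cauchySeq_tendsto_of_complete (cauchySeq_weight_mul hq (fun n => hf (k₃ n))
    (fun n => hg (k₃ n)) hM (fun n => hfM (k₃ n)) (fun n => hgM (k₃ n)) hconv)
  have hW' := hW
  rw [← Lp.toLp_coeFn W (Lp.memLp W)] at hW
  have hwk := WeakLim.of_tendsto (fun n => memLp_weight_mul hq (hf (k₃ n))) (Lp.memLp W) hW
  rw [Lp.tendsto_Lp_iff_tendsto_eLpNorm''] at hW
  obtain ⟨k₄, hk₄, hae⟩ := (tendstoInMeasure_of_tendsto_eLpNorm_of_ne_top (p := 2) (by norm_num)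
    (by norm_num) (fun n => (memLp_weight_mul hq (hf (k₃ n))).1) (Lp.memLp W).1
    hW).exists_seq_tendsto_ae
  set F : Space d → ℂ := fun x => (weight x : ℂ)⁻¹ * W x with hF
  have hFae : ∀ᵐ x, Tendsto (fun n => f (k₃ (k₄ n)) x) atTop (nhds (F x)) := by
    filter_upwards [hae] with x hx
    refine (hx.const_mul (weight x : ℂ)⁻¹).congr fun n => ?_
    rw [inv_mul_cancel_left₀ (hw0 x)]
  have hFψ : ∀ ψ : 𝓢(Space d, ℂ),
      Tendsto (fun n => ∫ x, f (k₃ (k₄ n)) x * ψ x) atTop (nhds (∫ x, F x * ψ x)) := by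
    intro ψ
    have h := (hwk.comp hk₄).2 _ (memLp_inv_weight_mul ψ)
    have e : ∫ x, F x * ψ x = ∫ x, W x * (((weight x)⁻¹ : ℝ) * ψ x) := by
      refine integral_congr_ae (Eventually.of_forall fun x => ?_)
      simp only [hF]; push_cast; ring
    rw [e]
    exact h.congr fun n => (integral_eq_weight _ _).symm
  have hFm : MemLp F (ENNReal.ofReal q) volume := by
    refine ⟨(hwc.inv₀ hw0).aestronglyMeasurable.mul (Lp.memLp W).1, ?_⟩
    refine (Lp.eLpNorm_lim_le_liminf_eLpNorm (fun n => (hf (k₃ (k₄ n))).1) F hFae).trans_lt ?_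
    refine lt_of_le_of_lt ?_ (ENNReal.ofReal_lt_top (r := M))
    refine liminf_le_of_le (by isBoundedDefault) fun b hb => ?_
    obtain ⟨n, hn⟩ := hb.exists
    exact hn.trans (hfM _)
  refine ⟨fun n => k₃ (k₄ n), (hk₁.comp hk₂).comp hk₄, F, G, hFm, ⟨hG.1, fun φ hφ => ?_⟩,
    hG.comp hk₄, hFae, hFψ⟩
  obtain ⟨v, -, hv⟩ := exists_absGrad_eq 2 hφ
  rw [hv]
  have h1 := hFψ (𝓕 v)
  have h2 := (hG.comp hk₄).2 φ (φ.memLp 2 volume)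
  refine tendsto_nhds_unique h1 (h2.congr fun n => ?_)
  have := (hg (k₃ (k₄ n))).2 φ hφ
  rw [hv] at this
  exact this.symm

/-- Nonvanishing limits up to translation. -/
theorem Exponents.exists_translated_limit {γ q s p : ℝ} (E : Exponents d γ q s p) {M c : ℝ}
    (hM : 0 < M) (hc : 0 < c) {f g : ℕ → Space d → ℂ}
    (hf : ∀ n, MemLp (f n) (ENNReal.ofReal q) volume) (hg : ∀ n, IsAbsGrad 2 (f n) (g n))
    (hfM : ∀ n, eLpNorm (f n) (ENNReal.ofReal q) volume ≤ ENNReal.ofReal M)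
    (hgM : ∀ n, eLpNorm (g n) 2 volume ≤ ENNReal.ofReal M)
    (hfc : ∀ n, ENNReal.ofReal c ≤ eLpNorm (f n) (ENNReal.ofReal p) volume) :
    ∃ (k : ℕ → ℕ) (a : ℕ → Space d), StrictMono k ∧ ∃ F G : Space d → ℂ,
      MemLp F (ENNReal.ofReal q) volume ∧
      IsAbsGrad 2 F G ∧ WeakLim (fun n x => g (k n) (x + a n)) G ∧
      (∀ᵐ x, Filter.Tendsto (fun n => f (k n) (x + a n)) Filter.atTop (nhds (F x))) ∧
      (∀ ψ : 𝓢(Space d, ℂ), Filter.Tendsto (fun n => ∫ x, f (k n) (x + a n) * ψ x) Filter.atTop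
        (nhds (∫ x, F x * ψ x))) ∧ ¬ F =ᵐ[volume] 0 := by
  obtain ⟨Ψ, δ, hδ, hdet⟩ := E.exists_detect hM hc
  choose a ha using fun n => hdet (f n) (g n) (hf n) (hg n) (hfM n) (hgM n) (hfc n)
  have hnorm : ∀ {r : ℝ} (u : Space d → ℂ) (b : Space d), 0 < r →
      eLpNorm (fun x => u (x + b)) (ENNReal.ofReal r) volume =
        eLpNorm u (ENNReal.ofReal r) volume := fun u b hr => by
    simpa using eLpNorm_affine u one_pos b hr
  obtain ⟨k, hk, F, G, hF, hG, hw, hae, hψ⟩ := exists_local_limit (q := q) E.q_gt.le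
    (f := fun n x => f n (x + a n)) (g := fun n x => g n (x + a n)) (M := M)
    (fun n => by simpa using memLp_affine (hf n) one_pos (a n))
    (fun n => by simpa using (hg n).affine 1 one_pos (a n)) hM
    (fun n => by rw [hnorm _ _ E.q_pos]; exact hfM n)
    (fun n => by
      have := hnorm (r := 2) (g n) (a n) (by norm_num)
      rw [ENNReal.ofReal_ofNat] at this
      rw [this]; exact hgM n)
  refine ⟨k, fun n => a (k n), hk, F, G, hF, hG, hw, hae, hψ, fun h0 => ?_⟩
  have h1 := (hψ Ψ).norm
  have h2 : ∫ x, F x * Ψ x = 0 := by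
    rw [← integral_zero (Space d) ℂ]
    refine integral_congr_ae ?_
    filter_upwards [h0] with x hx
    rw [hx]; simp
  rw [h2, norm_zero] at h1
  -- After translation the detected value of the correlation is a pairing with the fixed `Ψ`, so its
  -- lower bound survives in the limit.
  have h3 : ∀ n, δ ≤ ‖∫ x, f (k n) (x + a (k n)) * Ψ x‖ := fun n => by
    refine (ha (k n)).trans (le_of_eq ?_)
    rw [corr, ← integral_add_right_eq_self _ (a (k n))]
    simp
  exact absurd (ge_of_tendsto' h1 h3) (not_le.2 hδ)

/-! ### The Brezis–Lieb lemma -/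

/-- If `|a|` is small relative to `|b|`, continuity of `t ^ p` at one gives the `ε` term; otherwise
`|b|` is bounded by a multiple of `|a|`. -/
theorem exists_abs_rpow_norm_add_sub_le {p : ℝ} (hp : 0 < p) {ε : ℝ} (hε : 0 < ε) :
    ∃ C : ℝ, 0 ≤ C ∧ ∀ a b : ℂ, |‖a + b‖ ^ p - ‖b‖ ^ p| ≤ ε * ‖b‖ ^ p + C * ‖a‖ ^ p := by
  have hcont : ContinuousAt (fun t : ℝ => t ^ p) 1 :=
    Real.continuousAt_rpow_const _ _ (Or.inl one_ne_zero)
  obtain ⟨η, hη, hη'⟩ := Metric.continuousAt_iff.1 hcont ε hε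
  set δ := min (η / 2) (1 / 2) with hδ
  have hδ0 : 0 < δ := by positivity
  have hδη : δ < η := (min_le_left _ _).trans_lt (by linarith)
  have hδ1 : δ ≤ 1 / 2 := min_le_right _ _
  have hclose : ∀ t : ℝ, |t - 1| ≤ δ → |t ^ p - 1| ≤ ε := fun t ht => by
    have := hη' (x := t) (by rw [Real.dist_eq]; linarith)
    rw [Real.dist_eq, Real.one_rpow] at this
    exact this.le
  refine ⟨(1 + 1 / δ) ^ p + (1 / δ) ^ p, by positivity, fun a b => ?_⟩
  have hna := norm_nonneg a
  have hnb := norm_nonneg b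
  by_cases h : ‖a‖ ≤ δ * ‖b‖
  · refine le_add_of_le_of_nonneg ?_ (by positivity)
    rcases hnb.eq_or_lt with hb | hb
    · rw [← hb, mul_zero] at h
      have ha : a = 0 := norm_le_zero_iff.1 h
      simp [ha]
      positivity
    · have ht := hclose (‖a + b‖ / ‖b‖) (by
        rw [div_sub_one hb.ne', abs_div, abs_of_pos hb, div_le_iff₀ hb]
        refine (abs_norm_sub_norm_le _ _).trans ?_
        rwa [add_sub_cancel_right])
      rw [Real.div_rpow (norm_nonneg _) hnb, div_sub_one (by positivity), abs_div,
        abs_of_pos (by positivity : 0 < ‖b‖ ^ p), div_le_iff₀ (by positivity)] at ht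
      exact ht
  · refine le_add_of_nonneg_of_le (by positivity) ?_
    have hb : ‖b‖ ≤ 1 / δ * ‖a‖ := by
      rw [not_le] at h
      rw [one_div, inv_mul_eq_div, le_div_iff₀ hδ0]; linarith
    have h1 : ‖b‖ ^ p ≤ (1 / δ) ^ p * ‖a‖ ^ p := by
      rw [← Real.mul_rpow (by positivity) hna]
      exact Real.rpow_le_rpow hnb hb hp.le
    have h2 : ‖a + b‖ ^ p ≤ (1 + 1 / δ) ^ p * ‖a‖ ^ p := by
      rw [← Real.mul_rpow (by positivity) hna]
      refine Real.rpow_le_rpow (norm_nonneg _) ((norm_add_le _ _).trans ?_) hp.le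
      linarith
    have h3 : 0 ≤ ‖b‖ ^ p := by positivity
    have h4 : 0 ≤ ‖a + b‖ ^ p := by positivity
    rw [abs_le, add_mul]
    constructor <;> nlinarith

theorem integrable_norm_rpow {p : ℝ} (hp : 0 < p) {u : Space d → ℂ}
    (hu : MemLp u (ENNReal.ofReal p) volume) : Integrable (fun x => ‖u x‖ ^ p) volume := by
  have := hu.integrable_norm_rpow (by simpa using hp) ENNReal.ofReal_ne_top
  rwa [ENNReal.toReal_ofReal hp.le] at this

theorem toReal_eLpNorm_rpow {p : ℝ} (hp : 0 < p) {u : Space d → ℂ}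
    (hu : MemLp u (ENNReal.ofReal p) volume) :
    (eLpNorm u (ENNReal.ofReal p) volume).toReal ^ p = ∫ x, ‖u x‖ ^ p := by
  rw [ENNReal.toReal_rpow, eLpNorm_rpow_eq hp,
    integral_eq_lintegral_of_nonneg_ae (Filter.Eventually.of_forall fun x => by positivity)
      (integrable_norm_rpow hp hu).1]
  congr 1
  refine lintegral_congr fun x => ?_
  rw [← ofReal_norm, ENNReal.ofReal_rpow_of_nonneg (norm_nonneg _) hp.le]

open Filter in
-- After subtracting `ε ‖u n - U‖^p`, the defect is dominated by a multiple of `‖U‖^p`, so dominated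
-- convergence applies; what was subtracted has integral at most `ε B`.
theorem tendsto_integral_norm_rpow_sub {p : ℝ} (hp : 1 ≤ p) {u : ℕ → Space d → ℂ} {U : Space d → ℂ}
    (hu : ∀ n, MemLp (u n) (ENNReal.ofReal p) volume) (hU : MemLp U (ENNReal.ofReal p) volume)
    {M : ℝ} (hM : ∀ n, eLpNorm (u n) (ENNReal.ofReal p) volume ≤ ENNReal.ofReal M)
    (hlim : ∀ᵐ x, Tendsto (fun n => u n x) atTop (nhds (U x))) :
    Tendsto (fun n => (∫ x, ‖u n x‖ ^ p) - ∫ x, ‖u n x - U x‖ ^ p) atTop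
      (nhds (∫ x, ‖U x‖ ^ p)) := by
  have hp0 : 0 < p := by linarith
  have hp1 : 1 ≤ ENNReal.ofReal p := by
    rw [← ENNReal.ofReal_one]; exact ENNReal.ofReal_le_ofReal hp
  have hsub : ∀ n, MemLp (fun x => u n x - U x) (ENNReal.ofReal p) volume := fun n =>
    (hu n).sub hU
  have iu := fun n => integrable_norm_rpow hp0 (hu n)
  have iU := integrable_norm_rpow hp0 hU
  have is := fun n => integrable_norm_rpow hp0 (hsub n)
  obtain ⟨B, hB, hsB⟩ : ∃ B : ℝ, 0 < B ∧ ∀ n, ∫ x, ‖u n x - U x‖ ^ p ≤ B := by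
    set N := ENNReal.ofReal M + eLpNorm U (ENNReal.ofReal p) volume with hN
    have hNt : N ≠ ∞ := ENNReal.add_ne_top.2 ⟨ENNReal.ofReal_ne_top, hU.2.ne⟩
    refine ⟨N.toReal ^ p + 1, by positivity, fun n => ?_⟩
    rw [← toReal_eLpNorm_rpow hp0 (hsub n)]
    refine le_add_of_le_of_nonneg (Real.rpow_le_rpow ENNReal.toReal_nonneg ?_ hp0.le) zero_le_one
    refine ENNReal.toReal_mono hNt ?_
    exact (eLpNorm_sub_le (hu n).1 hU.1 hp1).trans (add_le_add (hM n) le_rfl)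
  set D : ℕ → Space d → ℝ := fun n x => ‖u n x‖ ^ p - ‖u n x - U x‖ ^ p - ‖U x‖ ^ p with hD
  have iD : ∀ n, Integrable (D n) volume := fun n => ((iu n).sub (is n)).sub iU
  have hDint : ∀ n, ∫ x, D n x =
      (∫ x, ‖u n x‖ ^ p) - (∫ x, ‖u n x - U x‖ ^ p) - ∫ x, ‖U x‖ ^ p := fun n => by
    have i : Integrable (fun x => ‖u n x‖ ^ p - ‖u n x - U x‖ ^ p) volume := (iu n).sub (is n)
    simp only [hD]
    rw [integral_sub i iU, integral_sub (iu n) (is n)]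
  have hDlim : Tendsto (fun n => ∫ x, D n x) atTop (nhds 0) := by
    rw [Metric.tendsto_atTop]
    intro e he
    set ε := e / (2 * B) with hε
    have hε0 : 0 < ε := by positivity
    obtain ⟨C, hC, hCb⟩ := exists_abs_rpow_norm_add_sub_le hp0 hε0
    set W : ℕ → Space d → ℝ := fun n x => max (|D n x| - ε * ‖u n x - U x‖ ^ p) 0 with hW
    have iW : ∀ n, Integrable (W n) volume := fun n =>
      ((iD n).abs.sub ((is n).const_mul ε)).pos_part
    have hWlim : Tendsto (fun n => ∫ x, W n x) atTop (nhds (∫ _ : Space d, (0 : ℝ))) := by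
      refine tendsto_integral_of_dominated_convergence (fun x => (C + 1) * ‖U x‖ ^ p)
        (fun n => (iW n).1) (iU.const_mul _) (fun n => Eventually.of_forall fun x => ?_) ?_
      · have h := hCb (U x) (u n x - U x)
        rw [add_sub_cancel] at h
        have h1 : 0 ≤ ‖U x‖ ^ p := by positivity
        rw [Real.norm_of_nonneg (le_max_right _ _)]
        refine max_le ?_ (by positivity)
        have h2 : |D n x| ≤ |‖u n x‖ ^ p - ‖u n x - U x‖ ^ p| + ‖U x‖ ^ p := by
          refine (abs_sub _ _).trans ?_
          rw [abs_of_nonneg h1]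
        linarith
      · filter_upwards [hlim] with x hx
        have h1 : Tendsto (fun n => ‖u n x‖ ^ p) atTop (nhds (‖U x‖ ^ p)) :=
          hx.norm.rpow_const (Or.inr hp0.le)
        have h2 : Tendsto (fun n => ‖u n x - U x‖ ^ p) atTop (nhds 0) := by
          have := (hx.sub_const (U x)).norm.rpow_const (p := p) (Or.inr hp0.le)
          rwa [sub_self, norm_zero, Real.zero_rpow hp0.ne'] at this
        have h3 := ((((h1.sub h2).sub_const (‖U x‖ ^ p)).abs).sub (h2.const_mul ε)).max
          (tendsto_const_nhds (x := (0 : ℝ)))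
        simpa using h3
    rw [integral_zero] at hWlim
    obtain ⟨N, hN⟩ := eventually_atTop.1 (hWlim.eventually_lt_const (u := e / 2) (by positivity))
    refine ⟨N, fun n hn => ?_⟩
    rw [Real.dist_eq, sub_zero]
    calc |∫ x, D n x| ≤ ∫ x, |D n x| := abs_integral_le_integral_abs
      _ ≤ ∫ x, (W n x + ε * ‖u n x - U x‖ ^ p) := by
          refine integral_mono (iD n).abs ((iW n).add ((is n).const_mul ε)) fun x => ?_
          have := le_max_left (|D n x| - ε * ‖u n x - U x‖ ^ p) 0
          simp only [hW]
          linarith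
      _ = (∫ x, W n x) + ε * ∫ x, ‖u n x - U x‖ ^ p := by
          rw [integral_add (iW n) ((is n).const_mul ε), integral_const_mul]
      _ < e / 2 + ε * B := add_lt_add_of_lt_of_le (hN n hn)
          (mul_le_mul_of_nonneg_left (hsB n) hε0.le)
      _ = e := by rw [hε]; field_simp; norm_num
  have := hDlim.add_const (∫ x, ‖U x‖ ^ p)
  rw [zero_add] at this
  refine this.congr fun n => ?_
  rw [hDint]; ring

/-! ### Scaling -/

/-- The data needed to treat both sharp constants at once: a function space `𝒳`, its norm
`N f = ‖u‖_{L^m}` where `R f u`, i.e. `u` is the image of `f` under an operator extending `T`. -/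
structure GNSetting (α γ q s m : ℝ) (𝒳 : Set (Space d → ℂ)) (N : (Space d → ℂ) → ℝ≥0∞)
    (R : (Space d → ℂ) → (Space d → ℂ) → Prop) (T : 𝓢(Space d, ℂ) → Space d → ℂ) : Prop where
  exps : Exponents d γ q s (α + 2)
  α_pos : 0 < α
  γ_eq : γ = d / 2 - 4 / α
  two_le : 2 ≤ m
  exists_rel : ∀ f ∈ 𝒳, ∃ u, R f u
  rel : ∀ f ∈ 𝒳, ∀ u, R f u →
    MemLp u (ENNReal.ofReal m) volume ∧ N f = eLpNorm u (ENNReal.ofReal m) volume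
  memLp : ∀ f ∈ 𝒳, MemLp f (ENNReal.ofReal q) volume
  bound : ∃ C : ℝ, 0 < C ∧ ∀ f ∈ 𝒳, eLpNorm f (ENNReal.ofReal q) volume ≤ ENNReal.ofReal C * N f
  grad : ∀ f ∈ 𝒳, ∃ g, IsAbsGrad 2 f g
  add_mul : ∀ f ∈ 𝒳, ∀ f' ∈ 𝒳, ∀ u u', R f u → R f' u' → ∀ c : ℂ,
    (fun x => f x + c * f' x) ∈ 𝒳 ∧ R (fun x => f x + c * f' x) (fun x => u x + c * u' x)
  affine : ∀ f ∈ 𝒳, ∀ (a : ℂ) (lam : ℝ) (x₀ : Space d), 0 < lam →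
    (fun x => a * f (lam • x + x₀)) ∈ 𝒳 ∧
      N (fun x => a * f (lam • x + x₀)) = ENNReal.ofReal (‖a‖ * lam ^ (-(4 / α))) * N f
  schwartz : ∀ φ : 𝓢(Space d, ℂ), (φ : Space d → ℂ) ∈ 𝒳 ∧ R φ (T φ)
  T_smul : ∀ φ : 𝓢(Space d, ℂ), ∀ x, T (Complex.I • φ) x = Complex.I * T φ x
  T_conj : ∀ φ ψ : 𝓢(Space d, ℂ), (∀ x, ψ x = (starRingEnd ℂ) (φ x)) →
    ∀ x, T ψ x = (starRingEnd ℂ) (T φ x)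
  -- The only compactness needed of `N`: the local limit stays in the space, and `N ^ m` splits
  -- asymptotically along a subsequence.
  compact : ∀ (f : ℕ → Space d → ℂ) (F G : Space d → ℂ), (∀ n, f n ∈ 𝒳) → (∀ n, N (f n) = 1) →
    MemLp F (ENNReal.ofReal q) volume → IsAbsGrad 2 F G →
    (∀ᵐ x, Filter.Tendsto (fun n => f n x) Filter.atTop (nhds (F x))) →
    (∀ ψ : 𝓢(Space d, ℂ), Filter.Tendsto (fun n => ∫ x, f n x * ψ x) Filter.atTop
      (nhds (∫ x, F x * ψ x))) →
    F ∈ 𝒳 ∧ ∃ k : ℕ → ℕ, StrictMono k ∧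
      Filter.Tendsto (fun n => (N (fun x => f (k n) x + (-1) * F x)).toReal ^ m) Filter.atTop
        (nhds (1 - (N F).toReal ^ m))

/-! ### Exponent identities and the multiplicative inequality. -/

theorem Exponents.div_q {α γ q s : ℝ} (E : Exponents d γ q s (α + 2)) (hα : 0 < α)
    (hγ : γ = d / 2 - 4 / α) : (d : ℝ) / q = 4 / α := by
  have hd : (0 : ℝ) < d := by exact_mod_cast E.dim
  have h1 : (0 : ℝ) < d - 2 * γ := by linarith [E.γ_dim]
  rw [E.q_eq, hγ]
  rw [hγ] at h1
  field_simp
  field_simp at h1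
  ring

theorem Exponents.s_eq {γ q s p : ℝ} (E : Exponents d γ q s p) : s = d / 2 - d / p := by
  have hd : (0 : ℝ) < d := by exact_mod_cast E.dim
  have h1 : (0 : ℝ) < d - 2 * s := by linarith [E.s_dim]
  rw [E.p_eq]
  field_simp
  ring

/-- The Gagliardo–Nirenberg inequality, without the sharp constant. -/
theorem Exponents.exists_gagliardo_nirenberg {α γ q s : ℝ} (E : Exponents d γ q s (α + 2))
    (hα : 0 < α) (hγ : γ = d / 2 - 4 / α) :
    ∃ C : ℝ, 0 < C ∧ ∀ f g : Space d → ℂ, MemLp f (ENNReal.ofReal q) volume → IsAbsGrad 2 f g →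
      MemLp f (ENNReal.ofReal (α + 2)) volume ∧
      eLpNorm f (ENNReal.ofReal (α + 2)) volume ^ (α + 2) ≤ ENNReal.ofReal C *
        (eLpNorm f (ENNReal.ofReal q) volume ^ α * eLpNorm g 2 volume ^ 2) := by
  have hd : (0 : ℝ) < d := by exact_mod_cast E.dim
  obtain ⟨C, hC, hb⟩ := E.exists_additive_bound
  have hs := E.s_eq
  have hdq := E.div_q hα hγ
  have hγ2 := E.γ_lt
  have hγs := E.γ_s
  have hs2 := E.s_lt
  refine ⟨(2 * C) ^ (α + 2), by positivity, fun f g hf hg => ?_⟩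
  have hfp : eLpNorm f (ENNReal.ofReal (α + 2)) volume ≠ ∞ := by
    refine ((hb f g hf hg).trans_lt ?_).ne
    exact ENNReal.mul_lt_top ENNReal.ofReal_lt_top (ENNReal.add_lt_top.2 ⟨hf.2, hg.1.2⟩)
  refine ⟨⟨hf.1, hfp.lt_top⟩, ?_⟩
  set A := (eLpNorm f (ENNReal.ofReal q) volume).toReal with hA
  set B := (eLpNorm g 2 volume).toReal with hB
  set P := (eLpNorm f (ENNReal.ofReal (α + 2)) volume).toReal with hP
  have hA0 : 0 ≤ A := ENNReal.toReal_nonneg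
  have hB0 : 0 ≤ B := ENNReal.toReal_nonneg
  have hP0 : 0 ≤ P := ENNReal.toReal_nonneg
  have eA : eLpNorm f (ENNReal.ofReal q) volume = ENNReal.ofReal A := (ENNReal.ofReal_toReal hf.2.ne).symm
  have eB : eLpNorm g 2 volume = ENNReal.ofReal B := (ENNReal.ofReal_toReal hg.1.2.ne).symm
  have eP : eLpNorm f (ENNReal.ofReal (α + 2)) volume = ENNReal.ofReal P :=
    (ENNReal.ofReal_toReal hfp).symm
  -- The additive inequality applied to the dilates of `f`.
  have key : ∀ lam : ℝ, 0 < lam → P ≤ C * (lam ^ (-(s - γ)) * A + lam ^ (2 - s) * B) := by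
    intro lam hl
    have h := hb _ _ (memLp_affine hf hl 0) (by simpa using hg.affine 1 hl 0)
    have e2 := eLpNorm_affine_mul g ((lam ^ (2 : ℝ) : ℝ) : ℂ) hl 0 (p := 2) (by norm_num)
    rw [ENNReal.ofReal_ofNat] at e2
    simp only [add_zero] at e2 h
    have e0 := eLpNorm_affine f hl 0 (p := α + 2) (by linarith)
    have e1 := eLpNorm_affine f hl 0 (p := q) E.q_pos
    simp only [add_zero] at e0 e1
    have e2' : eLpNorm (fun x => (lam : ℂ) ^ 2 * g (lam • x)) 2 volume =
        ENNReal.ofReal (lam ^ (2 - d / 2 : ℝ) * B) := by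
      have : (fun x => (lam : ℂ) ^ 2 * g (lam • x)) =
          fun x => ((lam ^ (2 : ℝ) : ℝ) : ℂ) * g (lam • x) := by
        ext x; simp
      rw [this, e2, eB, ← ENNReal.ofReal_mul (by positivity), Complex.norm_real,
        Real.norm_of_nonneg (by positivity), ← Real.rpow_add hl]
      congr 3
      ring
    rw [e0, e1, e2', eA, eP, ← ENNReal.ofReal_mul (by positivity),
      ← ENNReal.ofReal_mul (by positivity), ← ENNReal.ofReal_add (by positivity) (by positivity),
      ← ENNReal.ofReal_mul (by positivity), ENNReal.ofReal_le_ofReal_iff (by positivity)] at h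
    have hpos : 0 < lam ^ (-(d : ℝ) / (α + 2)) := by positivity
    rw [← mul_le_mul_iff_right₀ hpos]
    refine h.trans (le_of_eq ?_)
    have x1 : lam ^ (-(d : ℝ) / (α + 2)) * lam ^ (-(s - γ)) = lam ^ (-(d : ℝ) / q) := by
      rw [← Real.rpow_add hl]
      congr 1
      rw [neg_div, neg_div, hdq, hs, hγ]; ring
    have x2 : lam ^ (-(d : ℝ) / (α + 2)) * lam ^ (2 - s) = lam ^ (2 - d / 2 : ℝ) := by
      rw [← Real.rpow_add hl]
      congr 1
      rw [hs]; ring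
    linear_combination -C * A * x1 - C * B * x2
  rw [eA, eB, eP, ENNReal.ofReal_rpow_of_nonneg hP0 (by linarith),
    ENNReal.ofReal_rpow_of_nonneg hA0 hα.le, ← ENNReal.ofReal_pow hB0,
    ← ENNReal.ofReal_mul (by positivity), ← ENNReal.ofReal_mul (by positivity)]
  refine ENNReal.ofReal_le_ofReal ?_
  have hA' : A = 0 → P = 0 := fun h => by
    have h1 : f =ᵐ[volume] 0 := by
      rw [h, ENNReal.ofReal_zero, eLpNorm_eq_zero_iff hf.1 (by simpa using E.q_pos)] at eA
      exact eA
    rw [hP, eLpNorm_congr_ae h1]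
    simp
  rcases hA0.eq_or_lt with hA1 | hA1
  · rw [hA' hA1.symm, Real.zero_rpow (by linarith)]
    positivity
  rcases hB0.eq_or_lt with hB1 | hB1
  -- When the Laplacian term vanishes, the limit `lam → ∞` removes the other one.
  · have hP' : P ≤ 0 := by
      have t1 := ((tendsto_rpow_neg_atTop (y := s - γ) (by linarith)).mul_const A).const_mul C
      simp only [zero_mul, mul_zero] at t1
      refine ge_of_tendsto t1 ?_
      filter_upwards [Filter.eventually_gt_atTop 0] with lam hl
      have := key lam hl
      rwa [← hB1, mul_zero, add_zero] at this
    rw [le_antisymm hP' hP0, Real.zero_rpow (by linarith)]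
    positivity
  -- The interpolation exponent. The value of `γ` gives `τ * (α + 2) = 2`, and the dilation `(A / B)
  -- ^ (1 / (2 - γ))` used below equalizes the two terms.
  set τ := (s - γ) / (2 - γ) with hτ
  have h2γ : 0 < 2 - γ := by linarith
  have hτp : τ * (α + 2) = 2 := by
    rw [hτ, div_mul_eq_mul_div, div_eq_iff h2γ.ne', hs, hγ]
    field_simp
    ring
  have h := key ((A / B) ^ (1 / (2 - γ))) (by positivity)
  have y1 : ((A / B) ^ (1 / (2 - γ))) ^ (-(s - γ)) * A = A ^ (1 - τ) * B ^ τ := by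
    rw [← Real.rpow_mul (by positivity), Real.div_rpow hA0 hB0, Real.rpow_sub hA1, Real.rpow_one,
      show 1 / (2 - γ) * -(s - γ) = -τ by rw [hτ]; ring, Real.rpow_neg hA0, Real.rpow_neg hB0]
    field_simp
  have y2 : ((A / B) ^ (1 / (2 - γ))) ^ (2 - s) * B = A ^ (1 - τ) * B ^ τ := by
    rw [← Real.rpow_mul (by positivity), Real.div_rpow hA0 hB0,
      show 1 / (2 - γ) * (2 - s) = 1 - τ by rw [hτ]; field_simp; ring]
    rw [Real.rpow_sub hB1, Real.rpow_one]
    field_simp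
  rw [y1, y2] at h
  have h3 : P ≤ 2 * C * (A ^ (1 - τ) * B ^ τ) := h.trans (by linarith)
  refine (Real.rpow_le_rpow hP0 h3 (by linarith)).trans (le_of_eq ?_)
  rw [Real.mul_rpow (x := 2 * C) (by positivity) (by positivity)]
  congr 1
  rw [Real.mul_rpow (by positivity) (by positivity),
    ← Real.rpow_mul hA0, ← Real.rpow_mul hB0, hτp, sub_mul, hτp]
  norm_num

/-- The Gagliardo–Nirenberg quotient for the norm `N`. -/
def gnQuotient (α : ℝ) (N : (Space d → ℂ) → ℝ≥0∞) (f : Space d → ℂ) : ℝ≥0∞ :=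
  lpNorm (α + 2) f ^ (α + 2) / (N f ^ α * hdotNorm 2 f ^ 2)

/-- The sharp constant for the norm `N` on `𝒳`. -/
def gnSharp (α : ℝ) (𝒳 : Set (Space d → ℂ)) (N : (Space d → ℂ) → ℝ≥0∞) : ℝ≥0∞ :=
  ⨆ f ∈ 𝒳, gnQuotient α N f

/-! ### The sharp constant and normalized maximizing sequences. -/

namespace GNSetting

variable {α γ q s m : ℝ} {𝒳 : Set (Space d → ℂ)} {N : (Space d → ℂ) → ℝ≥0∞}
  {R : (Space d → ℂ) → (Space d → ℂ) → Prop} {T : 𝓢(Space d, ℂ) → Space d → ℂ}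
  {f : Space d → ℂ}

theorem norm_ne_top (S : GNSetting α γ q s m 𝒳 N R T) (hf : f ∈ 𝒳) : N f ≠ ∞ := by
  obtain ⟨u, hu⟩ := S.exists_rel f hf
  rw [(S.rel f hf u hu).2]
  exact (S.rel f hf u hu).1.2.ne

theorem hdot_ne_top (S : GNSetting α γ q s m 𝒳 N R T) (hf : f ∈ 𝒳) : hdotNorm 2 f ≠ ∞ := by
  obtain ⟨g, hg⟩ := S.grad f hf
  exact (hg.hdotNorm_lt S.exps.dim).ne

theorem exists_le (S : GNSetting α γ q s m 𝒳 N R T) :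
    ∃ C : ℝ, 0 < C ∧ ∀ f ∈ 𝒳, MemLp f (ENNReal.ofReal (α + 2)) volume ∧
      lpNorm (α + 2) f ^ (α + 2) ≤ ENNReal.ofReal C * (N f ^ α * hdotNorm 2 f ^ 2) := by
  obtain ⟨C, hC, h⟩ := S.exps.exists_gagliardo_nirenberg S.α_pos S.γ_eq
  obtain ⟨C', hC', h'⟩ := S.bound
  refine ⟨C * C' ^ α, by positivity, fun f hf => ?_⟩
  obtain ⟨g, hg⟩ := S.grad f hf
  obtain ⟨h1, h2⟩ := h f g (S.memLp f hf) hg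
  refine ⟨h1, h2.trans ?_⟩
  rw [← hg.hdotNorm_eq S.exps.dim, ENNReal.ofReal_mul hC.le, mul_assoc, ← mul_assoc _ (N f ^ α)]
  refine mul_le_mul_right (mul_le_mul_left ?_ _) _
  rw [← ENNReal.ofReal_rpow_of_nonneg hC'.le S.α_pos.le,
    ← ENNReal.mul_rpow_of_nonneg _ _ S.α_pos.le]
  exact ENNReal.rpow_le_rpow (h' f hf) S.α_pos.le

theorem memLp_p (S : GNSetting α γ q s m 𝒳 N R T) (hf : f ∈ 𝒳) :
    MemLp f (ENNReal.ofReal (α + 2)) volume := by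
  obtain ⟨C, -, h⟩ := S.exists_le
  exact (h f hf).1

theorem sharp_lt_top (S : GNSetting α γ q s m 𝒳 N R T) : gnSharp α 𝒳 N < ∞ := by
  obtain ⟨C, -, h⟩ := S.exists_le
  refine lt_of_le_of_lt (iSup₂_le fun f hf => ?_) (ENNReal.ofReal_lt_top (r := C))
  exact ENNReal.div_le_of_le_mul (h f hf).2

theorem denom_ne_top (S : GNSetting α γ q s m 𝒳 N R T) (hf : f ∈ 𝒳) :
    N f ^ α * hdotNorm 2 f ^ 2 ≠ ∞ :=
  ENNReal.mul_ne_top (ENNReal.rpow_lt_top_of_nonneg S.α_pos.le (S.norm_ne_top hf)).ne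
    (ENNReal.pow_ne_top (S.hdot_ne_top hf))

theorem le_sharp (S : GNSetting α γ q s m 𝒳 N R T) (hf : f ∈ 𝒳) :
    lpNorm (α + 2) f ^ (α + 2) ≤ gnSharp α 𝒳 N * (N f ^ α * hdotNorm 2 f ^ 2) := by
  rw [← ENNReal.div_le_iff_le_mul (Or.inr S.sharp_lt_top.ne) (Or.inl (S.denom_ne_top hf))]
  exact le_iSup₂_of_le f hf le_rfl

theorem sharp_pos (S : GNSetting α γ q s m 𝒳 N R T) : 0 < gnSharp α 𝒳 N := by
  let b : ContDiffBump (0 : Space d) := ⟨1, 2, one_pos, by norm_num⟩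
  obtain ⟨φ, -, hφ⟩ := toSchwartz_exists (g := b) b.contDiff b.hasCompactSupport
  have hmem := (S.schwartz φ).1
  refine lt_of_lt_of_le ?_ (le_iSup₂_of_le (φ : Space d → ℂ) hmem le_rfl)
  refine ENNReal.div_pos ?_ (S.denom_ne_top hmem)
  have hp : 0 < α + 2 := by linarith [S.α_pos]
  intro h0
  rw [ENNReal.rpow_eq_zero_iff_of_pos hp, lpNorm, eLpNorm_eq_zero_iff φ.continuous.aestronglyMeasurable
    (by simpa using hp)] at h0
  have h1 := (Continuous.ae_eq_iff_eq volume φ.continuous continuous_zero).1 h0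
  have h2 := congrFun h1 0
  rw [hφ, b.one_of_mem_closedBall (by simpa using b.rIn_pos.le)] at h2
  simp at h2

/-- The sharp inequality between real numbers. -/
theorem integral_le (S : GNSetting α γ q s m 𝒳 N R T) (hf : f ∈ 𝒳) :
    ∫ x, ‖f x‖ ^ (α + 2) ≤
      (gnSharp α 𝒳 N).toReal * ((N f).toReal ^ α * (hdotNorm 2 f).toReal ^ 2) := by
  have hp : 0 < α + 2 := by linarith [S.α_pos]
  rw [← toReal_eLpNorm_rpow hp (S.memLp_p hf), ENNReal.toReal_rpow, ENNReal.toReal_rpow,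
    ← ENNReal.toReal_pow, ← ENNReal.toReal_mul, ← ENNReal.toReal_mul]
  exact ENNReal.toReal_mono (ENNReal.mul_ne_top S.sharp_lt_top.ne (S.denom_ne_top hf))
    (S.le_sharp hf)

theorem gnQuotient_eq (S : GNSetting α γ q s m 𝒳 N R T) (hf : f ∈ 𝒳) :
    (gnQuotient α N f).toReal =
      (∫ x, ‖f x‖ ^ (α + 2)) / ((N f).toReal ^ α * (hdotNorm 2 f).toReal ^ 2) := by
  have hp : 0 < α + 2 := by linarith [S.α_pos]
  rw [← toReal_eLpNorm_rpow hp (S.memLp_p hf), ENNReal.toReal_rpow, ENNReal.toReal_rpow,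
    ← ENNReal.toReal_pow, ← ENNReal.toReal_mul, ← ENNReal.toReal_div]
  rfl

/-- Scaling and multiplication by constants adjust the two norms independently and preserve the
quotient. -/
theorem exists_rescale (S : GNSetting α γ q s m 𝒳 N R T) (hf : f ∈ 𝒳) (hN : 0 < (N f).toReal)
    (hh : 0 < (hdotNorm 2 f).toReal) {x y : ℝ} (hx : 0 < x) (hy : 0 < y) :
    ∃ f' ∈ 𝒳, (N f') = ENNReal.ofReal x ∧ hdotNorm 2 f' = ENNReal.ofReal y ∧
      ∫ z, ‖f' z‖ ^ (α + 2) = (∫ z, ‖f z‖ ^ (α + 2)) /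
        ((N f).toReal ^ α * (hdotNorm 2 f).toReal ^ 2) * (x ^ α * y ^ 2) := by
  have hp : 0 < α + 2 := by linarith [S.α_pos]
  have hα := S.α_pos
  set n := (N f).toReal with hn
  set h := (hdotNorm 2 f).toReal with hh'
  have en : N f = ENNReal.ofReal n := (ENNReal.ofReal_toReal (S.norm_ne_top hf)).symm
  have eh : hdotNorm 2 f = ENNReal.ofReal h := (ENNReal.ofReal_toReal (S.hdot_ne_top hf)).symm
  have hγ : 0 < 2 - γ := by linarith [S.exps.γ_lt]
  -- The ratio of the two norms scales like `lam ^ (2 - γ)`, with `γ < 2`, so dilation fixes the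
  -- ratio and the amplitude `a` then fixes the size.
  set lam : ℝ := (y * n / (x * h)) ^ (1 / (2 - γ)) with hlam
  have hl : 0 < lam := by positivity
  have hlamp : lam ^ (2 - γ) = y * n / (x * h) := by
    rw [hlam, ← Real.rpow_mul (by positivity), one_div_mul_cancel hγ.ne', Real.rpow_one]
  set a : ℝ := x * lam ^ (4 / α) / n with ha
  have ha0 : 0 < a := by positivity
  obtain ⟨hmem, hNf⟩ := S.affine f hf (a : ℂ) lam 0 hl
  obtain ⟨g, hg⟩ := S.grad f hf
  have hg' := hg.affine (a : ℂ) hl 0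
  have hna : ‖(a : ℂ)‖ = a := by rw [Complex.norm_real, Real.norm_of_nonneg ha0.le]
  have c1 : a * lam ^ (-(4 / α)) * n = x := by
    rw [ha, Real.rpow_neg hl.le]; field_simp
  have c2 : a * lam ^ (2 - d / 2 : ℝ) * h = y := by
    have : lam ^ (2 - d / 2 : ℝ) = lam ^ (2 - γ) * lam ^ (-(4 / α)) := by
      rw [← Real.rpow_add hl, S.γ_eq]; congr 1; ring
    rw [this, hlamp]
    have : a * (y * n / (x * h) * lam ^ (-(4 / α))) * h = a * lam ^ (-(4 / α)) * n * (y / x) := by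
      field_simp
    rw [this, c1]; field_simp
  refine ⟨_, hmem, ?_, ?_, ?_⟩
  · rw [hNf, hna, en, ← ENNReal.ofReal_mul (by positivity), c1]
  · rw [hg'.hdotNorm_eq S.exps.dim]
    have := eLpNorm_affine_mul g ((a : ℂ) * ((lam ^ (2 : ℝ) : ℝ) : ℂ)) hl 0 (p := 2) (by norm_num)
    rw [ENNReal.ofReal_ofNat] at this
    rw [this, ← hg.hdotNorm_eq S.exps.dim, eh, ← ENNReal.ofReal_mul (by positivity), norm_mul, hna,
      Complex.norm_real, Real.norm_of_nonneg (by positivity), ← c2]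
    congr 2
    rw [mul_assoc, ← Real.rpow_add hl]
    congr 2
    ring
  · rw [← toReal_eLpNorm_rpow hp (S.memLp_p hmem), eLpNorm_affine_mul f a hl 0 hp,
      ENNReal.toReal_mul, ENNReal.toReal_ofReal (by positivity),
      Real.mul_rpow (by positivity) ENNReal.toReal_nonneg, toReal_eLpNorm_rpow hp (S.memLp_p hf),
      hna, Real.mul_rpow ha0.le (by positivity), ← Real.rpow_mul hl.le, div_mul_cancel₀ _ hp.ne']
    have hx' : x ^ α = a ^ α * lam ^ (-(4 : ℝ)) * n ^ α := by
      rw [← c1, Real.mul_rpow (by positivity) hN.le, Real.mul_rpow ha0.le (by positivity),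
        ← Real.rpow_mul hl.le]
      congr 3
      field_simp
    have hy' : y ^ 2 = a ^ 2 * lam ^ (4 - d : ℝ) * h ^ 2 := by
      rw [← c2, mul_pow, mul_pow, ← Real.rpow_mul_natCast hl.le]
      congr 3
      push_cast
      ring
    have hl' : lam ^ (-(4 : ℝ)) * lam ^ (4 - d : ℝ) = lam ^ (-(d : ℝ)) := by
      rw [← Real.rpow_add hl]; congr 1; ring
    rw [hx', hy', Real.rpow_add ha0, ← hl', Real.rpow_two]
    field_simp

theorem pos_of_integral_pos (S : GNSetting α γ q s m 𝒳 N R T) (hf : f ∈ 𝒳)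
    (h : 0 < ∫ x, ‖f x‖ ^ (α + 2)) : 0 < (N f).toReal ∧ 0 < (hdotNorm 2 f).toReal := by
  have h1 := h.trans_le (S.integral_le hf)
  constructor
  · refine lt_of_le_of_ne ENNReal.toReal_nonneg fun h0 => ?_
    rw [← h0, Real.zero_rpow S.α_pos.ne', zero_mul, mul_zero] at h1
    exact lt_irrefl _ h1
  · refine lt_of_le_of_ne ENNReal.toReal_nonneg fun h0 => ?_
    rw [← h0] at h1
    simp at h1

theorem sharp_toReal_pos (S : GNSetting α γ q s m 𝒳 N R T) : 0 < (gnSharp α 𝒳 N).toReal :=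
  ENNReal.toReal_pos S.sharp_pos.ne' S.sharp_lt_top.ne

theorem exists_maximizing (S : GNSetting α γ q s m 𝒳 N R T) :
    ∃ f : ℕ → Space d → ℂ, (∀ n, f n ∈ 𝒳) ∧ (∀ n, N (f n) = 1) ∧ (∀ n, hdotNorm 2 (f n) = 1) ∧
      (∀ n, (gnSharp α 𝒳 N).toReal * (1 / 2) ≤ ∫ x, ‖f n x‖ ^ (α + 2)) ∧
      Filter.Tendsto (fun n => ∫ x, ‖f n x‖ ^ (α + 2)) Filter.atTop
        (nhds (gnSharp α 𝒳 N).toReal) := by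
  set K := (gnSharp α 𝒳 N).toReal with hK
  have hK0 : 0 < K := S.sharp_toReal_pos
  -- The extra halving keeps every term above `K / 2`, including the first; a uniform lower bound is
  -- needed for detection.
  have key : ∀ n : ℕ, ∃ f ∈ 𝒳, N f = 1 ∧ hdotNorm 2 f = 1 ∧
      K * (1 - 1 / ((n : ℝ) + 1) / 2) ≤ ∫ x, ‖f x‖ ^ (α + 2) := by
    intro n
    have hc1 : 1 / ((n : ℝ) + 1) ≤ 1 := by
      rw [div_le_one (by positivity)]; linarith [n.cast_nonneg (α := ℝ)]
    have hc2 : 0 < 1 / ((n : ℝ) + 1) := by positivity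
    have hc0 : 0 < K * (1 - 1 / ((n : ℝ) + 1) / 2) := mul_pos hK0 (by linarith)
    have hlt : ENNReal.ofReal (K * (1 - 1 / ((n : ℝ) + 1) / 2)) < gnSharp α 𝒳 N := by
      rw [← ENNReal.ofReal_toReal S.sharp_lt_top.ne, ENNReal.ofReal_lt_ofReal_iff hK0]
      nlinarith
    obtain ⟨f, hf, hlt'⟩ := by simpa only [gnSharp, lt_iSup_iff, exists_prop] using hlt
    have hqt : gnQuotient α N f ≠ ∞ :=
      (lt_of_le_of_lt (le_iSup₂_of_le f hf le_rfl) S.sharp_lt_top).ne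
    have hq := (ENNReal.ofReal_lt_iff_lt_toReal hc0.le hqt).1 hlt'
    rw [S.gnQuotient_eq hf] at hq
    have hP : 0 < ∫ x, ‖f x‖ ^ (α + 2) := by
      refine lt_of_le_of_ne (integral_nonneg fun x => by positivity) fun h0 => ?_
      rw [← h0, zero_div] at hq
      linarith
    obtain ⟨h1, h2⟩ := S.pos_of_integral_pos hf hP
    obtain ⟨f', hf', e1, e2, e3⟩ := S.exists_rescale hf h1 h2 one_pos one_pos
    refine ⟨f', hf', by simpa using e1, by simpa using e2, ?_⟩
    rw [e3]
    simpa using hq.le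
  choose f hf hN hh hle using key
  refine ⟨f, hf, hN, hh, fun n => (mul_le_mul_of_nonneg_left ?_ hK0.le).trans (hle n), ?_⟩
  · have hc1 : 1 / ((n : ℝ) + 1) ≤ 1 := by
      rw [div_le_one (by positivity)]; linarith [n.cast_nonneg (α := ℝ)]
    linarith
  · refine tendsto_of_tendsto_of_tendsto_of_le_of_le ?_ tendsto_const_nhds hle fun n => ?_
    · have := (((tendsto_one_div_add_atTop_nhds_zero_nat (𝕜 := ℝ)).div_const 2).const_sub 1).const_mul K
      simpa using this
    · have := S.integral_le (hf n)
      simpa [hN, hh] using this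

end GNSetting

/-! ### Existence of maximizers -/

/-- The right side averages `a ^ κ ≤ 1` and `(1 - a) ^ κ < 1` with weights `b` and `1 - b`. It can
reach one only if `b = 1`, and then `a ^ κ = 1`. This is the exclusion of splitting. -/
theorem eq_one_of_one_le_split {a b κ : ℝ} (hκ : 0 < κ) (ha : 0 < a) (ha1 : a ≤ 1) (hb : 0 < b)
    (hb1 : b ≤ 1) (h : 1 ≤ a ^ κ * b + (1 - a) ^ κ * (1 - b)) : a = 1 ∧ b = 1 := by
  have h1 : a ^ κ ≤ 1 := Real.rpow_le_one ha.le ha1 hκ.le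
  have h2 : (1 - a) ^ κ < 1 := Real.rpow_lt_one (by linarith) (by linarith) hκ
  have hb' : b = 1 := by
    by_contra hne
    have hlt : b < 1 := lt_of_le_of_ne hb1 hne
    nlinarith
  refine ⟨?_, hb'⟩
  by_contra hne
  have h3 : a ^ κ < 1 := Real.rpow_lt_one ha.le (lt_of_le_of_ne ha1 hne) hκ
  rw [hb'] at h
  linarith

/-- Expand the square; weak convergence sends the cross term to `-2‖G‖²`. -/
theorem WeakLim.tendsto_norm_sub {g : ℕ → Space d → ℂ} {G : Space d → ℂ} (h : WeakLim g G)
    (hg : ∀ n, MemLp (g n) 2 volume) (h1 : ∀ n, eLpNorm (g n) 2 volume = 1) :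
    Filter.Tendsto (fun n => (eLpNorm (fun x => g n x - G x) 2 volume).toReal ^ 2) Filter.atTop
      (nhds (1 - (eLpNorm G 2 volume).toReal ^ 2)) := by
  have hGc := memLp_conj h.1
  have e : ((memLp_conj hGc).toLp _ : Lp ℂ 2 (volume : Measure (Space d))) = h.1.toLp G := by
    congr 1
    ext x
    simp
  have hlim := h.2 _ hGc
  rw [← inner_toLp_conj h.1 hGc, e] at hlim
  have hlim' := (Complex.continuous_re.tendsto _).comp hlim
  have e2 : ∀ n, (eLpNorm (fun x => g n x - G x) 2 volume).toReal ^ 2 =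
      1 - 2 * (∫ x, g n x * (starRingEnd ℂ) (G x)).re + (eLpNorm G 2 volume).toReal ^ 2 := by
    intro n
    have h3 := norm_sub_sq (𝕜 := ℂ) (h.1.toLp G) ((hg n).toLp (g n))
    rw [← e, inner_toLp_conj (hg n) hGc, e, norm_sub_rev, ← MemLp.toLp_sub, Lp.norm_toLp,
      Lp.norm_toLp, Lp.norm_toLp, h1] at h3
    have h4 : (g n - G) = fun x => g n x - G x := rfl
    rw [h4] at h3
    rw [h3, ENNReal.toReal_one]
    simp only [RCLike.re_to_complex]
    ring
  have h5 : (inner ℂ (h.1.toLp G) (h.1.toLp G)).re = (eLpNorm G 2 volume).toReal ^ 2 := by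
    have := inner_self_eq_norm_sq (𝕜 := ℂ) (h.1.toLp G)
    rw [Lp.norm_toLp] at this
    exact this
  rw [h5] at hlim'
  have h6 := ((hlim'.const_mul 2).const_sub 1).add_const ((eLpNorm G 2 volume).toReal ^ 2)
  have h7 : 1 - 2 * (eLpNorm G 2 volume).toReal ^ 2 + (eLpNorm G 2 volume).toReal ^ 2 =
      1 - (eLpNorm G 2 volume).toReal ^ 2 := by ring
  rw [h7] at h6
  exact h6.congr fun n => (e2 n).symm

open Filter in
-- The translated limit is nonzero, so it carries positive shares `A`, `B` of the two normalized
-- quantities, and applying the sharp inequality to it and to the remainder forces both shares to be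
-- one.
theorem GNSetting.exists_maximizer {α γ q s m : ℝ} {𝒳 : Set (Space d → ℂ)}
    {N : (Space d → ℂ) → ℝ≥0∞} {R : (Space d → ℂ) → (Space d → ℂ) → Prop}
    {T : 𝓢(Space d, ℂ) → Space d → ℂ} (S : GNSetting α γ q s m 𝒳 N R T) :
    ∃ F ∈ 𝒳, N F = 1 ∧ hdotNorm 2 F = 1 ∧
      ∫ x, ‖F x‖ ^ (α + 2) = (gnSharp α 𝒳 N).toReal := by
  obtain ⟨f, hf, hN, hh, hlow, hlim⟩ := S.exists_maximizing
  have hp : 0 < α + 2 := by linarith [S.α_pos]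
  have hd := S.exps.dim
  have hm : 0 < m := by linarith [S.two_le]
  set K := (gnSharp α 𝒳 N).toReal with hK
  have hK0 : 0 < K := S.sharp_toReal_pos
  choose g hg using fun n => S.grad (f n) (hf n)
  have hg1 : ∀ n, eLpNorm (g n) 2 volume = 1 := fun n => by
    rw [← (hg n).hdotNorm_eq hd, hh]
  obtain ⟨C, hC, hCb⟩ := S.bound
  have hc : ∀ n, ENNReal.ofReal ((K * (1 / 2)) ^ (α + 2)⁻¹) ≤
      eLpNorm (f n) (ENNReal.ofReal (α + 2)) volume := by
    intro n
    have h1 := hlow n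
    rw [← toReal_eLpNorm_rpow hp (S.memLp_p (hf n))] at h1
    rw [ENNReal.ofReal_le_iff_le_toReal (S.memLp_p (hf n)).2.ne,
      Real.rpow_inv_le_iff_of_pos (by positivity) ENNReal.toReal_nonneg hp]
    exact h1
  obtain ⟨k, a, hk, F, G, hF, hG, hw, hae, hψ, hne⟩ := S.exps.exists_translated_limit
    (M := C + 1) (c := (K * (1 / 2)) ^ (α + 2)⁻¹) (by positivity) (by positivity)
    (fun n => S.memLp (f n) (hf n)) hg
    (fun n => by
      refine (hCb _ (hf n)).trans ?_
      rw [hN, mul_one]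
      exact ENNReal.ofReal_le_ofReal (by linarith))
    (fun n => by
      rw [hg1, ← ENNReal.ofReal_one]
      exact ENNReal.ofReal_le_ofReal (by linarith)) hc
  set w : ℕ → Space d → ℂ := fun n x => f (k n) (x + a n) with hwdef
  have hwX : ∀ n, w n ∈ 𝒳 ∧ N (w n) = 1 := fun n => by
    have := S.affine (f (k n)) (hf _) 1 1 (a n) one_pos
    simpa [hN, hwdef] using this
  have hwg : ∀ n, IsAbsGrad 2 (w n) (fun x => g (k n) (x + a n)) := fun n => by
    simpa using (hg (k n)).affine 1 one_pos (a n)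
  have hwg1 : ∀ n, eLpNorm (fun x => g (k n) (x + a n)) 2 volume = 1 := fun n => by
    have := eLpNorm_affine (g (k n)) one_pos (a n) (p := 2) (by norm_num)
    rw [ENNReal.ofReal_ofNat] at this
    simpa [hg1] using this
  have hwP : ∀ n, ∫ x, ‖w n x‖ ^ (α + 2) = ∫ x, ‖f (k n) x‖ ^ (α + 2) := fun n =>
    integral_add_right_eq_self (fun x => ‖f (k n) x‖ ^ (α + 2)) (a n)
  obtain ⟨hFX, k', hk', hsplit⟩ := S.compact w F G (fun n => (hwX n).1) (fun n => (hwX n).2)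
    hF hG hae hψ
  have hsub : ∀ n, (fun x => w (k' n) x + (-1) * F x) ∈ 𝒳 := fun n => by
    obtain ⟨u, hu⟩ := S.exists_rel _ (hwX (k' n)).1
    obtain ⟨u', hu'⟩ := S.exists_rel _ hFX
    exact (S.add_mul _ (hwX (k' n)).1 _ hFX u u' hu hu' (-1)).1
  set A := (N F).toReal ^ m with hA
  set B := (hdotNorm 2 F).toReal ^ 2 with hB
  set P := ∫ x, ‖F x‖ ^ (α + 2) with hP
  have hgsub : ∀ n, hdotNorm 2 (fun x => w (k' n) x + (-1) * F x) =
      eLpNorm (fun x => g (k (k' n)) (x + a (k' n)) - G x) 2 volume := fun n => by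
    have ht1 := isTempered_of_memLp S.exps.one_le_q (S.memLp _ (hwX (k' n)).1)
    have ht2 := isTempered_of_memLp S.exps.one_le_q hF
    have h1 := IsAbsGrad.sub ht1 ht2 (hwg (k' n)) hG
    have h2 : (fun x => w (k' n) x + (-1) * F x) = fun x => w (k' n) x - F x := by
      ext x; ring
    rw [h2, h1.hdotNorm_eq hd]
  have hBlim : Tendsto (fun n => (hdotNorm 2 (fun x => w (k' n) x + (-1) * F x)).toReal ^ 2) atTop
      (nhds (1 - B)) := by
    have h1 := (hw.comp hk').tendsto_norm_sub (fun n => (hwg (k' n)).1) fun n => hwg1 (k' n)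
    rw [← hG.hdotNorm_eq hd] at h1
    exact h1.congr fun n => by rw [hgsub]
  have hFp := S.memLp_p hFX
  obtain ⟨C', hC', hC'b⟩ := S.exists_le
  have hPlim : Tendsto (fun n => ∫ x, ‖w (k' n) x + (-1) * F x‖ ^ (α + 2)) atTop
      (nhds (K - P)) := by
    have h1 := tendsto_integral_norm_rpow_sub (p := α + 2) (by linarith [S.α_pos])
      (u := fun n => w (k' n)) (fun n => S.memLp_p (hwX (k' n)).1) hFp
      (M := C' ^ (α + 2)⁻¹) (fun n => by
        have h2 := (hC'b _ (hwX (k' n)).1).2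
        rw [(hwX (k' n)).2, (hwg (k' n)).hdotNorm_eq hd, hwg1] at h2
        simp only [ENNReal.one_rpow, one_pow, mul_one] at h2
        rw [← ENNReal.ofReal_rpow_of_nonneg hC'.le (by positivity), ENNReal.le_rpow_inv_iff hp]
        exact h2)
      (by filter_upwards [hae] with x hx using hx.comp hk'.tendsto_atTop)
    have h3 : Tendsto (fun n => ∫ x, ‖w (k' n) x‖ ^ (α + 2)) atTop (nhds K) := by
      simp only [hwP]
      exact (hlim.comp hk.tendsto_atTop).comp hk'.tendsto_atTop
    refine (h3.sub h1).congr fun n => ?_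
    rw [sub_sub_cancel]
    refine integral_congr_ae (Eventually.of_forall fun x => ?_)
    simp only [neg_one_mul, sub_eq_add_neg]
  have hA1 : 0 ≤ 1 - A := ge_of_tendsto' hsplit fun n => by positivity
  have hB1 : 0 ≤ 1 - B := ge_of_tendsto' hBlim fun n => by positivity
  have hκ : 0 < α / m := div_pos S.α_pos hm
  have hpow : ∀ t : ℝ, 0 ≤ t → t ^ α = (t ^ m) ^ (α / m) := fun t ht => by
    rw [← Real.rpow_mul ht, mul_div_cancel₀ _ hm.ne']
  -- The sharp inequality for the remainders, passed to the limit.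
  have hineq : K - P ≤ K * ((1 - A) ^ (α / m) * (1 - B)) := by
    refine le_of_tendsto_of_tendsto' hPlim
      (((hsplit.rpow_const (Or.inr hκ.le)).mul hBlim).const_mul K) fun n => ?_
    have := S.integral_le (hsub n)
    rwa [hpow _ ENNReal.toReal_nonneg] at this
  have hFle : P ≤ K * (A ^ (α / m) * B) := by
    have := S.integral_le hFX
    rwa [hpow _ ENNReal.toReal_nonneg] at this
  have hP0 : 0 < P := by
    rw [hP, ← toReal_eLpNorm_rpow hp hFp]
    refine Real.rpow_pos_of_pos (ENNReal.toReal_pos (fun h0 => hne ?_) hFp.2.ne) _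
    rwa [eLpNorm_eq_zero_iff hFp.1 (by simpa using hp)] at h0
  obtain ⟨hn0, hh0⟩ := S.pos_of_integral_pos hFX hP0
  obtain ⟨hA', hB'⟩ := eq_one_of_one_le_split hκ (by positivity : 0 < A) (by linarith)
    (by positivity : 0 < B) (by linarith) (by
      have : K * 1 ≤ K * (A ^ (α / m) * B + (1 - A) ^ (α / m) * (1 - B)) := by linarith
      exact le_of_mul_le_mul_left this hK0)
  refine ⟨F, hFX, ?_, ?_, ?_⟩
  · have : (N F).toReal = 1 := by
      rwa [hA, ← Real.one_rpow m, Real.rpow_left_inj hn0.le zero_le_one hm.ne'] at hA'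
    rw [← ENNReal.ofReal_toReal (S.norm_ne_top hFX), this, ENNReal.ofReal_one]
  · have : (hdotNorm 2 F).toReal = 1 := by
      rwa [hB, pow_eq_one_iff_of_nonneg hh0.le (by norm_num)] at hB'
    rw [← ENNReal.ofReal_toReal (S.hdot_ne_top hFX), this, ENNReal.ofReal_one]
  · rw [hA', hB'] at hFle hineq
    simp only [Real.one_rpow, sub_self, mul_zero, mul_one, sub_nonpos] at hFle hineq
    exact le_antisymm hFle hineq

/-! ### The Euler–Lagrange equation -/

theorem norm_rpow_mul_le {m : ℝ} (hm : 2 ≤ m) (a b : ℂ) :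
    ‖a‖ ^ (m - 2) * (‖a‖ * ‖b‖) ≤ (‖a‖ + ‖b‖) ^ m := by
  have h1 : ‖a‖ ≤ ‖a‖ + ‖b‖ := by linarith [norm_nonneg b]
  have h2 : ‖b‖ ≤ ‖a‖ + ‖b‖ := by linarith [norm_nonneg a]
  have h3 : 0 ≤ ‖a‖ + ‖b‖ := by positivity
  calc ‖a‖ ^ (m - 2) * (‖a‖ * ‖b‖) ≤ (‖a‖ + ‖b‖) ^ (m - 2) * ((‖a‖ + ‖b‖) * (‖a‖ + ‖b‖)) := by
        gcongr
    _ = (‖a‖ + ‖b‖) ^ m := by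
        rw [← sq, ← Real.rpow_two, ← Real.rpow_add_of_nonneg h3 (by linarith) (by norm_num)]
        congr 1
        ring

theorem integrable_norm_add_rpow {m : ℝ} (hm : 0 < m) {u v : Space d → ℂ}
    (hu : MemLp u (ENNReal.ofReal m) volume) (hv : MemLp v (ENNReal.ofReal m) volume) :
    Integrable (fun x => (‖u x‖ + ‖v x‖) ^ m) volume := by
  have h := (hu.norm.add hv.norm).integrable_norm_rpow (by simpa using hm) ENNReal.ofReal_ne_top
  rw [ENNReal.toReal_ofReal hm.le] at h
  refine h.congr (Filter.Eventually.of_forall fun x => ?_)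
  simp only [Pi.add_apply]
  rw [Real.norm_of_nonneg (by positivity)]

theorem aestronglyMeasurable_powerNL (r : ℝ) {u : Space d → ℂ}
    (hu : AEStronglyMeasurable u volume) : AEStronglyMeasurable (powerNL r u) volume :=
  (Complex.measurable_ofReal.comp_aemeasurable
    (hu.norm.aemeasurable.pow_const r)).aestronglyMeasurable.mul hu

theorem norm_powerNL (r : ℝ) (u : Space d → ℂ) (x : Space d) :
    ‖powerNL r u x‖ = ‖u x‖ ^ r * ‖u x‖ := by
  rw [powerNL, norm_mul, Complex.norm_real, Real.norm_of_nonneg (by positivity)]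

theorem integrable_powerNL_mul {m : ℝ} (hm : 2 ≤ m) {u v : Space d → ℂ}
    (hu : MemLp u (ENNReal.ofReal m) volume) (hv : MemLp v (ENNReal.ofReal m) volume) :
    Integrable (fun x => powerNL (m - 2) u x * v x) volume := by
  refine (integrable_norm_add_rpow (by linarith) hu hv).mono'
    ((aestronglyMeasurable_powerNL _ hu.1).mul hv.1) (Filter.Eventually.of_forall fun x => ?_)
  rw [norm_mul, norm_powerNL, mul_assoc]
  exact norm_rpow_mul_le hm _ _

/-- Differentiation under the integral sign: for `|t| < 1` the derivative in `t` is dominated by `m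
(‖u‖ + 2‖v‖)^m`. -/
theorem hasDerivAt_integral_norm_rpow {m : ℝ} (hm : 2 ≤ m) {u v : Space d → ℂ}
    (hu : MemLp u (ENNReal.ofReal m) volume) (hv : MemLp v (ENNReal.ofReal m) volume) :
    HasDerivAt (fun t : ℝ => ∫ x, ‖u x + (t : ℂ) * v x‖ ^ m)
      (m * (∫ x, powerNL (m - 2) u x * (starRingEnd ℂ) (v x)).re) 0 := by
  have hm0 : 0 < m := by linarith
  have hvc := memLp_conj hv
  set F' : ℝ → Space d → ℝ := fun t x =>
    m * ‖u x + (t : ℂ) * v x‖ ^ (m - 2) * inner ℝ (u x + (t : ℂ) * v x) (v x) with hF'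
  have hF'0 : ∀ x, F' 0 x = m * (powerNL (m - 2) u x * (starRingEnd ℂ) (v x)).re := by
    intro x
    simp only [hF', Complex.ofReal_zero, zero_mul, add_zero, powerNL, Complex.inner]
    rw [mul_assoc (((‖u x‖ ^ (m - 2) : ℝ) : ℂ)), Complex.re_ofReal_mul]
    simp
    ring
  have hi0 : Integrable (F' 0) volume := by
    have := ((integrable_powerNL_mul hm hu hvc).re).const_mul m
    refine this.congr (Filter.Eventually.of_forall fun x => ?_)
    rw [hF'0]; simp
  have hmeas : ∀ t : ℝ, AEStronglyMeasurable (fun x => u x + (t : ℂ) * v x) volume := fun t =>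
    hu.1.add (hv.1.const_mul _)
  have key := hasDerivAt_integral_of_dominated_loc_of_deriv_le (μ := volume) (𝕜 := ℝ)
    (F := fun (t : ℝ) x => ‖u x + (t : ℂ) * v x‖ ^ m) (F' := F') (x₀ := 0)
    (s := Metric.ball 0 1) (bound := fun x => m * (‖u x‖ + ‖v x‖ + ‖v x‖) ^ m)
    (Metric.ball_mem_nhds _ one_pos)
    (Filter.Eventually.of_forall fun t => ((hmeas t).norm.aemeasurable.pow_const m).aestronglyMeasurable)
    (by simpa using integrable_norm_rpow hm0 hu) hi0.1
    (Filter.Eventually.of_forall fun x t ht => ?_) ?_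
    (Filter.Eventually.of_forall fun x t ht => ?_)
  · have h := key.2
    have e : ∫ x, F' 0 x = m * (∫ x, powerNL (m - 2) u x * (starRingEnd ℂ) (v x)).re := by
      simp only [hF'0]
      rw [integral_const_mul]
      congr 1
      exact integral_re (integrable_powerNL_mul hm hu hvc)
    rwa [e] at h
  · have ht' : |t| ≤ 1 := by simpa using (mem_ball_zero_iff.1 ht).le
    have h1 : ‖u x + (t : ℂ) * v x‖ ≤ ‖u x‖ + ‖v x‖ := by
      refine (norm_add_le _ _).trans (add_le_add le_rfl ?_)
      rw [norm_mul, Complex.norm_real]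
      exact mul_le_of_le_one_left (norm_nonneg _) ht'
    simp only [hF']
    rw [norm_mul, norm_mul, Real.norm_of_nonneg hm0.le, Real.norm_of_nonneg (by positivity),
      mul_assoc]
    refine mul_le_mul_of_nonneg_left ?_ hm0.le
    calc _ ≤ ‖u x + (t : ℂ) * v x‖ ^ (m - 2) * (‖u x + (t : ℂ) * v x‖ * ‖v x‖) := by
          gcongr
          exact norm_inner_le_norm _ _
      _ ≤ _ := norm_rpow_mul_le hm _ _
      _ ≤ _ := by gcongr
  · have h := integrable_norm_add_rpow hm0 (hu.norm.add hv.norm).ofReal hv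
    refine (h.const_mul m).congr (Filter.Eventually.of_forall fun x => ?_)
    simp only [Pi.add_apply]
    have e : ‖((‖u x‖ + ‖v x‖ : ℝ) : ℂ)‖ = ‖u x‖ + ‖v x‖ := by
      rw [Complex.norm_real, Real.norm_of_nonneg (by positivity)]
    exact congrArg (fun z => m * (z + ‖v x‖) ^ m) e
  · have h1 : HasDerivAt (fun t : ℝ => u x + (t : ℂ) * v x) (v x) t := by
      have := ((Complex.ofRealCLM.hasDerivAt (x := t)).mul_const (v x)).const_add (u x)
      simpa using this
    have h2 := (hasFDerivAt_norm_rpow (u x + (t : ℂ) * v x) (p := m) (by linarith)).comp_hasDerivAt t h1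
    exact h2

/-! ### Conjugation symmetry and `|∇|^s` on all Schwartz functions. -/

theorem conj_fourier (f : Space d → ℂ) (ξ : Space d) :
    (starRingEnd ℂ) (𝓕 f ξ) = 𝓕⁻ (fun x => (starRingEnd ℂ) (f x)) ξ := by
  rw [Real.fourier_eq, Real.fourierInv_eq, ← integral_conj]
  refine integral_congr_ae (Filter.Eventually.of_forall fun x => ?_)
  simp only [Circle.smul_def, smul_eq_mul, map_mul]
  rw [AddChar.map_neg_eq_inv, Circle.coe_inv_eq_conj, Complex.conj_conj]

theorem conj_fourierInv (f : Space d → ℂ) (ξ : Space d) :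
    (starRingEnd ℂ) (𝓕⁻ f ξ) = 𝓕 (fun x => (starRingEnd ℂ) (f x)) ξ := by
  have h := conj_fourier (fun x => (starRingEnd ℂ) (f x)) ξ
  simp only [Complex.conj_conj] at h
  rw [← h, Complex.conj_conj]

theorem conj_absSymbol (s : ℝ) (ξ : Space d) : (starRingEnd ℂ) (absSymbol s ξ) = absSymbol s ξ := by
  unfold absSymbol
  exact Complex.conj_ofReal _

theorem absGrad_conj (s : ℝ) {φ ψ : 𝓢(Space d, ℂ)} (h : ∀ x, ψ x = (starRingEnd ℂ) (φ x))
    (x : Space d) : absGrad s ψ x = (starRingEnd ℂ) (absGrad s φ x) := by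
  have e : (fun ξ : Space d => (((2 * Real.pi * ‖ξ‖) ^ s : ℝ) : ℂ) * 𝓕 (ψ : Space d → ℂ) ξ) =
      fun ξ => (starRingEnd ℂ) (absSymbol s ξ * (𝓕⁻ φ : 𝓢(Space d, ℂ)) ξ) := by
    ext ξ
    rw [map_mul, conj_absSymbol, SchwartzMap.fourierInv_coe, conj_fourierInv,
      show (ψ : Space d → ℂ) = _ from funext h]
    rfl
  rw [absGrad_eq_fourier s φ, conj_fourier, absGrad, e]

theorem absGrad_smul (s : ℝ) (c : ℂ) (φ : 𝓢(Space d, ℂ)) (x : Space d) :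
    absGrad s (c • φ) x = c * absGrad s φ x := by
  have e : (fun ξ => absSymbol s ξ * (𝓕⁻ (c • φ) : 𝓢(Space d, ℂ)) ξ) =
      c • fun ξ => absSymbol s ξ * (𝓕⁻ φ : 𝓢(Space d, ℂ)) ξ := by
    ext ξ
    rw [FourierTransform.fourierInv_smul, smul_apply, Pi.smul_apply, smul_eq_mul, smul_eq_mul]
    ring
  rw [absGrad_eq_fourier, absGrad_eq_fourier, e, Real.fourier_eq, Real.fourier_eq,
    ← integral_const_mul]
  refine integral_congr_ae (Filter.Eventually.of_forall fun y => ?_)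
  simp only [Circle.smul_def, smul_eq_mul, Pi.smul_apply]
  ring

theorem exists_schwartz_conj (φ : 𝓢(Space d, ℂ)) :
    ∃ ψ : 𝓢(Space d, ℂ), ∀ x, ψ x = (starRingEnd ℂ) (φ x) :=
  ⟨SchwartzMap.postcompCLM (𝕜 := ℝ) (Complex.conjCLE : ℂ →L[ℝ] ℂ) φ, fun x => by simp⟩

/-- Outside `𝓢₀` the product need not be smooth at the origin, but for `s ≥ 0` it is bounded there
and rapid decay absorbs the growth of the symbol. The constant `7` is a bound for `2π`. -/
theorem integrable_absSymbol_mul {s : ℝ} (hs : 0 ≤ s) (η : 𝓢(Space d, ℂ)) :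
    Integrable (fun ξ => absSymbol s ξ * η ξ) volume ∧
      MemLp (fun ξ => absSymbol s ξ * η ξ) 2 volume := by
  set n := ⌈s⌉₊ with hn
  have hdec := SchwartzMap.one_add_le_sup_seminorm_apply (𝕜 := ℝ) (m := (n + 2 * (d + 1), 0))
    (k := n + 2 * (d + 1)) (n := 0) le_rfl le_rfl η
  set c := 2 ^ (n + 2 * (d + 1), 0).1 * (Finset.Iic (n + 2 * (d + 1), 0)).sup
      (fun m => SchwartzMap.seminorm ℝ m.1 m.2) η with hc
  have hmeas : AEStronglyMeasurable (fun ξ => absSymbol s ξ * η ξ) volume :=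
    (measurable_absSymbol s).aestronglyMeasurable.mul η.continuous.aestronglyMeasurable
  have hc0 : 0 ≤ c := le_trans (by positivity) (hdec 0)
  have hb : ∀ ξ, ‖absSymbol s ξ * η ξ‖ ≤ (7 ^ n * c) * weight ξ ^ 2 := by
    intro ξ
    have h1 : (2 * Real.pi * ‖ξ‖) ^ s ≤ 7 ^ n * (1 + ‖ξ‖) ^ n := by
      have hpi : 2 * Real.pi * ‖ξ‖ ≤ 7 * (1 + ‖ξ‖) := by
        nlinarith [Real.pi_lt_d2, norm_nonneg ξ, Real.pi_pos]
      refine (Real.rpow_le_rpow (by positivity) hpi hs).trans ?_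
      rw [← mul_pow, ← Real.rpow_natCast]
      exact Real.rpow_le_rpow_of_exponent_le (by nlinarith [norm_nonneg ξ]) (Nat.le_ceil s)
    have h2 := hdec ξ
    rw [norm_iteratedFDeriv_zero, pow_add] at h2
    have hw : weight ξ ^ 2 * (1 + ‖ξ‖) ^ (2 * (d + 1)) = 1 := by
      rw [weight, inv_pow, ← pow_mul, mul_comm 2]
      exact inv_mul_cancel₀ (by positivity)
    have hw0 := weight_pos ξ
    rw [norm_mul, norm_absSymbol]
    calc _ ≤ 7 ^ n * (1 + ‖ξ‖) ^ n * ‖η ξ‖ := by gcongr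
      _ = 7 ^ n * ((1 + ‖ξ‖) ^ n * (1 + ‖ξ‖) ^ (2 * (d + 1)) * ‖η ξ‖) * weight ξ ^ 2 := by
          linear_combination -(7 ^ n * (1 + ‖ξ‖) ^ n * ‖η ξ‖) * hw
      _ ≤ _ := by gcongr
  have hi : Integrable (fun ξ : Space d => weight ξ ^ 2) volume := memLp_weight.integrable_sq
  refine ⟨(hi.const_mul _).mono' hmeas (Filter.Eventually.of_forall hb), ?_⟩
  refine MemLp.of_le_mul (c := 7 ^ n * c) memLp_weight hmeas
    (Filter.Eventually.of_forall fun ξ => (hb ξ).trans ?_)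
  have hw0 := weight_pos ξ
  rw [Real.norm_of_nonneg hw0.le]
  refine mul_le_mul_of_nonneg_left ?_ (by positivity)
  nlinarith [weight_le_one ξ]

/-- For Schwartz functions `absGrad` is the distributional `|∇|^s`. -/
theorem isAbsGrad_schwartz {s : ℝ} (hs : 0 ≤ s) (φ : 𝓢(Space d, ℂ)) :
    IsAbsGrad s φ (absGrad s φ) ∧ IsFourierPair (absGrad s φ)
      (fun ξ => absSymbol s ξ * 𝓕 (φ : Space d → ℂ) ξ) := by
  have h1 := integrable_absSymbol_mul hs (𝓕⁻ φ)
  have h2 := integrable_absSymbol_mul hs (𝓕 φ)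
  have hL2 : MemLp (absGrad s φ) 2 volume := by
    rw [absGrad_eq_fourier]
    exact memLp_two_fourier h1.1 h1.2
  have hF : IsFourierPair (absGrad s φ) (fun ξ => absSymbol s ξ * 𝓕 (φ : Space d → ℂ) ξ) :=
    isFourierPair_fourierInv h2.1
  exact ⟨isAbsGrad_of_isFourierPair (isFourierPair_fourier φ.integrable) hL2 hF
    Filter.EventuallyEq.rfl, hF⟩

/-! ### First variation and normalization. -/

namespace GNSetting

variable {α γ q s m : ℝ} {𝒳 : Set (Space d → ℂ)} {N : (Space d → ℂ) → ℝ≥0∞}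
  {R : (Space d → ℂ) → (Space d → ℂ) → Prop} {T : 𝓢(Space d, ℂ) → Space d → ℂ}

theorem memLp_T (S : GNSetting α γ q s m 𝒳 N R T) (φ : 𝓢(Space d, ℂ)) :
    MemLp (T φ) (ENNReal.ofReal m) volume :=
  (S.rel _ (S.schwartz φ).1 _ (S.schwartz φ).2).1

/-- First variation at a maximizer whose norms are suitably normalized. -/
theorem re_variation (S : GNSetting α γ q s m 𝒳 N R T) {Q u g : Space d → ℂ} (hQ : Q ∈ 𝒳)
    (hu : R Q u) (hg : IsAbsGrad 2 Q g) {X : ℝ} (hX : 0 < X) (hNX : (N Q).toReal ^ m = X)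
    (hY : (hdotNorm 2 Q).toReal ^ 2 = 2 * X / α)
    (hP : ∫ x, ‖Q x‖ ^ (α + 2) = (α + 2) * X / α)
    (hmax : ∫ x, ‖Q x‖ ^ (α + 2) =
      (gnSharp α 𝒳 N).toReal * ((N Q).toReal ^ α * (hdotNorm 2 Q).toReal ^ 2))
    (φ : 𝓢(Space d, ℂ)) :
    (∫ x, powerNL (m - 2) u x * (starRingEnd ℂ) (T φ x)).re +
      (∫ x, g x * (starRingEnd ℂ) (absGrad 2 φ x)).re -
      (∫ x, powerNL α Q x * (starRingEnd ℂ) (φ x)).re = 0 := by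
  have hα := S.α_pos
  have hm : 0 < m := by linarith [S.two_le]
  have hp : 0 < α + 2 := by linarith
  have hd := S.exps.dim
  set K := (gnSharp α 𝒳 N).toReal with hK
  have hQt := isTempered_of_memLp S.exps.one_le_q (S.memLp _ hQ)
  have hφt : IsTempered φ := isTempered_of_memLp le_rfl (memLp_one_iff_integrable.2 φ.integrable)
  have hgφ := (isAbsGrad_schwartz (s := 2) (by norm_num) φ).1
  have hpow : ∀ t : ℝ, 0 ≤ t → t ^ α = (t ^ m) ^ (α / m) := fun t ht => by
    rw [← Real.rpow_mul ht, mul_div_cancel₀ _ hm.ne']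
  have hmem : ∀ t : ℝ, (fun x => Q x + (t : ℂ) * φ x) ∈ 𝒳 ∧
      R (fun x => Q x + (t : ℂ) * φ x) (fun x => u x + (t : ℂ) * T φ x) := fun t =>
    S.add_mul Q hQ φ (S.schwartz φ).1 u (T φ) hu (S.schwartz φ).2 t
  have hNt : ∀ t : ℝ, (N (fun x => Q x + (t : ℂ) * φ x)).toReal ^ m =
      ∫ x, ‖u x + (t : ℂ) * T φ x‖ ^ m := fun t => by
    obtain ⟨h1, h2⟩ := S.rel _ (hmem t).1 _ (hmem t).2
    rw [h2, toReal_eLpNorm_rpow hm h1]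
  have hht : ∀ t : ℝ, (hdotNorm 2 (fun x => Q x + (t : ℂ) * φ x)).toReal ^ 2 =
      ∫ x, ‖g x + (t : ℂ) * absGrad 2 φ x‖ ^ (2 : ℝ) := fun t => by
    have h1 := IsAbsGrad.add hQt (hφt.const_mul t) hg (hgφ.const_mul t)
    have h2 := toReal_eLpNorm_rpow (p := 2) (by norm_num)
      (u := fun x => g x + (t : ℂ) * absGrad 2 φ x) (by rw [ENNReal.ofReal_ofNat]; exact h1.1)
    rw [h1.hdotNorm_eq hd, ← h2, ENNReal.ofReal_ofNat, Real.rpow_two]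
  have hN0 := hNt 0
  have hh0 := hht 0
  simp only [Complex.ofReal_zero, zero_mul, add_zero] at hN0 hh0
  rw [hNX] at hN0
  rw [hY] at hh0
  have dX := hasDerivAt_integral_norm_rpow S.two_le (S.rel Q hQ u hu).1 (S.memLp_T φ)
  have dY := hasDerivAt_integral_norm_rpow (m := 2) le_rfl (u := g) (v := absGrad 2 φ)
    (by rw [ENNReal.ofReal_ofNat]; exact hg.1) (by rw [ENNReal.ofReal_ofNat]; exact hgφ.1)
  have dP := hasDerivAt_integral_norm_rpow (m := α + 2) (by linarith) (S.memLp_p hQ)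
    (φ.memLp (ENNReal.ofReal (α + 2)) volume)
  rw [add_sub_cancel_right] at dP
  have e2 : ∀ x, powerNL (2 - 2 : ℝ) g x = g x := fun x => by simp [powerNL]
  simp only [e2] at dY
  set x' := (∫ x, powerNL (m - 2) u x * (starRingEnd ℂ) (T φ x)).re
  set y' := (∫ x, g x * (starRingEnd ℂ) (absGrad 2 φ x)).re
  set p' := (∫ x, powerNL α Q x * (starRingEnd ℂ) (φ x)).re
  have hX0 : ∫ x, ‖u x + ((0 : ℝ) : ℂ) * T φ x‖ ^ m = X := by simpa using hN0.symm
  have hY0 : ∫ x, ‖g x + ((0 : ℝ) : ℂ) * absGrad 2 φ x‖ ^ (2 : ℝ) = 2 * X / α := by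
    simpa using hh0.symm
  have dX' := dX.rpow_const (p := α / m) (Or.inl (by rw [hX0]; exact hX.ne'))
  have dtot := ((dX'.mul dY).const_mul K).sub dP
  -- The defect of the sharp inequality is nonnegative along the line `Q + tφ` and vanishes at `t =
  -- 0`.
  have hmin : IsLocalMin (fun t : ℝ => K * ((∫ x, ‖u x + (t : ℂ) * T φ x‖ ^ m) ^ (α / m) *
      ∫ x, ‖g x + (t : ℂ) * absGrad 2 φ x‖ ^ (2 : ℝ)) -
        ∫ x, ‖Q x + (t : ℂ) * φ x‖ ^ (α + 2)) 0 := by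
    refine Filter.Eventually.of_forall fun t => ?_
    have h1 := S.integral_le (hmem t).1
    rw [hpow _ ENNReal.toReal_nonneg, hNt, hht] at h1
    rw [hpow _ ENNReal.toReal_nonneg, hNX, hY] at hmax
    simp only [hX0, hY0]
    simp only [Complex.ofReal_zero, zero_mul, add_zero]
    rw [hmax]
    linarith
  have hzero := hmin.hasDerivAt_eq_zero dtot
  rw [hX0, hY0] at hzero
  rw [hpow _ ENNReal.toReal_nonneg, hNX, hY, hP] at hmax
  have hXpow : X ^ (α / m - 1) * X = X ^ (α / m) := by
    rw [Real.rpow_sub_one hX.ne']; field_simp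
  -- With the prescribed `X` and `Y = 2X / α`, all three terms of the derivative acquire the common
  -- factor `α + 2`.
  have hKX : K * X ^ (α / m) = (α + 2) / 2 := by
    field_simp at hmax ⊢
    linarith
  have h3 : K * X ^ (α / m - 1) * X = (α + 2) / 2 := by rw [mul_assoc, hXpow, hKX]
  have h4 : (α + 2) * (x' + y' - p') = 0 := by
    have e : K * (m * x' * (α / m) * X ^ (α / m - 1) * (2 * X / α) + X ^ (α / m) * (2 * y')) -
        (α + 2) * p' = (K * X ^ (α / m - 1) * X) * (2 * x') + (K * X ^ (α / m)) * (2 * y') -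
          (α + 2) * p' := by
      field_simp
    rw [e, h3, hKX] at hzero
    linarith
  exact (mul_eq_zero.1 h4).resolve_left hp.ne'

/-- A maximizer solving the Euler–Lagrange equation with all coefficients equal to one. -/
theorem exists_groundState (S : GNSetting α γ q s m 𝒳 N R T) :
    ∃ Q ∈ 𝒳, gnQuotient α N Q = gnSharp α 𝒳 N ∧
      gnSharp α 𝒳 N = ENNReal.ofReal ((α + 2) / 2) * N Q ^ (-α) ∧ ∃ u, R Q u ∧
      ∀ φ : 𝓢(Space d, ℂ), Integrable (fun x => powerNL (m - 2) u x * T φ x) volume ∧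
        Integrable (fun x => powerNL α Q x * φ x) volume ∧
        (∫ x, Q x * Δ (Δ φ) x) + (∫ x, powerNL (m - 2) u x * T φ x) -
          (∫ x, powerNL α Q x * φ x) = 0 := by
  have hα := S.α_pos
  have hm : 0 < m := by linarith [S.two_le]
  have hp : 0 < α + 2 := by linarith
  obtain ⟨F, hF, hNF, hhF, hPF⟩ := S.exists_maximizer
  set K := (gnSharp α 𝒳 N).toReal with hK
  have hK0 : 0 < K := S.sharp_toReal_pos
  -- The value of `N Q` for which the sharp constant is `(α + 2) / 2 * N Q ^ (-α)`.
  set n : ℝ := ((α + 2) / (2 * K)) ^ (1 / α) with hn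
  have hn0 : 0 < n := by positivity
  have hnα : n ^ α = (α + 2) / (2 * K) := by
    rw [hn, ← Real.rpow_mul (by positivity), one_div_mul_cancel hα.ne', Real.rpow_one]
  set X := n ^ m with hX
  have hX0 : 0 < X := by positivity
  obtain ⟨Q, hQ, hNQ, hhQ, hPQ⟩ := S.exists_rescale hF (by simp [hNF]) (by simp [hhF]) hn0
    (Real.sqrt_pos.2 (by positivity : 0 < 2 * X / α))
  have hNQ' : (N Q).toReal = n := by rw [hNQ, ENNReal.toReal_ofReal hn0.le]
  have hhQ' : (hdotNorm 2 Q).toReal ^ 2 = 2 * X / α := by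
    rw [hhQ, ENNReal.toReal_ofReal (Real.sqrt_nonneg _), Real.sq_sqrt (by positivity)]
  rw [hPF, hNF, hhF, Real.sq_sqrt (by positivity)] at hPQ
  simp only [ENNReal.toReal_one, Real.one_rpow, one_pow, mul_one, div_one] at hPQ
  have hPQ' : ∫ x, ‖Q x‖ ^ (α + 2) = (α + 2) * X / α := by
    rw [hPQ, hnα]; field_simp
  have hmax : ∫ x, ‖Q x‖ ^ (α + 2) = K * ((N Q).toReal ^ α * (hdotNorm 2 Q).toReal ^ 2) := by
    rw [hPQ, hNQ', hhQ']
  have hqt : gnQuotient α N Q ≠ ∞ :=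
    (lt_of_le_of_lt (le_iSup₂_of_le Q hQ le_rfl) S.sharp_lt_top).ne
  refine ⟨Q, hQ, ?_, ?_, ?_⟩
  · rw [← ENNReal.toReal_eq_toReal_iff' hqt S.sharp_lt_top.ne, S.gnQuotient_eq hQ, hmax,
      mul_div_cancel_right₀]
    rw [hNQ', hhQ']
    positivity
  · rw [hNQ, ENNReal.ofReal_rpow_of_pos hn0, ← ENNReal.ofReal_mul (by positivity),
      ← ENNReal.ofReal_toReal S.sharp_lt_top.ne, ← hK, Real.rpow_neg hn0.le, hnα]
    congr 1
    field_simp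
  obtain ⟨u, hu⟩ := S.exists_rel Q hQ
  obtain ⟨g, hg⟩ := S.grad Q hQ
  have hum := (S.rel Q hQ u hu).1
  have hrpow2 : ∀ φ : 𝓢(Space d, ℂ), Integrable (fun x => powerNL α Q x * φ x) volume := fun φ => by
    have := integrable_powerNL_mul (m := α + 2) (by linarith) (S.memLp_p hQ)
      (φ.memLp (ENNReal.ofReal (α + 2)) volume)
    rwa [add_sub_cancel_right] at this
  refine ⟨u, hu, fun φ => ⟨integrable_powerNL_mul S.two_le hum (S.memLp_T φ), hrpow2 φ, ?_⟩⟩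
  -- The relation `-ΔQ = g` is tested against `Δ φ`, which need not lie in `𝓢₀`; hence the need for
  -- `laplaceDefect_eq_zero`.
  have hbi : ∫ x, Q x * Δ (Δ φ) x = ∫ x, g x * absGrad 2 φ x := by
    have h1 := hg.laplaceDefect_eq_zero S.exps.dim (by linarith [S.exps.q_gt] : 1 ≤ q)
      (S.memLp Q hQ) (Δ φ)
    rw [laplaceDefect, sub_eq_zero] at h1
    simp only [absGrad_two, mul_neg, integral_neg] at h1 ⊢
    rw [← h1, neg_neg]
  have key : ∀ φ : 𝓢(Space d, ℂ), ((∫ x, g x * absGrad 2 φ x) +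
      (∫ x, powerNL (m - 2) u x * T φ x) - ∫ x, powerNL α Q x * φ x).re = 0 := by
    intro φ
    obtain ⟨ψ, hψ⟩ := exists_schwartz_conj φ
    have h := S.re_variation hQ hu hg hX0 (by rw [hNQ']) hhQ' hPQ' hmax ψ
    simp only [S.T_conj φ ψ hψ, absGrad_conj 2 hψ, hψ, Complex.conj_conj] at h
    rw [Complex.sub_re, Complex.add_re]
    linarith
  rw [hbi]
  refine Complex.ext (key φ) ?_
  -- Only real parts come from the variation; replacing `φ` by `iφ` supplies the imaginary part.
  have h := key (Complex.I • φ)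
  have e1 : ∫ x, g x * absGrad 2 (Complex.I • φ) x = Complex.I * ∫ x, g x * absGrad 2 φ x := by
    rw [← integral_const_mul]
    refine integral_congr_ae (Filter.Eventually.of_forall fun x => ?_)
    simp only [absGrad_smul]; ring
  have e2 : ∫ x, powerNL (m - 2) u x * T (Complex.I • φ) x =
      Complex.I * ∫ x, powerNL (m - 2) u x * T φ x := by
    rw [← integral_const_mul]
    refine integral_congr_ae (Filter.Eventually.of_forall fun x => ?_)
    simp only [S.T_smul]; ring
  have e3 : ∫ x, powerNL α Q x * (Complex.I • φ) x =
      Complex.I * ∫ x, powerNL α Q x * φ x := by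
    rw [← integral_const_mul]
    refine integral_congr_ae (Filter.Eventually.of_forall fun x => ?_)
    simp only [smul_apply, smul_eq_mul]; ring
  rw [e1, e2, e3, ← mul_add, ← mul_sub, Complex.I_mul_re, neg_eq_zero] at h
  rw [h, Complex.zero_im]

end GNSetting

/-! ### The two settings -/

/-- The order `s = d/2 - d/(α + 2)` is the one with Sobolev exponent `α + 2`. The bounds `γ < 2`, `s
< 2` and `γ < s` are all equivalent to `α (d - 4) < 8`. -/
theorem exponents_of_lt (hd : 1 ≤ d) {α : ℝ} (hα : 8 / (d : ℝ) < α)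
    (hα' : 5 ≤ d → α < 8 / ((d : ℝ) - 4)) :
    0 < α ∧ Exponents d (critSobolev d α) (critLebesgue d α) (d / 2 - d / (α + 2)) (α + 2) := by
  have hd0 : (0 : ℝ) < d := by exact_mod_cast hd
  have hα0 : 0 < α := lt_trans (by positivity) hα
  have h1 : 8 < α * d := by rwa [div_lt_iff₀ hd0] at hα
  have h2 : α * ((d : ℝ) - 4) < 8 := by
    -- For `d ≤ 4` the left side is nonpositive, so no upper bound on `α` is required.
    by_cases h5 : 5 ≤ d
    · have h5' : (5 : ℝ) ≤ d := by exact_mod_cast h5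
      have := hα' h5
      rwa [lt_div_iff₀ (by linarith)] at this
    · have h5' : (d : ℝ) ≤ 4 := by exact_mod_cast (by omega : d ≤ 4)
      nlinarith
  have e1 : 4 / α < d / 2 := by rw [div_lt_div_iff₀ hα0 (by norm_num)]; linarith
  have e2 : (d : ℝ) / 2 - 2 < 4 / α := by rw [lt_div_iff₀ hα0]; linarith
  have e3 : (d : ℝ) / (α + 2) < d / 2 := by
    rw [div_lt_div_iff₀ (by linarith) (by norm_num)]; nlinarith
  have e4 : (d : ℝ) / 2 - 2 < d / (α + 2) := by rw [lt_div_iff₀ (by linarith)]; linarith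
  have e5 : (d : ℝ) / (α + 2) < 4 / α := by
    rw [div_lt_div_iff₀ (by linarith) hα0]; linarith
  have e6 : 0 < 4 / α := by positivity
  have e7 : 0 < (d : ℝ) / (α + 2) := by positivity
  refine ⟨hα0, ⟨hd, ?_, ?_, ?_, ?_, ?_, ?_, ?_, ?_, ?_⟩⟩
  · unfold critSobolev; linarith
  · unfold critSobolev; linarith
  · unfold critSobolev; linarith
  · unfold critSobolev critLebesgue
    rw [show (d : ℝ) - 2 * (d / 2 - 4 / α) = 8 / α by ring]
    field_simp
    norm_num
  · linarith
  · linarith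
  · linarith
  · rw [show (d : ℝ) - 2 * (d / 2 - d / (α + 2)) = 2 * d / (α + 2) by ring]
    field_simp
  · unfold critSobolev; linarith

open Filter in
-- Here `u = f`, and the splitting of `N ^ q` is the Brezis–Lieb lemma along the whole sequence.
theorem gnSetting_lebesgue {α γ q s : ℝ} (E : Exponents d γ q s (α + 2)) (hα : 0 < α)
    (hγ : γ = d / 2 - 4 / α) :
    GNSetting (d := d) α γ q s q (lebesgueSpace d q) (lpNorm q) (fun f u => u = f)
      (fun φ => φ) where
  exps := E
  α_pos := hα
  γ_eq := hγ
  two_le := E.q_gt.le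
  exists_rel f _ := ⟨f, rfl⟩
  rel f hf u hu := by rw [hu]; exact ⟨hf.1, rfl⟩
  memLp f hf := hf.1
  bound := ⟨1, one_pos, fun f _ => by rw [ENNReal.ofReal_one, one_mul]; exact le_rfl⟩
  grad f hf := exists_isAbsGrad_of_hdotNorm_lt hf.2
  add_mul f hf f' hf' u u' hu hu' c := by
    obtain ⟨g, hg⟩ := exists_isAbsGrad_of_hdotNorm_lt hf.2
    obtain ⟨g', hg'⟩ := exists_isAbsGrad_of_hdotNorm_lt hf'.2
    refine ⟨⟨hf.1.add (hf'.1.const_mul c), ?_⟩, by rw [hu, hu']⟩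
    exact (IsAbsGrad.add (isTempered_of_memLp E.one_le_q hf.1)
      ((isTempered_of_memLp E.one_le_q hf'.1).const_mul c) hg (hg'.const_mul c)).hdotNorm_lt E.dim
  affine f hf a lam x₀ hl := by
    obtain ⟨g, hg⟩ := exists_isAbsGrad_of_hdotNorm_lt hf.2
    refine ⟨⟨(memLp_affine hf.1 hl x₀).const_mul a, (hg.affine a hl x₀).hdotNorm_lt E.dim⟩, ?_⟩
    rw [lpNorm, lpNorm, eLpNorm_affine_mul f a hl x₀ E.q_pos, neg_div, E.div_q hα hγ]
  schwartz φ := ⟨⟨φ.memLp _ volume,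
    (isAbsGrad_schwartz (s := 2) (by norm_num) φ).1.hdotNorm_lt E.dim⟩, rfl⟩
  T_smul φ x := by simp
  T_conj φ ψ h x := h x
  compact f F G hf hN hF hG hae _ := by
    refine ⟨⟨hF, hG.hdotNorm_lt E.dim⟩, id, strictMono_id, ?_⟩
    have h1 := tendsto_integral_norm_rpow_sub (p := q) (by linarith [E.q_gt]) (fun n => (hf n).1) hF
      (M := 1) (fun n => by rw [ENNReal.ofReal_one, ← hN n]; exact le_rfl) hae
    have h2 : ∀ n, ∫ x, ‖f n x‖ ^ q = 1 := fun n => by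
      rw [← toReal_eLpNorm_rpow E.q_pos (hf n).1]
      have := hN n
      rw [lpNorm] at this
      rw [this, ENNReal.toReal_one, Real.one_rpow]
    have h3 : (lpNorm q F).toReal ^ q = ∫ x, ‖F x‖ ^ q := toReal_eLpNorm_rpow E.q_pos hF
    rw [h3]
    refine (h1.const_sub 1).congr fun n => ?_
    have e : (fun x => f (id n) x + (-1) * F x) = f n - F := by
      ext x; simp [sub_eq_add_neg]
    rw [h2, sub_sub_cancel, e]
    exact (toReal_eLpNorm_rpow E.q_pos ((hf n).1.sub hF)).symm

/-- Makes `|2πξ|^(-γ) φ` an admissible test function for weak `L²` limits of Fourier transforms. -/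
theorem memLp_inv_absSymbol_mul (hd : 1 ≤ d) {γ : ℝ} (hγ0 : 0 < γ) (hγ : 2 * γ < d)
    (φ : 𝓢(Space d, ℂ)) : MemLp (fun ξ => (absSymbol γ ξ)⁻¹ * φ ξ) 2 volume := by
  have h1 := memLp_indicator_inv_absSymbol hd hγ
  set c := SchwartzMap.seminorm ℝ 0 0 φ
  refine MemLp.of_le ((h1.norm.const_mul c).add (φ.memLp 2 volume).norm)
    ((measurable_absSymbol γ).inv.aestronglyMeasurable.mul φ.continuous.aestronglyMeasurable)
    (Filter.Eventually.of_forall fun ξ => ?_)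
  have hc : ‖φ ξ‖ ≤ c := SchwartzMap.norm_le_seminorm ℝ φ ξ
  have hc0 : 0 ≤ c := (norm_nonneg _).trans hc
  rw [norm_mul]
  simp only [Pi.add_apply]
  rw [Real.norm_of_nonneg (by positivity)]
  by_cases hξ : ‖ξ‖ ≤ 1
  · have hm : ξ ∈ {ξ : Space d | ‖ξ‖ ≤ 1} := hξ
    rw [Set.indicator_of_mem hm, mul_comm]
    exact le_add_of_le_of_nonneg (mul_le_mul_of_nonneg_right hc (norm_nonneg _)) (norm_nonneg _)
  · refine le_add_of_nonneg_of_le (by positivity) ?_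
    refine mul_le_of_le_one_left (norm_nonneg _) ?_
    rw [norm_inv, norm_absSymbol]
    refine inv_le_one_of_one_le₀ (Real.one_le_rpow ?_ hγ0.le)
    nlinarith [Real.pi_gt_three]

theorem exists_fourier_of_mem_sobolevSpace (hd : 1 ≤ d) {γ : ℝ} (hγ0 : 0 < γ) (hγ : 2 * γ < d)
    {f u : Space d → ℂ} (hf : f ∈ sobolevSpace d γ) (hu : IsAbsGrad γ f u) :
    ∃ H, MemLp H 2 volume ∧ eLpNorm H 2 volume = eLpNorm u 2 volume ∧ IsFourierPair u H ∧
      IsFourierPair f (fun ξ => (absSymbol γ ξ)⁻¹ * H ξ) := by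
  obtain ⟨H, h1, h2, h3⟩ := exists_fourier_of_memLp_two hu.1
  exact ⟨H, h1, h3, h2, exists_riesz_representation hd hγ0 hγ hf.1 hf.2.1 hu h2⟩

theorem absSymbol_smul (s : ℝ) {lam : ℝ} (hl : 0 < lam) (ξ : Space d) :
    absSymbol s (lam • ξ) = ((lam ^ s : ℝ) : ℂ) * absSymbol s ξ := by
  rw [absSymbol, absSymbol, ← Complex.ofReal_mul, ← Real.mul_rpow hl.le (by positivity), norm_smul,
    Real.norm_of_nonneg hl.le]
  congr 2
  ring

theorem exists_bound_sobolevSpace {γ q s p : ℝ} (E : Exponents d γ q s p) :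
    ∃ C : ℝ, 0 < C ∧ ∀ f ∈ sobolevSpace d γ,
      eLpNorm f (ENNReal.ofReal q) volume ≤ ENNReal.ofReal C * hdotNorm γ f := by
  obtain ⟨C, hC, h⟩ := exists_sobolev_const E.dim E.γ_pos E.γ_dim E.q_eq
  refine ⟨C, hC, fun f hf => ?_⟩
  obtain ⟨u, hu⟩ := exists_isAbsGrad_of_hdotNorm_lt hf.2.2.1
  obtain ⟨H, h1, h2, h3, h4⟩ := exists_fourier_of_mem_sobolevSpace E.dim E.γ_pos E.γ_dim hf hu
  refine (h _ _ h4).trans (mul_le_mul_right ?_ _)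
  rw [hu.hdotNorm_eq E.dim, ← h2]
  refine eLpNorm_mono fun ξ => ?_
  rw [← mul_assoc, norm_mul]
  refine mul_le_of_le_one_left (norm_nonneg _) ?_
  rw [norm_mul, norm_inv, norm_absSymbol, Complex.norm_real, Real.norm_of_nonneg (by positivity),
    ← div_eq_mul_inv]
  refine div_le_one_of_le₀ ?_ (by positivity)
  refine Real.rpow_le_rpow (norm_nonneg _) ?_ E.γ_pos.le
  nlinarith [Real.pi_gt_three, norm_nonneg ξ]

open Filter in
-- Here `u = |∇|^γ f`. Every closure property is checked on the Riesz representation, and the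
-- splitting of `N ^ 2` is the Hilbert space identity for weak limits.
theorem gnSetting_sobolev {α γ q s : ℝ} (E : Exponents d γ q s (α + 2)) (hα : 0 < α)
    (hγ : γ = d / 2 - 4 / α) :
    GNSetting (d := d) α γ q s 2 (sobolevSpace d γ) (hdotNorm γ) (IsAbsGrad γ)
      (absGrad γ) where
  exps := E
  α_pos := hα
  γ_eq := hγ
  two_le := le_rfl
  exists_rel f hf := exists_isAbsGrad_of_hdotNorm_lt hf.2.2.1
  rel f hf u hu := by rw [ENNReal.ofReal_ofNat]; exact ⟨hu.1, hu.hdotNorm_eq E.dim⟩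
  memLp f hf := by
    obtain ⟨C, -, h⟩ := exists_bound_sobolevSpace E
    exact ⟨hf.1.1, (h f hf).trans_lt (ENNReal.mul_lt_top ENNReal.ofReal_lt_top hf.2.2.1)⟩
  bound := exists_bound_sobolevSpace E
  grad f hf := exists_isAbsGrad_of_hdotNorm_lt hf.2.2.2
  add_mul f hf f' hf' u u' hu hu' c := by
    obtain ⟨g, hg⟩ := exists_isAbsGrad_of_hdotNorm_lt hf.2.2.2
    obtain ⟨g', hg'⟩ := exists_isAbsGrad_of_hdotNorm_lt hf'.2.2.2
    obtain ⟨H, h1, h2, h3, h4⟩ := exists_fourier_of_mem_sobolevSpace E.dim E.γ_pos E.γ_dim hf hu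
    obtain ⟨H', h1', h2', h3', h4'⟩ :=
      exists_fourier_of_mem_sobolevSpace E.dim E.γ_pos E.γ_dim hf' hu'
    refine mem_sobolevSpace_of_riesz E.dim (hu.1.add (hu'.1.const_mul c))
      (h3.add (h3'.const_mul c)) ?_ (IsAbsGrad.add hf.1 (hf'.1.const_mul c) hg (hg'.const_mul c))
    refine (h4.add (h4'.const_mul c)).congr EventuallyEq.rfl (Eventually.of_forall fun ξ => ?_)
    ring
  affine f hf a lam x₀ hl := by
    obtain ⟨u, hu⟩ := exists_isAbsGrad_of_hdotNorm_lt hf.2.2.1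
    obtain ⟨g, hg⟩ := exists_isAbsGrad_of_hdotNorm_lt hf.2.2.2
    obtain ⟨H, h1, h2, h3, h4⟩ := exists_fourier_of_mem_sobolevSpace E.dim E.γ_pos E.γ_dim hf hu
    have hu' := hu.affine a hl x₀
    have h4' := (h4.affine hl x₀).const_mul a
    refine ⟨(mem_sobolevSpace_of_riesz E.dim hu'.1
      ((h3.affine hl x₀).const_mul (a * ((lam ^ γ : ℝ) : ℂ))) ?_ (hg.affine a hl x₀)).1, ?_⟩
    · refine h4'.congr EventuallyEq.rfl (Eventually.of_forall fun ξ => ?_)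
      have hlγ : ((lam ^ γ : ℝ) : ℂ) ≠ 0 :=
        Complex.ofReal_ne_zero.2 (Real.rpow_pos_of_pos hl γ).ne'
      have e : absSymbol γ ξ = ((lam ^ γ : ℝ) : ℂ) * absSymbol γ (lam⁻¹ • ξ) := by
        rw [← absSymbol_smul γ hl, smul_inv_smul₀ hl.ne']
      simp only []
      rw [e, mul_inv]
      field_simp
    · rw [hu'.hdotNorm_eq E.dim, hu.hdotNorm_eq E.dim]
      have := eLpNorm_affine_mul u (a * ((lam ^ γ : ℝ) : ℂ)) hl x₀ (p := 2) (by norm_num)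
      rw [ENNReal.ofReal_ofNat] at this
      rw [this, norm_mul, Complex.norm_real, Real.norm_of_nonneg (by positivity), mul_assoc,
        ← Real.rpow_add hl]
      congr 4
      rw [hγ]; ring
  schwartz φ := by
    have : Nonempty (Fin d) := ⟨⟨0, E.dim⟩⟩
    obtain ⟨h1, h2⟩ := isAbsGrad_schwartz E.γ_pos.le φ
    refine mem_sobolevSpace_of_riesz E.dim h1.1 h2 ?_
      (isAbsGrad_schwartz (s := 2) (by norm_num) φ).1
    refine (isFourierPair_fourier φ.integrable).congr EventuallyEq.rfl ?_
    filter_upwards [compl_mem_ae_iff.2 (measure_singleton (0 : Space d))] with ξ hξ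
    rw [inv_mul_cancel_left₀ (absSymbol_ne_zero γ hξ)]
  T_smul φ x := absGrad_smul γ Complex.I φ x
  T_conj φ ψ h x := absGrad_conj γ h x
  compact f F G hf hN hF hG hae hψ := by
    choose u hu using fun n => exists_isAbsGrad_of_hdotNorm_lt (hf n).2.2.1
    choose H h1 h2 h3 h4 using fun n =>
      exists_fourier_of_mem_sobolevSpace E.dim E.γ_pos E.γ_dim (hf n) (hu n)
    have hu1 : ∀ n, eLpNorm (u n) 2 volume = 1 := fun n => by
      rw [← (hu n).hdotNorm_eq E.dim, hN]
    obtain ⟨k₁, hk₁, h, hh⟩ := exists_weakLim (fun n => (hu n).1) zero_le_one fun n => by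
      rw [hu1, ENNReal.ofReal_one]
    obtain ⟨k₂, hk₂, W, hW⟩ := exists_weakLim (fun n => h1 (k₁ n)) zero_le_one fun n => by
      rw [h2, hu1, ENNReal.ofReal_one]
    -- The weak limits of `u n` and of their transforms form a Fourier pair, as both sides of the
    -- duality relation pass to the limit.
    have hhW : IsFourierPair h W := by
      refine ⟨isTempered_of_memLp (by norm_num) hh.1, isTempered_of_memLp (by norm_num) hW.1,
        fun φ => ?_⟩
      have l1 := (hh.comp hk₂).2 _ ((𝓕 φ : 𝓢(Space d, ℂ)).memLp 2 volume)
      have l2 := hW.2 _ (φ.memLp 2 volume)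
      exact tendsto_nhds_unique l1 (l2.congr fun n => ((h3 (k₁ (k₂ n))).2.2 φ).symm)
    obtain ⟨f', hf'⟩ := exists_isFourierPair_div E.dim E.γ_pos E.γ_dim hW.1
    -- The Riesz representation passes to the limit, so `F` has no polynomial part and its `|∇|^γ`
    -- is `h`.
    have hFW : IsFourierPair F (fun ξ => (absSymbol γ ξ)⁻¹ * W ξ) := by
      refine ⟨isTempered_of_memLp E.one_le_q hF, hf'.2.1, fun φ => ?_⟩
      have l1 := ((hψ (𝓕 φ)).comp hk₁.tendsto_atTop).comp hk₂.tendsto_atTop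
      have l2 := hW.2 _ (memLp_inv_absSymbol_mul E.dim E.γ_pos E.γ_dim φ)
      have e : ∀ (V : Space d → ℂ), ∫ ξ, V ξ * ((absSymbol γ ξ)⁻¹ * φ ξ) =
          ∫ ξ, (absSymbol γ ξ)⁻¹ * V ξ * φ ξ := fun V =>
        integral_congr_ae (Eventually.of_forall fun ξ => by ring)
      rw [e] at l2
      refine tendsto_nhds_unique l1 (l2.congr fun n => ?_)
      rw [e]
      exact ((h4 (k₁ (k₂ n))).2.2 φ).symm
    obtain ⟨hFX, hFh⟩ := mem_sobolevSpace_of_riesz E.dim hh.1 hhW hFW hG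
    -- The second extraction served only to identify `F`; weak convergence of `u` already holds
    -- along `k₁`.
    refine ⟨hFX, k₁, hk₁, ?_⟩
    have hlim := hh.tendsto_norm_sub (fun n => (hu (k₁ n)).1) fun n => hu1 (k₁ n)
    rw [hFh.hdotNorm_eq E.dim]
    simp only [Real.rpow_two]
    refine hlim.congr fun n => ?_
    have e : (fun x => f (k₁ n) x + (-1) * F x) = fun x => f (k₁ n) x - F x := by
      ext x; ring
    rw [e, (IsAbsGrad.sub (hf (k₁ n)).1 hFX.1 (hu (k₁ n)) hFh).hdotNorm_eq E.dim]

end BiharmonicGN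

end

/-! ### Conclusion for the two sharp constants. -/

open BiharmonicGN in
theorem mainTheorem2 (d : ℕ) (hd : 1 ≤ d) (α : ℝ) (hα : 8 / (d : ℝ) < α)
    (hα' : 5 ≤ d → α < 8 / ((d : ℝ) - 4)) :
    (0 < sharpA d α ∧ sharpA d α < ∞ ∧
      (∀ f ∈ sobolevSpace d (critSobolev d α),
        lpNorm (α + 2) f ^ (α + 2) ≤
          sharpA d α * (hdotNorm (critSobolev d α) f ^ α * hdotNorm 2 f ^ 2)) ∧
      ∃ U ∈ sobolevSpace d (critSobolev d α), quotientH α U = sharpA d α ∧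
        ∃ Q ∈ sobolevSpace d (critSobolev d α), SolvesSobolev α (critSobolev d α) Q ∧
          (∃ a : ℂ, a ≠ 0 ∧ ∃ lam : ℝ, 0 < lam ∧ ∃ x₀ : Space d,
            U = fun x => a * Q (lam • x + x₀)) ∧
          sharpA d α = ENNReal.ofReal ((α + 2) / 2) * hdotNorm (critSobolev d α) Q ^ (-α)) ∧
    (0 < sharpB d α ∧ sharpB d α < ∞ ∧
      (∀ f ∈ lebesgueSpace d (critLebesgue d α),
        lpNorm (α + 2) f ^ (α + 2) ≤
          sharpB d α * (lpNorm (critLebesgue d α) f ^ α * hdotNorm 2 f ^ 2)) ∧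
      ∃ V ∈ lebesgueSpace d (critLebesgue d α), quotientK α V = sharpB d α ∧
        ∃ R ∈ lebesgueSpace d (critLebesgue d α), SolvesLebesgue α (critLebesgue d α) R ∧
          (∃ b : ℂ, b ≠ 0 ∧ ∃ μ : ℝ, 0 < μ ∧ ∃ y₀ : Space d,
            V = fun x => b * R (μ • x + y₀)) ∧
          sharpB d α = ENNReal.ofReal ((α + 2) / 2) * lpNorm (critLebesgue d α) R ^ (-α)) := by
  obtain ⟨hα0, E⟩ := exponents_of_lt hd hα hα'
  have SA := gnSetting_sobolev E hα0 rfl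
  have SB := gnSetting_lebesgue E hα0 rfl
  -- The normalized ground states are themselves maximizers, so the identity affine map suffices.
  have self : ∀ Q : Space d → ℂ, ∃ a : ℂ, a ≠ 0 ∧ ∃ lam : ℝ, 0 < lam ∧ ∃ x₀ : Space d,
      Q = fun x => a * Q (lam • x + x₀) := fun Q =>
    ⟨1, one_ne_zero, 1, one_pos, 0, by simp⟩
  obtain ⟨Q, hQ, hQ1, hQ2, u, hu, hQE⟩ := SA.exists_groundState
  obtain ⟨V, hV, hV1, hV2, v, hv, hVE⟩ := SB.exists_groundState
  refine ⟨⟨SA.sharp_pos, SA.sharp_lt_top, fun f hf => SA.le_sharp hf, Q, hQ, hQ1, Q, hQ,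
    ⟨u, hu, fun φ => ⟨(hQE φ).2.1, ?_⟩⟩, self Q, hQ2⟩,
    ⟨SB.sharp_pos, SB.sharp_lt_top, fun f hf => SB.le_sharp hf, V, hV, hV1, V, hV,
      fun φ => ?_, self V, hV2⟩⟩
  · have h := (hQE φ).2.2
    -- Here `m = 2`, so the nonlinearity of exponent `m - 2 = 0` is `u` itself.
    simpa [powerNL] using h
  · have h := hVE φ
    rw [hv] at h
    exact h
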